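/- Corollary 1.7. Let $\nu$ be a non-zero finite Borel measure on $(0,1)$. For $n\ge 1$ and $q\in\mathbb R$ put $\beta_n(q)=\frac{1}{\log 2^n}\log\sum_C \nu(C)^q$, the sum being over those dyadic intervals $C=(k2^{-n},(k+1)2^{-n}]$, $0\le k<2^n$, with $\nu(C)>0$, and let $\beta_\nu(q)=\limsup_{n}\beta_n(q)\in(-\infty,+\infty]$ be the $L^q$-spectrum of $\nu$. For all large $n$ the function $\beta_n$ has a unique fixed point $q_n$; put $\overline q_\nu=\limsup_n q_n$. Put $\delta^*_\nu=\beta_\nu(0)$ (this is the upper Minkowski dimension of $\operatorname{supp}\nu$) and $$\overline\delta_\nu=\lim_{t\nearrow 1}\frac{\beta_\nu(t)}{1-t},\qquad \underline\delta_\nu=\lim_{t\searrow 1}\frac{\beta_\nu(t)}{1-t}.$$ Let $\mathcal E_\nu(f,g)=\int_0^1 f'g'\,d\Lambda$ be the Dirichlet form with domain consisting of all $f\in H^1_0(0,1)$ that are affine on each connected component of $[0,1]\setminus\operatorname{supp}\nu$. A number $\lambda$ is an eigenvalue, with eigenfunction $f\ne0$ in this domain, if $\mathcal E_\nu(f,g)=\lambda\int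 fg\,d\nu$ for all $g$ in the domain. Let $N_\nu(x)$ be the number of eigenvalues not exceeding $x$, counted with multiplicity. The spectral dimension of $\nu$ is $s_\nu=\lim_{x\to\infty}\frac{\log N_\nu(x)}{\log x}$, if this limit exists. Call $\nu$ $L^q$-regular if either there is $\varepsilon>0$ with $\beta_\nu(q)=\liminf_n\beta_n(q)$ for all $q\in(\overline q_\nu-\varepsilon,\overline q_\nu)$, or $\beta_\nu(\overline q_\nu)=\liminf_n\beta_n(\overline q_\nu)$ and $\beta_\nu$ is differentiable at $\overline q_\nu$. Let $\overline{\dim}_M(\nu)$ be the upper Minkowski dimension of $\operatorname{supp}\nu$ and let $$\dim_H(\nu)=\inf\{\dim_H A:\nu(A^c)=0\},\quad \underline{\dim}_H(\nu)=\inf\{\dim_H E:\nu(E)>0\},\quad \dim_P(\nu)=\inf\{\dim_P A:\nu(A^c)=0\}$$ (infima over Borel sets), with $\dim_H$ the Hausdorff and $\dim_P$ the packing dimension of a set. Suppose that $\nu$ is $L^q$-regular. Then the spectral dimension $s_\nu$ exists, and: 1. $\overline\delta_\nu=\delta^*_\nu$ if and only if $s_\nu=\dfrac{\delta^*_\nu}{1+\delta^*_\nu}$;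 in particular, $\underline\delta_\nu=\delta^*_\nu$ implies $s_\nu=\dfrac{\delta^*_\nu}{1+\delta^*_\nu}$. 2. If $\overline{\dim}_M(\nu)=\dim_H(\nu)$, then $s_\nu=\dfrac{\delta^*_\nu}{1+\delta^*_\nu}$. 3. If $\beta_\nu$ is differentiable at $1$ and $s_\nu=\dfrac{\delta^*_\nu}{1+\delta^*_\nu}$, then $\overline{\dim}_M(\nu)=\dim_H(\nu)=\underline{\dim}_H(\nu)=\dim_P(\nu)$. -/

import Mathlib

open MeasureTheory Set Filter Topology
open scoped ENNReal NNReal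

noncomputable section

namespace KreinFeller

/-! ## Dirichlet form and spectral dimension on the unit interval -/

/-- `g` is the square integrable weak derivative of `f` on `[0,1]`; the existence of such a `g`
says that `f` belongs to `H¹(0,1)`. -/
def HasWeakDeriv (f g : ℝ → ℝ) : Prop :=
  MemLp g 2 (volume.restrict (Icc (0 : ℝ) 1)) ∧
    ∀ x ∈ Icc (0 : ℝ) 1, f x = f 0 + ∫ t in (0 : ℝ)..x, g t

open Classical in
/-- A representative of the (almost everywhere unique) weak derivative of `f`. -/
def weakDeriv (f : ℝ → ℝ) : ℝ → ℝ :=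
  if h : ∃ g, HasWeakDeriv f g then h.choose else 0

/-- The domain `H¹₀(0,1) ∩ C_ν([0,1])` of the form.  Functions on `[0,1]` are represented by
their extension by zero to `ℝ`.  The last clause says that `f` is affine on the connected
components of `[0,1] \ supp ν`: these are the maximal intervals contained in that set. -/
def formDomain (ν : Measure ℝ) : Set (ℝ → ℝ) :=
  {f | (∃ g, HasWeakDeriv f g) ∧ f 0 = 0 ∧ f 1 = 0 ∧ (∀ x ∉ Icc (0 : ℝ) 1, f x = 0) ∧
    ∀ J : Set ℝ, J.OrdConnected → J ⊆ Icc 0 1 \ ν.support →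
      ∃ p q : ℝ, ∀ z ∈ J, f z = p * z + q}

/-- The form `𝓔(f,h) = ∫₀¹ f' h' dΛ`. -/
def energy (f h : ℝ → ℝ) : ℝ :=
  ∫ t in (0 : ℝ)..1, weakDeriv f t * weakDeriv h t

/-- `f` is an eigenfunction of the Dirichlet form of `ν` with eigenvalue `lam`. -/
def IsEigenfunction (ν : Measure ℝ) (lam : ℝ) (f : ℝ → ℝ) : Prop :=
  f ∈ formDomain ν ∧ f ≠ 0 ∧
    ∀ h ∈ formDomain ν, energy f h = lam * ∫ t, f t * h t ∂ν

/-- The eigenvalue counting function: the number of eigenvalues not exceeding `x`, counted with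
multiplicity, that is, the dimension of the span of all eigenfunctions whose eigenvalue is at
most `x` (eigenfunctions with distinct eigenvalues are orthogonal in `L²(ν)`, so the eigenspaces
form a direct sum). -/
def eigenvalueCount (ν : Measure ℝ) (x : ℝ) : ℕ :=
  Module.finrank ℝ (Submodule.span ℝ {f : ℝ → ℝ | ∃ lam ≤ x, IsEigenfunction ν lam f})

/-- The spectral dimension of `ν` exists and equals `s`, i.e. the lower and upper exponents of
divergence of the eigenvalue counting function are both equal to `s`. -/
def HasSpectralDim (ν : Measure ℝ) (s : ℝ) : Prop :=
  Tendsto (fun x : ℝ => Real.log (eigenvalueCount ν x) / Real.log x) atTop (𝓝 s)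

/-! ## The `L^q`-spectrum -/

/-- The dyadic interval `(k 2⁻ⁿ, (k+1) 2⁻ⁿ]`. -/
def dyadic (n k : ℕ) : Set ℝ := Ioc ((k : ℝ) / 2 ^ n) (((k : ℝ) + 1) / 2 ^ n)

open Classical in
/-- `β_n(q) = (log 2ⁿ)⁻¹ log ∑ ν(C)^q`, summed over the dyadic intervals `C` of order `n` in
`(0,1]` of positive measure. -/
def betaN (ν : Measure ℝ) (n : ℕ) (q : ℝ) : ℝ :=
  Real.log (∑ k ∈ (Finset.range (2 ^ n)).filter (fun k => 0 < ν (dyadic n k)),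
    (ν.real (dyadic n k)) ^ q) / Real.log (2 ^ n)

/-- The `L^q`-spectrum `β(q) = limsup β_n(q)`.  It is finite for `q ≥ 0`, and may be `+∞` for
negative `q`. -/
def beta (ν : Measure ℝ) (q : ℝ) : EReal :=
  limsup (fun n : ℕ => (betaN ν n q : EReal)) atTop

/-- `liminf β_n(q)`. -/
def betaLower (ν : Measure ℝ) (q : ℝ) : EReal :=
  liminf (fun n : ℕ => (betaN ν n q : EReal)) atTop

/-- The fixed point of `β_n`.  For all large `n` the function `β_n` has exactly one fixed point,
so that the set below is a singleton. -/
def fixedPoint (ν : Measure ℝ) (n : ℕ) : ℝ := sInf {q : ℝ | betaN ν n q = q}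

/-- `q̄ = limsup q_n`, with `q_n` the fixed point of `β_n` (`q_n ∈ [0,1)` for all large `n`). -/
def qBar (ν : Measure ℝ) : ℝ := limsup (fun n : ℕ => fixedPoint ν n) atTop

/-- `β` is differentiable at `q`: it is finite near `q` and differentiable there. -/
def BetaDifferentiableAt (ν : Measure ℝ) (q : ℝ) : Prop :=
  (∀ᶠ t in 𝓝 q, beta ν t ≠ ⊤ ∧ beta ν t ≠ ⊥) ∧
    DifferentiableAt ℝ (fun t => (beta ν t).toReal) q

/-- `ν` is `L^q`-regular. -/
def IsLqRegular (ν : Measure ℝ) : Prop :=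
  (∃ ε > 0, ∀ q ∈ Ioo (qBar ν - ε) (qBar ν), beta ν q = betaLower ν q) ∨
    (beta ν (qBar ν) = betaLower ν (qBar ν) ∧ BetaDifferentiableAt ν (qBar ν))

/-- `δ* = β(0)`, a number in `[0,1]`. -/
def deltaStar (ν : Measure ℝ) : ℝ := (beta ν 0).toReal

/-- `δ̄ = d`, where `δ̄ = lim_{t ↗ 1} β(t) / (1 - t)`. -/
def DeltaUpperEq (ν : Measure ℝ) (d : ℝ) : Prop :=
  Tendsto (fun t : ℝ => (beta ν t).toReal / (1 - t)) (𝓝[<] 1) (𝓝 d)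

/-- `δ̲ = d`, where `δ̲ = lim_{t ↘ 1} β(t) / (1 - t)`. -/
def DeltaLowerEq (ν : Measure ℝ) (d : ℝ) : Prop :=
  Tendsto (fun t : ℝ => (beta ν t).toReal / (1 - t)) (𝓝[>] 1) (𝓝 d)

/-! ## Dimensions of sets and measures -/

/-- The upper Minkowski (box-counting) dimension `limsup_{ε → 0} log N_ε(A) / log (1/ε)`, with
`N_ε(A)` the least number of closed balls of radius `ε` that cover `A`. -/
def upperMinkowskiDim (A : Set ℝ) : ℝ≥0∞ :=
  (limsup (fun ε : ℝ≥0 => ENNReal.log ((Metric.externalCoveringNumber ε A : ℕ∞) : ℝ≥0∞) /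
    ((-Real.log (ε : ℝ) : ℝ) : EReal)) (𝓝[>] 0)).toENNReal

/-- The packing dimension: the infimum, over countable covers `(F i)` of `A`, of the supremum of
the upper Minkowski dimensions of the pieces (unbounded pieces have dimension `∞`). -/
def packingDim (A : Set ℝ) : ℝ≥0∞ :=
  ⨅ (F : ℕ → Set ℝ) (_ : A ⊆ ⋃ i, F i), ⨆ i, upperMinkowskiDim (F i)

/-- The upper Minkowski dimension of `ν` is that of its support. -/
def measureMinkowskiDim (ν : Measure ℝ) : ℝ≥0∞ := upperMinkowskiDim ν.support

/-- The Hausdorff dimension of `ν`, `inf {dim_H A : ν(Aᶜ) = 0}` over Borel sets. -/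
def measureHausdorffDim (ν : Measure ℝ) : ℝ≥0∞ :=
  ⨅ (A : Set ℝ) (_ : MeasurableSet A) (_ : ν Aᶜ = 0), dimH A

/-- The lower Hausdorff dimension of `ν`, `inf {dim_H E : ν(E) > 0}` over Borel sets. -/
def measureLowerHausdorffDim (ν : Measure ℝ) : ℝ≥0∞ :=
  ⨅ (E : Set ℝ) (_ : MeasurableSet E) (_ : 0 < ν E), dimH E

/-- The packing dimension of `ν`, `inf {dim_P A : ν(Aᶜ) = 0}` over Borel sets. -/
def measurePackingDim (ν : Measure ℝ) : ℝ≥0∞ :=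
  ⨅ (A : Set ℝ) (_ : MeasurableSet A) (_ : ν Aᶜ = 0), packingDim A

end KreinFeller

end

/-! The core is that an `L^q`-regular measure has spectral dimension `q̄`. The rest is convexity of
`β` on `[0,∞)`, together with `β(1) = 0`, and the meaning of the slopes of `β` at `1` for the
dimensions of `ν`.

Passing from `f` to `f'` identifies the form domain with a closed subspace of `L²[0,1]` on which the
energy is the inner product. Eigenvalues become reciprocals of the positive eigenvalues of the
compact operator `formOperator`, so `N(x)` is the dimension of a spectral subspace.

Upper bound. A function vanishing at the endpoints of a dyadic cell `C` has squared `L²(ν)`-norm on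
`C` at most `ν(C)Λ(C)` times its energy there. Vanishing at the midpoints of all cells with
`ν(C)Λ(C) ≥ t` therefore makes the Rayleigh quotient at most `t`, and `N(x)` is at most the number
of these cells when `t < 1/x`. By Markov's inequality this number is at most `t^{-q} ∑ₙ 2^{-nq} ∑
ν(C)^q`, and the series converges for `q > q̄`.

Lower bound. Well separated cells of order `n` and mass at least `m` carry tent functions with
non-overlapping supports, and each gives an eigenvalue below about `2^{n+1}/m`. At a point `q` where
`β` has derivative `-a` and upper and lower limits agree, a Chernoff argument yields about
`2^{n(β(q)+aq)}` cells of mass about `2^{-na}`. Choosing `2^{n(1+a)} ≈ x` gives the growth exponent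
`(β(q)+aq)/(1+a)`, which is at least `q` if `β(q) ≥ q`. Regularity provides such `q` at or just
below `q̄`; in the first alternative this uses that monotone functions are differentiable almost
everywhere.

Consequences. On `[0,1]` the graph of `β` lies below the chord `δ*(1-t)`, which meets the diagonal
at `δ*/(1+δ*)`. A positive `q̄` is a fixed point of `β`, so `q̄` has this value exactly when `β` is
affine on `[0,1]`, that is, when the chord slopes into `1` stay equal to `δ*`. By Borel-Cantelli,
chords left of `1` bound `dim_H ν` from above; chords right of `1`, through the mass distribution
principle, bound the lower Hausdorff dimension from below. Since the Minkowski dimension is `δ*`,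
equality with `dim_H` forces affineness. Conversely, affineness and differentiability at `1` close a
cycle of inequalities between all four dimensions. -/

noncomputable section

namespace KreinFeller

/-! ## Rayleigh quotients of compact self-adjoint operators -/

section Spectral

open Module.End

variable {H : Type*} [NormedAddCommGroup H] [InnerProductSpace ℝ H]

/-- The span of all eigenvectors of `A` with eigenvalue in `s`. -/
def spectralSubspace (A : H →L[ℝ] H) (s : Set ℝ) : Submodule ℝ H :=
  ⨆ μ : s, eigenspace (A : Module.End ℝ H) (μ : ℝ)

/-- Eigenspaces of a symmetric operator for distinct eigenvalues are orthogonal, so both quadratic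
forms are diagonal in a finite eigenvector decomposition. No compactness is involved. -/
lemma exists_rayleigh_sum {A : H →L[ℝ] H} (hA : (A : H →ₗ[ℝ] H).IsSymmetric) {s : Set ℝ} {x : H}
    (hx : x ∈ spectralSubspace A s) :
    ∃ (t : Finset s) (f : s → H), inner ℝ (A x) x = ∑ i ∈ t, (i : ℝ) * ‖f i‖ ^ 2 ∧
      ‖x‖ ^ 2 = ∑ i ∈ t, ‖f i‖ ^ 2 := by
  classical
  obtain ⟨f, hf, rfl⟩ := (Submodule.mem_iSup_iff_exists_finsupp _ _).1 hx
  have horth : ∀ i j : s, i ≠ j → inner ℝ (f i) (f j) = 0 := fun i j hij =>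
    hA.orthogonalFamily_eigenspaces (i := (i : ℝ)) (j := (j : ℝ))
      (fun h => hij (Subtype.ext h)) ⟨f i, hf i⟩ ⟨f j, hf j⟩
  have hAf : ∀ i, A (f i) = (i : ℝ) • f i := fun i => mem_eigenspace_iff.1 (hf i)
  refine ⟨f.support, f, ?_, ?_⟩
  · rw [Finsupp.sum, map_sum, sum_inner]
    refine Finset.sum_congr rfl fun i hi => ?_
    rw [inner_sum, Finset.sum_eq_single i]
    · rw [hAf, inner_smul_left, real_inner_self_eq_norm_sq]; simp
    · intro j _ hji
      rw [hAf, inner_smul_left, horth i j (Ne.symm hji), mul_zero]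
    · intro h; exact absurd hi h
  · rw [← real_inner_self_eq_norm_sq, Finsupp.sum, sum_inner]
    refine Finset.sum_congr rfl fun i hi => ?_
    rw [inner_sum, Finset.sum_eq_single i]
    · rw [real_inner_self_eq_norm_sq]
    · intro j _ hji
      exact horth i j (Ne.symm hji)
    · intro h; exact absurd hi h

lemma le_inner_of_mem_spectralSubspace {A : H →L[ℝ] H} (hA : (A : H →ₗ[ℝ] H).IsSymmetric) {c : ℝ}
    {x : H} (hx : x ∈ spectralSubspace A (Ici c)) : c * ‖x‖ ^ 2 ≤ inner ℝ (A x) x := by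
  obtain ⟨t, f, h1, h2⟩ := exists_rayleigh_sum hA hx
  rw [h1, h2, Finset.mul_sum]
  exact Finset.sum_le_sum fun i _ => mul_le_mul_of_nonneg_right i.2 (sq_nonneg _)

lemma inner_le_of_mem_spectralSubspace {A : H →L[ℝ] H} (hA : (A : H →ₗ[ℝ] H).IsSymmetric) {c : ℝ}
    {x : H} (hx : x ∈ spectralSubspace A (Iio c)) : inner ℝ (A x) x ≤ c * ‖x‖ ^ 2 := by
  obtain ⟨t, f, h1, h2⟩ := exists_rayleigh_sum hA hx
  rw [h1, h2, Finset.mul_sum]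
  exact Finset.sum_le_sum fun i _ => mul_le_mul_of_nonneg_right (le_of_lt i.2) (sq_nonneg _)

lemma spectralSubspace_orthogonal {A : H →L[ℝ] H} (hA : (A : H →ₗ[ℝ] H).IsSymmetric) {s t : Set ℝ}
    (hst : Disjoint s t) : spectralSubspace A s ⟂ spectralSubspace A t := by
  unfold spectralSubspace
  rw [Submodule.isOrtho_iSup_left]
  intro i
  rw [Submodule.isOrtho_iSup_right]
  intro j
  have hij : (i : ℝ) ≠ j := fun h => Set.disjoint_left.1 hst i.2 (h ▸ j.2)
  exact hA.orthogonalFamily_eigenspaces.isOrtho hij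

/-- On the orthogonal complement of the eigenvectors with eigenvalue at least `c`, the Rayleigh
quotient is at most `c`. -/
lemma inner_le_of_mem_spectralSubspace_orthogonal [CompleteSpace H] {A : H →L[ℝ] H}
    (hA : (A : H →ₗ[ℝ] H).IsSymmetric) (hc : IsCompactOperator A) {c : ℝ} {x : H}
    (hx : x ∈ (spectralSubspace A (Ici c))ᗮ) : inner ℝ (A x) x ≤ c * ‖x‖ ^ 2 := by
  set R := spectralSubspace A (Iio c) with hR
  set S := spectralSubspace A (Ici c) with hS
  have hRS : R ⟂ S := spectralSubspace_orthogonal hA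
    (Set.disjoint_left.2 fun a ha hb => absurd (mem_Iio.1 ha) (not_lt.2 hb))
  -- Compactness enters here: the eigenspaces together have dense span. A vector orthogonal to `S`
  -- is then in the closure of `R`, where the bound holds by continuity.
  have hbot : (R ⊔ S)ᗮ = ⊥ := by
    rw [eq_bot_iff, ← ContinuousLinearMap.orthogonalComplement_iSup_eigenspaces_eq_bot hc hA]
    refine Submodule.orthogonal_le (iSup_le fun μ => ?_)
    rcases lt_or_ge μ c with h | h
    · exact (le_iSup (fun μ : Iio c => eigenspace (A : Module.End ℝ H) (μ : ℝ)) ⟨μ, h⟩).trans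
        le_sup_left
    · exact (le_iSup (fun μ : Ici c => eigenspace (A : Module.End ℝ H) (μ : ℝ)) ⟨μ, h⟩).trans
        le_sup_right
  have hcl : R.topologicalClosure ≤ Sᗮ :=
    Submodule.topologicalClosure_minimal _ hRS (Submodule.isClosed_orthogonal _)
  have hx' : x ∈ R.topologicalClosure := by
    have : CompleteSpace R.topologicalClosure :=
      (Submodule.isClosed_topologicalClosure R).completeSpace_coe
    obtain ⟨r, hr, u, hu, rfl⟩ :=
      Submodule.exists_add_mem_mem_orthogonal (K := R.topologicalClosure) x
    have hu0 : u = 0 := by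
      have h1 : u ∈ Sᗮ := by
        have := Submodule.sub_mem _ hx (hcl hr)
        simpa using this
      have h2 : u ∈ Rᗮ := Submodule.orthogonal_le R.le_topologicalClosure hu
      have : u ∈ (R ⊔ S)ᗮ := by
        rw [← Submodule.inf_orthogonal]; exact ⟨h2, h1⟩
      rw [hbot] at this
      simpa using this
    simpa [hu0] using hr
  have hclosed : IsClosed {y : H | inner ℝ (A y) y ≤ c * ‖y‖ ^ 2} :=
    isClosed_le (by fun_prop) (by fun_prop)
  exact closure_minimal (s := (R : Set H)) (fun y hy => inner_le_of_mem_spectralSubspace hA hy)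
    hclosed hx'

end Spectral

/-! ## Primitives of square integrable functions on the unit interval -/

/-- Lebesgue measure on `[0,1]`. -/
abbrev unitMeasure : Measure ℝ := volume.restrict (Icc (0 : ℝ) 1)

/-- The Hilbert space `L²[0,1]`, whose elements play the role of derivatives. -/
abbrev UnitL2 : Type := Lp ℝ 2 unitMeasure

/-- The indicator function of `(0,x]` in `L²[0,1]`. -/
def initialIndicator (x : ℝ) : UnitL2 :=
  indicatorConstLp 2 (measurableSet_Ioc (a := (0 : ℝ)) (b := x)) (measure_ne_top unitMeasure _) 1

/-- The primitive of `g` vanishing at `0`; it is constant on `(-∞,0]` and on `[1,∞)`. -/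
def primitive (g : UnitL2) (x : ℝ) : ℝ := inner ℝ (initialIndicator x) g

/-- The primitive as a linear map. -/
def primitiveₗ : UnitL2 →ₗ[ℝ] (ℝ → ℝ) where
  toFun := primitive
  map_add' g h := by ext x; simp [primitive, inner_add_right]
  map_smul' c g := by ext x; simp [primitive, inner_smul_right]

@[simp] lemma primitiveₗ_apply (g : UnitL2) : primitiveₗ g = primitive g := rfl

lemma primitive_add (g h : UnitL2) (x : ℝ) :
    primitive (g + h) x = primitive g x + primitive h x := by
  simp [primitive, inner_add_right]

lemma primitive_sub (g h : UnitL2) (x : ℝ) :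
    primitive (g - h) x = primitive g x - primitive h x := by
  simp [primitive, inner_sub_right]

lemma primitive_smul (c : ℝ) (g : UnitL2) (x : ℝ) :
    primitive (c • g) x = c * primitive g x := by
  simp [primitive, inner_smul_right]

lemma primitive_eq_setIntegral (g : UnitL2) (x : ℝ) :
    primitive g x = ∫ t in Ioc 0 x, g t ∂unitMeasure :=
  L2.inner_indicatorConstLp_one measurableSet_Ioc _ g

lemma restrict_unitMeasure_Ioc {x y : ℝ} (hx : 0 ≤ x) (hy : y ≤ 1) :
    unitMeasure.restrict (Ioc x y) = volume.restrict (Ioc x y) := by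
  rw [Measure.restrict_restrict measurableSet_Ioc]
  congr 1
  exact inter_eq_left.2 fun t ht => ⟨hx.trans ht.1.le, ht.2.trans hy⟩

lemma primitive_eq_intervalIntegral (g : UnitL2) {x : ℝ} (hx : x ∈ Icc (0 : ℝ) 1) :
    primitive g x = ∫ t in (0 : ℝ)..x, g t := by
  rw [primitive_eq_setIntegral, intervalIntegral.integral_of_le hx.1,
    restrict_unitMeasure_Ioc le_rfl hx.2]

@[simp] lemma primitive_zero (g : UnitL2) : primitive g 0 = 0 := by
  simp [primitive_eq_setIntegral]

lemma primitive_of_nonpos (g : UnitL2) {x : ℝ} (hx : x ≤ 0) : primitive g x = 0 := by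
  simp [primitive_eq_setIntegral, Ioc_eq_empty_of_le hx]

lemma primitive_of_one_le (g : UnitL2) {x : ℝ} (hx : 1 ≤ x) : primitive g x = primitive g 1 := by
  rw [primitive_eq_setIntegral, primitive_eq_setIntegral,
    Measure.restrict_restrict measurableSet_Ioc, Measure.restrict_restrict measurableSet_Ioc]
  congr 2
  ext t
  simp only [mem_inter_iff, mem_Ioc, mem_Icc]
  constructor
  · rintro ⟨⟨a, b⟩, c, d⟩; exact ⟨⟨a, d⟩, c, d⟩
  · rintro ⟨⟨a, b⟩, c, d⟩; exact ⟨⟨a, b.trans hx⟩, c, d⟩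

lemma integrable_coe (g : UnitL2) : Integrable g unitMeasure :=
  (Lp.memLp g).integrable (by norm_num)

lemma integrable_coe_sq (g : UnitL2) : Integrable (fun t => (g t) ^ 2) unitMeasure :=
  (Lp.memLp g).integrable_sq

lemma norm_sq_eq_integral (g : UnitL2) : ‖g‖ ^ 2 = ∫ t, (g t) ^ 2 ∂unitMeasure := by
  rw [← real_inner_self_eq_norm_sq, L2.inner_def]
  simp [pow_two]

lemma primitive_sub_primitive (g : UnitL2) {x y : ℝ} (hx : 0 ≤ x) (hxy : x ≤ y) :
    primitive g y - primitive g x = ∫ t in Ioc x y, g t ∂unitMeasure := by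
  rw [primitive_eq_setIntegral, primitive_eq_setIntegral, sub_eq_iff_eq_add',
    ← setIntegral_union (Ioc_disjoint_Ioc_of_le le_rfl) measurableSet_Ioc
      (integrable_coe g).integrableOn (integrable_coe g).integrableOn,
    Ioc_union_Ioc_eq_Ioc hx hxy]

lemma unitMeasure_real_Ioc_le {x y : ℝ} (hxy : x ≤ y) : unitMeasure.real (Ioc x y) ≤ y - x := by
  have h : unitMeasure (Ioc x y) ≤ ENNReal.ofReal (y - x) := by
    rw [← Real.volume_Ioc]; exact Measure.restrict_apply_le _ _
  exact ENNReal.toReal_le_of_le_ofReal (sub_nonneg.2 hxy) h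

/-- The Cauchy-Schwarz bound for the increments of a primitive. -/
lemma sq_primitive_sub_le (g : UnitL2) {x y : ℝ} (hx : 0 ≤ x) (hxy : x ≤ y) :
    (primitive g y - primitive g x) ^ 2 ≤ (y - x) * ∫ t in Ioc x y, (g t) ^ 2 ∂unitMeasure := by
  rw [primitive_sub_primitive g hx hxy]
  rcases hxy.eq_or_lt with rfl | hlt
  · simp
  set I := ∫ t in Ioc x y, g t ∂unitMeasure
  set Q := ∫ t in Ioc x y, (g t) ^ 2 ∂unitMeasure
  have hd : 0 < y - x := sub_pos.2 hlt
  -- Cauchy-Schwarz in the form that `∫ (g - m)²` is nonnegative for the mean `m`. If `y > 1`, the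
  -- interval has `unitMeasure` smaller than `y - x`; only the inequality is used.
  set m := I / (y - x) with hm
  have hmI : m * (y - x) = I := by rw [hm]; field_simp
  have h0 : 0 ≤ ∫ t in Ioc x y, (g t - m) ^ 2 ∂unitMeasure :=
    integral_nonneg fun t => sq_nonneg _
  have h1 : ∫ t in Ioc x y, (g t - m) ^ 2 ∂unitMeasure
      = Q - 2 * m * I + m ^ 2 * unitMeasure.real (Ioc x y) := by
    have e : ∀ t, (g t - m) ^ 2 = (g t) ^ 2 - 2 * m * g t + m ^ 2 := fun t => by ring
    simp_rw [e]
    have i1 : IntegrableOn (fun t => (g t) ^ 2) (Ioc x y) unitMeasure :=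
      (integrable_coe_sq g).integrableOn
    have i2 : IntegrableOn (fun t => 2 * m * g t) (Ioc x y) unitMeasure :=
      ((integrable_coe g).const_mul _).integrableOn
    have i3 : IntegrableOn (fun t => (g t) ^ 2 - 2 * m * g t) (Ioc x y) unitMeasure := i1.sub i2
    rw [integral_add i3 (integrable_const _), integral_sub i1 i2, integral_const_mul]
    simp [I, Q, mul_comm]
  have h2 := unitMeasure_real_Ioc_le hxy
  have h3 : m ^ 2 * unitMeasure.real (Ioc x y) ≤ m ^ 2 * (y - x) := by gcongr
  have h4 : m * I = m ^ 2 * (y - x) := by rw [← hmI]; ring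
  calc I ^ 2 = (y - x) * (m ^ 2 * (y - x)) := by rw [← hmI]; ring
    _ ≤ (y - x) * Q := mul_le_mul_of_nonneg_left (by linarith) hd.le

lemma setIntegral_sq_le_norm_sq (g : UnitL2) (s : Set ℝ) :
    ∫ t in s, (g t) ^ 2 ∂unitMeasure ≤ ‖g‖ ^ 2 := by
  rw [norm_sq_eq_integral]
  exact setIntegral_le_integral (integrable_coe_sq g) (ae_of_all _ fun t => sq_nonneg _)

lemma abs_primitive_le (g : UnitL2) (x : ℝ) : |primitive g x| ≤ ‖g‖ := by
  have key : ∀ x ∈ Icc (0 : ℝ) 1, |primitive g x| ≤ ‖g‖ := by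
    intro x hx
    have h := sq_primitive_sub_le g le_rfl hx.1
    rw [primitive_zero, sub_zero, sub_zero] at h
    have h2 := setIntegral_sq_le_norm_sq g (Ioc 0 x)
    have h3 : 0 ≤ ∫ t in Ioc 0 x, (g t) ^ 2 ∂unitMeasure := integral_nonneg fun t => sq_nonneg _
    refine abs_le_of_sq_le_sq ?_ (norm_nonneg _)
    nlinarith [hx.1, hx.2]
  rcases le_total x 0 with h | h
  · simp [primitive_of_nonpos g h]
  · rcases le_total x 1 with h' | h'
    · exact key x ⟨h, h'⟩
    · rw [primitive_of_one_le g h']; exact key 1 ⟨zero_le_one, le_rfl⟩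

lemma continuous_primitive (g : UnitL2) : Continuous (primitive g) := by
  have key : ∀ x y : ℝ, 0 ≤ x → x ≤ y →
      (primitive g y - primitive g x) ^ 2 ≤ (y - x) * ‖g‖ ^ 2 := fun x y hx hxy =>
    (sq_primitive_sub_le g hx hxy).trans
      (mul_le_mul_of_nonneg_left (setIntegral_sq_le_norm_sq g _) (sub_nonneg.2 hxy))
  have key2 : ∀ x y : ℝ, x ≤ y → (primitive g y - primitive g x) ^ 2 ≤ (y - x) * ‖g‖ ^ 2 := by
    intro x y hxy
    rcases le_total 0 x with hx | hx
    · exact key x y hx hxy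
    · rw [primitive_of_nonpos g hx]
      rcases le_total 0 y with hy | hy
      · have := key 0 y le_rfl hy
        rw [primitive_zero] at this
        nlinarith [sq_nonneg ‖g‖]
      · rw [primitive_of_nonpos g hy]
        nlinarith [sq_nonneg ‖g‖]
  have key3 : ∀ x y : ℝ, |primitive g y - primitive g x| ≤ Real.sqrt (|y - x| * ‖g‖ ^ 2) := by
    intro x y
    apply Real.abs_le_sqrt
    rcases le_total x y with h | h
    · rw [abs_of_nonneg (sub_nonneg.2 h)]; exact key2 x y h
    · rw [abs_sub_comm, abs_of_nonneg (sub_nonneg.2 h)]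
      have := key2 y x h
      nlinarith
  rw [continuous_iff_continuousAt]
  intro x
  rw [ContinuousAt, tendsto_iff_dist_tendsto_zero]
  have hcont : Continuous fun y : ℝ => Real.sqrt (|y - x| * ‖g‖ ^ 2) := by fun_prop
  have hlim := hcont.tendsto x
  rw [sub_self, abs_zero, zero_mul, Real.sqrt_zero] at hlim
  exact squeeze_zero (fun y => dist_nonneg) (fun y => key3 x y) hlim

/-- A square integrable function is determined by its primitive. -/
lemma ae_eq_of_intervalIntegral_eq {u v : ℝ → ℝ} (hu : MemLp u 2 unitMeasure)
    (hv : MemLp v 2 unitMeasure)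
    (h : ∀ x ∈ Icc (0 : ℝ) 1, ∫ t in (0 : ℝ)..x, u t = ∫ t in (0 : ℝ)..x, v t) :
    u =ᵐ[unitMeasure] v := by
  have toI : ∀ {w : ℝ → ℝ}, MemLp w 2 unitMeasure → IntervalIntegrable w volume 0 1 := by
    intro w hw
    rw [intervalIntegrable_iff_integrableOn_Icc_of_le zero_le_one]
    exact hw.integrable (by norm_num)
  have h1 := (toI hu).ae_hasDerivAt_integral
  have h2 := (toI hv).ae_hasDerivAt_integral
  have h3 : ∀ᵐ x : ℝ, x ≠ 0 ∧ x ≠ 1 := by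
    filter_upwards [Measure.ae_ne volume (0 : ℝ), Measure.ae_ne volume (1 : ℝ)] with x a b
    exact ⟨a, b⟩
  rw [Filter.EventuallyEq, ae_restrict_iff' measurableSet_Icc]
  filter_upwards [h1, h2, h3] with x hx1 hx2 hx3 hx
  rw [uIcc_of_le zero_le_one] at hx1 hx2
  have d1 := hx1 hx 0 ⟨le_rfl, zero_le_one⟩
  have d2 := hx2 hx 0 ⟨le_rfl, zero_le_one⟩
  have hnhds : Icc (0 : ℝ) 1 ∈ 𝓝 x :=
    Icc_mem_nhds (lt_of_le_of_ne hx.1 (Ne.symm hx3.1)) (lt_of_le_of_ne hx.2 hx3.2)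
  refine d1.unique (d2.congr_of_eventuallyEq ?_)
  filter_upwards [hnhds] with y hy using h y hy

lemma primitive_injective : Function.Injective primitiveₗ := by
  intro g h hgh
  refine Lp.ext (ae_eq_of_intervalIntegral_eq (Lp.memLp g) (Lp.memLp h) fun x hx => ?_)
  rw [← primitive_eq_intervalIntegral g hx, ← primitive_eq_intervalIntegral h hx]
  exact congrFun hgh x

lemma hasWeakDeriv_primitive (g : UnitL2) : HasWeakDeriv (primitive g) g :=
  ⟨Lp.memLp g, fun x hx => by rw [primitive_zero, zero_add, primitive_eq_intervalIntegral g hx]⟩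

lemma weakDeriv_primitive (g : UnitL2) : weakDeriv (primitive g) =ᵐ[unitMeasure] g := by
  have hex : ∃ u, HasWeakDeriv (primitive g) u := ⟨g, hasWeakDeriv_primitive g⟩
  have hw : HasWeakDeriv (primitive g) (weakDeriv (primitive g)) := by
    unfold weakDeriv; rw [dif_pos hex]; exact hex.choose_spec
  refine ae_eq_of_intervalIntegral_eq hw.1 (Lp.memLp g) fun x hx => ?_
  have h1 := hw.2 x hx
  rw [primitive_zero, zero_add] at h1
  rw [← h1, primitive_eq_intervalIntegral g hx]

/-- This moves the eigenvalue problem to the Hilbert space of derivatives, independently of the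
representative chosen by `weakDeriv`. -/
lemma energy_primitive (g h : UnitL2) : energy (primitive g) (primitive h) = inner ℝ g h := by
  unfold energy
  rw [intervalIntegral.integral_of_le zero_le_one, ← integral_Icc_eq_integral_Ioc, L2.inner_def]
  refine integral_congr_ae ?_
  filter_upwards [weakDeriv_primitive g, weakDeriv_primitive h] with t h1 h2
  rw [h1, h2]
  simp [mul_comm]

lemma exists_eq_primitive {f : ℝ → ℝ} (hf : ∃ g, HasWeakDeriv f g) (h0 : f 0 = 0) (h1 : f 1 = 0)
    (hout : ∀ x ∉ Icc (0 : ℝ) 1, f x = 0) : ∃ g : UnitL2, f = primitive g := by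
  obtain ⟨u, hu, hfu⟩ := hf
  have key : ∀ x ∈ Icc (0 : ℝ) 1, f x = primitive (hu.toLp u) x := by
    intro x hx
    rw [hfu x hx, h0, zero_add, primitive_eq_intervalIntegral _ hx,
      intervalIntegral.integral_of_le hx.1, intervalIntegral.integral_of_le hx.1,
      ← restrict_unitMeasure_Ioc le_rfl hx.2]
    exact integral_congr_ae (ae_restrict_of_ae hu.coeFn_toLp.symm)
  refine ⟨hu.toLp u, funext fun x => ?_⟩
  by_cases hx : x ∈ Icc (0 : ℝ) 1
  · exact key x hx
  · rw [hout x hx]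
    rcases not_and_or.1 hx with h | h
    · rw [primitive_of_nonpos _ (not_le.1 h).le]
    · rw [primitive_of_one_le _ (not_le.1 h).le, ← key 1 ⟨zero_le_one, le_rfl⟩, h1]

/-! ## The embedding into `L²(ν)` -/

section Embedding

variable (ν : Measure ℝ) [IsFiniteMeasure ν]

lemma memLp_primitive (g : UnitL2) : MemLp (primitive g) 2 ν :=
  MemLp.of_bound (continuous_primitive g).aestronglyMeasurable ‖g‖
    (ae_of_all _ fun x => abs_primitive_le g x)

/-- The map sending a derivative to its primitive, seen in `L²(ν)`. -/
def embed : UnitL2 →L[ℝ] Lp ℝ 2 ν :=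
  LinearMap.mkContinuous
    { toFun := fun g => (memLp_primitive ν g).toLp _
      map_add' := fun g h => by
        rw [← MemLp.toLp_add]
        congr 1
        ext x; exact primitive_add g h x
      map_smul' := fun c g => by
        rw [RingHom.id_apply, ← MemLp.toLp_const_smul]
        congr 1
        ext x; exact primitive_smul c g x }
    (ν.real univ ^ (2 : ℝ≥0∞).toReal⁻¹) (fun g => by
      refine (Lp.norm_le_of_ae_bound (C := ‖g‖) (norm_nonneg _) ?_).trans_eq ?_
      · filter_upwards [(memLp_primitive ν g).coeFn_toLp] with x hx
        simp only [LinearMap.coe_mk, AddHom.coe_mk]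
        rw [hx]; exact abs_primitive_le g x
      · simp [measureUnivNNReal, Measure.real, ENNReal.coe_toNNReal_eq_toReal])

lemma embed_ae (g : UnitL2) : embed ν g =ᵐ[ν] primitive g := (memLp_primitive ν g).coeFn_toLp

lemma inner_embed (g h : UnitL2) :
    inner ℝ (embed ν g) (embed ν h) = ∫ x, primitive g x * primitive h x ∂ν := by
  rw [L2.inner_def]
  refine integral_congr_ae ?_
  filter_upwards [embed_ae ν g, embed_ae ν h] with x h1 h2
  rw [h1, h2]; simp [mul_comm]

lemma norm_embed_sq (g : UnitL2) : ‖embed ν g‖ ^ 2 = ∫ x, (primitive g x) ^ 2 ∂ν := by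
  rw [← real_inner_self_eq_norm_sq, inner_embed]
  simp [pow_two]

lemma integrable_primitive_sq (g : UnitL2) : Integrable (fun x => (primitive g x) ^ 2) ν :=
  (memLp_primitive ν g).integrable_sq

end Embedding

/-! ## Dyadic cells -/

lemma measurableSet_dyadic (n k : ℕ) : MeasurableSet (dyadic n k) := measurableSet_Ioc

/-- The common endpoint of the two halves of a dyadic interval. -/
def dyadicMid (n k : ℕ) : ℝ := (2 * (k : ℝ) + 1) / 2 ^ (n + 1)

lemma dyadic_zero_zero : dyadic 0 0 = Ioc (0 : ℝ) 1 := by simp [dyadic]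

lemma dyadic_left_endpoint (n k : ℕ) : ((2 * k : ℕ) : ℝ) / 2 ^ (n + 1) = (k : ℝ) / 2 ^ n := by
  push_cast; field_simp; ring

lemma dyadic_right_endpoint (n k : ℕ) :
    (((2 * k + 1 : ℕ) : ℝ) + 1) / 2 ^ (n + 1) = ((k : ℝ) + 1) / 2 ^ n := by
  push_cast; field_simp; ring

lemma dyadic_union (n k : ℕ) :
    dyadic (n + 1) (2 * k) ∪ dyadic (n + 1) (2 * k + 1) = dyadic n k := by
  unfold dyadic
  rw [dyadic_left_endpoint, dyadic_right_endpoint]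
  have e1 : (((2 * k : ℕ) : ℝ) + 1) / 2 ^ (n + 1) = dyadicMid n k := by
    simp [dyadicMid]
  have e2 : (((2 * k + 1 : ℕ) : ℝ)) / 2 ^ (n + 1) = dyadicMid n k := by
    simp [dyadicMid]
  rw [e1, e2]
  apply Ioc_union_Ioc_eq_Ioc
  · rw [← dyadic_left_endpoint, dyadicMid]; push_cast; gcongr; linarith
  · rw [← dyadic_right_endpoint, dyadicMid]; push_cast; gcongr; linarith

lemma dyadic_disjoint {n j k : ℕ} (h : j ≠ k) : Disjoint (dyadic n j) (dyadic n k) := by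
  wlog hjk : j < k generalizing j k
  · exact (this h.symm (lt_of_le_of_ne (not_lt.1 hjk) h.symm)).symm
  refine Ioc_disjoint_Ioc_of_le ?_
  have : (j : ℝ) + 1 ≤ k := by exact_mod_cast hjk
  gcongr

lemma mem_dyadic_iff {n k : ℕ} {x : ℝ} :
    x ∈ dyadic n k ↔ (k : ℝ) < 2 ^ n * x ∧ 2 ^ n * x ≤ k + 1 := by
  have h2 : (0 : ℝ) < 2 ^ n := by positivity
  rw [dyadic, mem_Ioc, div_lt_iff₀' h2, le_div_iff₀' h2]

/-- Each point of `(0,1]` lies in a dyadic interval of every order. -/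
lemma exists_mem_dyadic (n : ℕ) {x : ℝ} (hx : x ∈ Ioc (0 : ℝ) 1) :
    ∃ k < 2 ^ n, x ∈ dyadic n k := by
  have h2 : (0 : ℝ) < 2 ^ n := by positivity
  have hpos : 0 < 2 ^ n * x := mul_pos h2 hx.1
  have hc : 0 < ⌈2 ^ n * x⌉₊ := Nat.ceil_pos.2 hpos
  obtain ⟨k, hk⟩ := Nat.exists_eq_succ_of_ne_zero hc.ne'
  refine ⟨k, ?_, mem_dyadic_iff.2 ⟨?_, ?_⟩⟩
  · have : ⌈2 ^ n * x⌉₊ ≤ 2 ^ n := by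
      refine Nat.ceil_le.2 ?_
      push_cast
      nlinarith [hx.2]
    omega
  · have : k < ⌈2 ^ n * x⌉₊ := by omega
    exact Nat.lt_ceil.1 this
  · have := Nat.le_ceil (2 ^ n * x)
    rw [hk] at this
    exact_mod_cast this

lemma dyadic_subset {n k : ℕ} (hk : k < 2 ^ n) : dyadic n k ⊆ Ioc (0 : ℝ) 1 := by
  refine Ioc_subset_Ioc (by positivity) ?_
  rw [div_le_one (by positivity)]
  exact_mod_cast hk

lemma Ioc_eq_biUnion_dyadic (n : ℕ) :
    Ioc (0 : ℝ) 1 = ⋃ k ∈ Finset.range (2 ^ n), dyadic n k := by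
  ext x
  simp only [mem_iUnion, Finset.mem_range, exists_prop]
  exact ⟨fun hx => exists_mem_dyadic n hx, fun ⟨k, hk, hx⟩ => dyadic_subset hk hx⟩

section Cells

variable (ν : Measure ℝ) [IsFiniteMeasure ν]

/-- The dyadic cells `C`, given by order and position, with `ν(C) Λ(C) ≥ t`. -/
def heavyCells (t : ℝ) : Set (ℕ × ℕ) :=
  {p | p.2 < 2 ^ p.1 ∧ t ≤ ν.real (dyadic p.1 p.2) / 2 ^ p.1}

variable {ν}

/-! ### Poincaré inequalities on light cells and compactness of the embedding -/

lemma exists_order_light {t : ℝ} (ht : 0 < t) :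
    ∃ N, ∀ n ≥ N, ∀ k, ν.real (dyadic n k) / 2 ^ n < t := by
  have hlim : Tendsto (fun n : ℕ => ν.real univ * (1 / 2 : ℝ) ^ n) atTop (𝓝 (ν.real univ * 0)) :=
    (tendsto_pow_atTop_nhds_zero_of_lt_one (by norm_num) (by norm_num)).const_mul _
  rw [mul_zero] at hlim
  obtain ⟨N, hN⟩ := eventually_atTop.1 (hlim.eventually (gt_mem_nhds ht))
  refine ⟨N, fun n hn k => lt_of_le_of_lt ?_ (hN n hn)⟩
  rw [one_div, inv_pow, ← div_eq_mul_inv]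
  exact div_le_div_of_nonneg_right (measureReal_mono (subset_univ _) (measure_ne_top ν _))
    (by positivity)

lemma heavyCells_finite {t : ℝ} (ht : 0 < t) : (heavyCells ν t).Finite := by
  obtain ⟨N, hN⟩ := exists_order_light (ν := ν) ht
  refine Set.Finite.subset (((Finset.range N) ×ˢ (Finset.range (2 ^ N))).finite_toSet) ?_
  rintro ⟨n, k⟩ ⟨h1, h2⟩
  have hn : n < N := by
    by_contra h
    exact absurd h2 (not_le.2 (hN n (not_lt.1 h) k))
  simp only [Finset.coe_product, Finset.coe_range, mem_prod, mem_Iio]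
  exact ⟨hn, lt_of_lt_of_le h1 (Nat.pow_le_pow_right (by norm_num) hn.le)⟩

/-- A zero at the left endpoint already gives `f² ≤ 2⁻ⁿ ∫ (f')²` pointwise on the cell; integrating
against `ν` produces the factor `ν(C)Λ(C)`. -/
lemma setIntegral_primitive_sq_le_of_light {t : ℝ} (g : UnitL2) {n k : ℕ}
    (hlight : ν.real (dyadic n k) / 2 ^ n ≤ t)
    (h0 : primitive g ((k : ℝ) / 2 ^ n) = 0) :
    ∫ x in dyadic n k, (primitive g x) ^ 2 ∂ν ≤
      t * ∫ x in dyadic n k, (g x) ^ 2 ∂unitMeasure := by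
  set Q := ∫ x in dyadic n k, (g x) ^ 2 ∂unitMeasure with hQ
  have hQ0 : 0 ≤ Q := integral_nonneg fun x => sq_nonneg _
  have hpt : ∀ x ∈ dyadic n k, (primitive g x) ^ 2 ≤ 1 / 2 ^ n * Q := by
    intro x hx
    have h1 := sq_primitive_sub_le g (x := (k : ℝ) / 2 ^ n) (y := x) (by positivity) hx.1.le
    rw [h0, sub_zero] at h1
    refine h1.trans ?_
    gcongr
    · have := hx.2
      rw [add_div] at this
      linarith
    · exact setIntegral_mono_set (integrable_coe_sq g).integrableOn
        (ae_of_all _ fun x => sq_nonneg _)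
        (LE.le.eventuallyLE (Ioc_subset_Ioc_right hx.2))
  calc ∫ x in dyadic n k, (primitive g x) ^ 2 ∂ν
      ≤ ∫ x in dyadic n k, 1 / 2 ^ n * Q ∂ν :=
        setIntegral_mono_on (integrable_primitive_sq ν g).integrableOn
          (integrable_const _) (measurableSet_dyadic n k) hpt
    _ = (ν.real (dyadic n k) / 2 ^ n) * Q := by
        rw [setIntegral_const, smul_eq_mul]; ring
    _ ≤ t * Q := by gcongr

/-- A stopping-time recursion: light cells are estimated directly, and any other cell is halved at
its midpoint, where the function vanishes, so both halves inherit the zeros at their endpoints. The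
index `m` counts the generations left before order `N`, at which every cell is light. -/
lemma setIntegral_primitive_sq_le {t : ℝ} (g : UnitL2) {N : ℕ}
    (hN : ∀ n ≥ N, ∀ k, ν.real (dyadic n k) / 2 ^ n < t)
    (hmid : ∀ p ∈ heavyCells ν t, primitive g (dyadicMid p.1 p.2) = 0) (m : ℕ) :
    ∀ n k : ℕ, n + m = N → k < 2 ^ n → primitive g ((k : ℝ) / 2 ^ n) = 0 →
      primitive g (((k : ℝ) + 1) / 2 ^ n) = 0 →
      ∫ x in dyadic n k, (primitive g x) ^ 2 ∂ν ≤
        t * ∫ x in dyadic n k, (g x) ^ 2 ∂unitMeasure := by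
  induction m with
  | zero =>
    intro n k hn hk h0 h1
    exact setIntegral_primitive_sq_le_of_light g (hN n (by omega) k).le h0
  | succ m ih =>
    intro n k hn hk h0 h1
    by_cases hlight : ν.real (dyadic n k) / 2 ^ n ≤ t
    · exact setIntegral_primitive_sq_le_of_light g hlight h0
    have hm : primitive g (dyadicMid n k) = 0 := hmid (n, k) ⟨hk, (not_le.1 hlight).le⟩
    have hd : Disjoint (dyadic (n + 1) (2 * k)) (dyadic (n + 1) (2 * k + 1)) :=
      dyadic_disjoint (by omega)
    rw [← dyadic_union, setIntegral_union hd (measurableSet_dyadic _ _)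
        (integrable_primitive_sq ν g).integrableOn (integrable_primitive_sq ν g).integrableOn,
      setIntegral_union hd (measurableSet_dyadic _ _)
        (integrable_coe_sq g).integrableOn (integrable_coe_sq g).integrableOn, mul_add]
    have hk' : 2 * k + 1 < 2 ^ (n + 1) := by rw [pow_succ]; omega
    refine add_le_add (ih (n + 1) (2 * k) (by omega) (by omega) ?_ ?_)
      (ih (n + 1) (2 * k + 1) (by omega) hk' ?_ ?_)
    · rw [dyadic_left_endpoint]; exact h0
    · convert hm using 2; simp [dyadicMid]
    · convert hm using 2; simp [dyadicMid]
    · rw [dyadic_right_endpoint]; exact h1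

/-- If `g` is orthogonal to finitely many functions, one for each heavy cell and one more, then the
`L²(ν)`-norm of its primitive is small. -/
lemma norm_embed_sq_le (hν : ν (Ioo (0 : ℝ) 1)ᶜ = 0) {t : ℝ} (ht : 0 < t) (g : UnitL2)
    (h1 : primitive g 1 = 0)
    (hmid : ∀ p ∈ heavyCells ν t, primitive g (dyadicMid p.1 p.2) = 0) :
    ‖embed ν g‖ ^ 2 ≤ t * ‖g‖ ^ 2 := by
  obtain ⟨N, hN⟩ := exists_order_light (ν := ν) ht
  have h := setIntegral_primitive_sq_le g hN hmid N 0 0 (by omega) (by norm_num)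
    (by simp) (by simpa using h1)
  rw [dyadic_zero_zero] at h
  have hr : ν.restrict (Ioc 0 1) = ν := by
    refine Measure.restrict_eq_self_of_ae_mem ?_
    have : ∀ᵐ x ∂ν, x ∈ Ioo (0 : ℝ) 1 := hν
    filter_upwards [this] with x hx using Ioo_subset_Ioc_self hx
  rw [hr] at h
  rw [norm_embed_sq]
  exact h.trans (mul_le_mul_of_nonneg_left (setIntegral_sq_le_norm_sq g _) ht.le)

/-- The embedding is a norm limit of finite-rank operators: on the orthogonal complement of finitely
many evaluation functionals its norm is at most `√t`. -/
lemma isCompactOperator_embed (hν : ν (Ioo (0 : ℝ) 1)ᶜ = 0) : IsCompactOperator (embed ν) := by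
  have hmem : embed ν ∈ closure {f : UnitL2 →L[ℝ] Lp ℝ 2 ν | IsCompactOperator f} := by
    rw [Metric.mem_closure_iff]
    intro ε hε
    set t : ℝ := (ε / 2) ^ 2 with ht
    have ht0 : 0 < t := by positivity
    -- Orthogonality to `initialIndicator y` means that the primitive vanishes at `y`.
    set B : Set UnitL2 := insert (initialIndicator 1)
      ((fun p : ℕ × ℕ => initialIndicator (dyadicMid p.1 p.2)) '' heavyCells ν t) with hB
    have hBfin : B.Finite := ((heavyCells_finite ht0).image _).insert _
    set F := Submodule.span ℝ B with hF
    have : FiniteDimensional ℝ F := FiniteDimensional.span_of_finite ℝ hBfin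
    refine ⟨(embed ν).comp F.starProjection, ?_, ?_⟩
    · have h1 : IsCompactOperator F.orthogonalProjectionOnto :=
        isCompactOperator_of_locallyCompactSpace_dom _
      exact h1.clm_comp ((embed ν).comp F.subtypeL)
    · have hle : ‖embed ν - (embed ν).comp F.starProjection‖ ≤ ε / 2 := by
        refine ContinuousLinearMap.opNorm_le_bound _ (by positivity) fun g => ?_
        set u := g - F.starProjection g with hu
        have horth : ∀ b ∈ B, inner ℝ b u = 0 := by
          intro b hb
          rw [real_inner_comm]
          exact Submodule.starProjection_inner_eq_zero g b (Submodule.subset_span hb)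
        have hsq := norm_embed_sq_le hν ht0 u (horth _ (mem_insert _ _)) (fun p hp =>
          horth _ (mem_insert_of_mem _ (mem_image_of_mem _ hp)))
        have hun : ‖u‖ ≤ ‖g‖ := by
          have h3 := Submodule.starProjection_add_starProjection_orthogonal (K := F) g
          have h4 : u = Fᗮ.starProjection g := by
            rw [hu]; exact sub_eq_of_eq_add' h3.symm
          rw [h4]
          exact Submodule.norm_starProjection_apply_le _ _
        have he : (embed ν - (embed ν).comp F.starProjection) g = embed ν u := by
          simp [hu]
        rw [he]
        refine le_of_sq_le_sq ?_ (by positivity)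
        calc ‖embed ν u‖ ^ 2 ≤ t * ‖u‖ ^ 2 := hsq
          _ ≤ t * ‖g‖ ^ 2 := by gcongr
          _ = (ε / 2 * ‖g‖) ^ 2 := by rw [ht]; ring
      rw [dist_eq_norm]
      linarith
  rw [isClosed_setOfPred_isCompactOperator.closure_eq] at hmem
  exact hmem

end Cells

/-! ## The operator of the form -/

section Operator

variable (ν : Measure ℝ)

/-- The derivatives of the functions in the form domain. -/
def derivDomain : Submodule ℝ UnitL2 where
  -- Affineness off the support is encoded by three-point identities. Each is a continuous linear
  -- equation in `g`, which makes the subspace closed.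
  carrier := {g | primitive g 1 = 0 ∧ ∀ a b c : ℝ, a ≤ b → b ≤ c → Icc a c ⊆ Icc 0 1 \ ν.support →
    (primitive g b - primitive g a) * (c - a) = (primitive g c - primitive g a) * (b - a)}
  add_mem' {g h} hg hh := by
    refine ⟨by rw [primitive_add, hg.1, hh.1, add_zero], fun a b c hab hbc hs => ?_⟩
    simp only [primitive_add]
    linear_combination hg.2 a b c hab hbc hs + hh.2 a b c hab hbc hs
  zero_mem' := by
    have h : ∀ x, primitive 0 x = 0 := fun x => by simp [primitive]
    refine ⟨h 1, fun a b c _ _ _ => by simp [h]⟩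
  smul_mem' r g hg := by
    refine ⟨by rw [primitive_smul, hg.1, mul_zero], fun a b c hab hbc hs => ?_⟩
    simp only [primitive_smul]
    linear_combination r * hg.2 a b c hab hbc hs

lemma continuous_primitive_apply (x : ℝ) : Continuous fun g : UnitL2 => primitive g x := by
  unfold primitive; fun_prop

lemma isClosed_derivDomain : IsClosed (derivDomain ν : Set UnitL2) := by
  have : (derivDomain ν : Set UnitL2) = {g | primitive g 1 = 0} ∩ ⋂ (a : ℝ) (b : ℝ) (c : ℝ)
      (_ : a ≤ b) (_ : b ≤ c) (_ : Icc a c ⊆ Icc 0 1 \ ν.support),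
      {g | (primitive g b - primitive g a) * (c - a) =
        (primitive g c - primitive g a) * (b - a)} := by
    ext g
    simp only [mem_inter_iff, mem_iInter, mem_ofPred_eq]
    rfl
  rw [this]
  refine (isClosed_eq (continuous_primitive_apply 1) continuous_const).inter ?_
  refine isClosed_iInter fun a => isClosed_iInter fun b => isClosed_iInter fun c =>
    isClosed_iInter fun _ => isClosed_iInter fun _ => isClosed_iInter fun _ => ?_
  exact isClosed_eq
    (((continuous_primitive_apply b).sub (continuous_primitive_apply a)).mul continuous_const)
    (((continuous_primitive_apply c).sub (continuous_primitive_apply a)).mul continuous_const)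

instance : CompleteSpace (derivDomain ν) := (isClosed_derivDomain ν).completeSpace_coe

variable {ν}

lemma primitive_mem_formDomain_iff {g : UnitL2} :
    primitive g ∈ formDomain ν ↔ g ∈ derivDomain ν := by
  constructor
  · rintro ⟨-, -, h1, -, haff⟩
    refine ⟨h1, fun a b c hab hbc hs => ?_⟩
    obtain ⟨p, q, hpq⟩ := haff (Icc a c) ordConnected_Icc hs
    rw [hpq a ⟨le_rfl, hab.trans hbc⟩, hpq b ⟨hab, hbc⟩, hpq c ⟨hab.trans hbc, le_rfl⟩]
    ring
  · rintro ⟨h1, haff⟩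
    refine ⟨⟨g, hasWeakDeriv_primitive g⟩, primitive_zero g, h1, fun x hx => ?_, fun J hJ hJs => ?_⟩
    · rcases not_and_or.1 hx with h | h
      · exact primitive_of_nonpos g (not_le.1 h).le
      · rw [primitive_of_one_le g (not_le.1 h).le, h1]
    · rcases J.subsingleton_or_nontrivial with hsub | hnt
      · rcases J.eq_empty_or_nonempty with rfl | ⟨x, hx⟩
        · exact ⟨0, 0, by simp⟩
        · exact ⟨0, primitive g x, fun z hz => by rw [hsub hz hx]; ring⟩
      · obtain ⟨a, ha, b, hb, hab⟩ := hnt.exists_lt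
        have hd : b - a ≠ 0 := (sub_pos.2 hab).ne'
        refine ⟨(primitive g b - primitive g a) / (b - a),
          primitive g a - (primitive g b - primitive g a) / (b - a) * a, fun z hz => ?_⟩
        have hsub : ∀ {x y : ℝ}, x ∈ J → y ∈ J → Icc x y ⊆ Icc 0 1 \ ν.support :=
          fun hx hy => (hJ.out hx hy).trans hJs
        have key : (primitive g z - primitive g a) * (b - a) =
            (primitive g b - primitive g a) * (z - a) := by
          rcases le_total z a with h | h
          · have := haff z a b h hab.le (hsub hz hb)
            linear_combination -this
          · rcases le_total z b with h' | h'
            · exact haff a z b h h' (hsub ha hb)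
            · exact (haff a b z hab.le h' (hsub ha hz)).symm
        field_simp
        linear_combination key

lemma mem_formDomain_iff {f : ℝ → ℝ} :
    f ∈ formDomain ν ↔ ∃ g ∈ derivDomain ν, f = primitive g := by
  constructor
  · intro hf
    obtain ⟨g, rfl⟩ := exists_eq_primitive hf.1 hf.2.1 hf.2.2.1 hf.2.2.2.1
    exact ⟨g, primitive_mem_formDomain_iff.1 hf, rfl⟩
  · rintro ⟨g, hg, rfl⟩
    exact primitive_mem_formDomain_iff.2 hg

lemma starProjection_of_mem {g : UnitL2} (hg : g ∈ derivDomain ν) :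
    (derivDomain ν).starProjection g = g := Submodule.starProjection_eq_self_iff.2 hg

variable (ν) [IsFiniteMeasure ν]

/-- The self-adjoint operator on `L²[0,1]` whose nonzero eigenvalues are the reciprocals of the
eigenvalues of the form. -/
def formOperator : UnitL2 →L[ℝ] UnitL2 :=
  (ContinuousLinearMap.adjoint ((embed ν).comp (derivDomain ν).starProjection)).comp
    ((embed ν).comp (derivDomain ν).starProjection)

variable {ν}

lemma inner_formOperator (g h : UnitL2) : inner ℝ (formOperator ν g) h =
    inner ℝ (embed ν ((derivDomain ν).starProjection g))
      (embed ν ((derivDomain ν).starProjection h)) := by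
  simp only [formOperator, ContinuousLinearMap.comp_apply, ContinuousLinearMap.adjoint_inner_left]

lemma formOperator_isSymmetric :
    ((formOperator ν : UnitL2 →L[ℝ] UnitL2) : UnitL2 →ₗ[ℝ] UnitL2).IsSymmetric := by
  intro g h
  change inner ℝ (formOperator ν g) h = inner ℝ g (formOperator ν h)
  rw [inner_formOperator, ← real_inner_comm, ← real_inner_comm g, inner_formOperator]

lemma isCompactOperator_formOperator (hν : ν (Ioo (0 : ℝ) 1)ᶜ = 0) :
    IsCompactOperator (formOperator ν) :=
  ((isCompactOperator_embed hν).comp_clm (derivDomain ν).starProjection).clm_comp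
    (ContinuousLinearMap.adjoint ((embed ν).comp (derivDomain ν).starProjection))

/-- The symmetric operator annihilates the orthogonal complement of the closed subspace `derivDomain
ν`, so its range lies in the double complement. Eigenvectors with nonzero eigenvalue thus belong to
the domain automatically. -/
lemma formOperator_range (g : UnitL2) : formOperator ν g ∈ derivDomain ν := by
  have : formOperator ν g ∈ (derivDomain ν)ᗮᗮ := by
    intro u hu
    have h0 : (derivDomain ν).starProjection u = 0 := by
      rwa [Submodule.starProjection_apply_eq_zero_iff]
    rw [real_inner_comm, inner_formOperator, h0, map_zero, inner_zero_right]
  rwa [Submodule.orthogonal_orthogonal] at this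

/-- The weak eigenvalue equation says `⟪g, h⟫ = lam * ⟪A g, h⟫` for `h` in the domain, where `A` is
`formOperator ν`. Testing with `h = g` forces `lam > 0`, because the energy of a nonzero function is
positive. -/
lemma isEigenfunction_iff {lam : ℝ} {f : ℝ → ℝ} : IsEigenfunction ν lam f ↔
    0 < lam ∧ ∃ g : UnitL2, g ≠ 0 ∧ f = primitive g ∧ formOperator ν g = lam⁻¹ • g := by
  constructor
  · rintro ⟨hf, hf0, heig⟩
    obtain ⟨g, hg, rfl⟩ := mem_formDomain_iff.1 hf
    have hg0 : g ≠ 0 := by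
      rintro rfl
      exact hf0 (by ext x; simp [primitive])
    have heig' : ∀ h ∈ derivDomain ν, inner ℝ g h = lam * inner ℝ (embed ν g) (embed ν h) := by
      intro h hh
      rw [inner_embed, ← energy_primitive]
      exact heig _ (primitive_mem_formDomain_iff.2 hh)
    have hpos : 0 < lam := by
      have h1 := heig' g hg
      rw [real_inner_self_eq_norm_sq, real_inner_self_eq_norm_sq] at h1
      have h2 : 0 < ‖g‖ ^ 2 := by positivity
      by_contra hneg
      nlinarith [sq_nonneg ‖embed ν g‖]
    refine ⟨hpos, g, hg0, rfl, ext_inner_right ℝ fun h => ?_⟩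
    rw [inner_formOperator, starProjection_of_mem hg, inner_smul_left]
    have h1 := heig' _ ((derivDomain ν).starProjection_apply_mem h)
    rw [← Submodule.inner_starProjection_left_eq_right, starProjection_of_mem hg] at h1
    rw [h1]
    simp [hpos.ne']
  · rintro ⟨hpos, g, hg0, rfl, hA⟩
    have hg : g ∈ derivDomain ν := by
      have h1 := (derivDomain ν).smul_mem lam (formOperator_range (ν := ν) g)
      rwa [hA, smul_smul, mul_inv_cancel₀ hpos.ne', one_smul] at h1
    refine ⟨primitive_mem_formDomain_iff.2 hg, fun h0 => hg0 (primitive_injective ?_), ?_⟩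
    · rw [map_zero]; exact h0
    · intro h hh
      obtain ⟨h, hhV, rfl⟩ := mem_formDomain_iff.1 hh
      rw [energy_primitive, ← inner_embed]
      have h1 := inner_formOperator (ν := ν) g h
      rw [starProjection_of_mem hg, starProjection_of_mem hhV, hA, inner_smul_left] at h1
      rw [← h1]
      simp [hpos.ne']

lemma eigenvalueCount_eq_finrank {x : ℝ} (hx : 0 < x) :
    eigenvalueCount ν x =
      Module.finrank ℝ (spectralSubspace (formOperator ν) (Ici x⁻¹)) := by
  have hspan : Submodule.span ℝ {f : ℝ → ℝ | ∃ lam ≤ x, IsEigenfunction ν lam f} =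
      (spectralSubspace (formOperator ν) (Ici x⁻¹)).map primitiveₗ := by
    apply le_antisymm
    · rw [Submodule.span_le]
      rintro f ⟨lam, hlam, hf⟩
      obtain ⟨hpos, g, hg0, rfl, hA⟩ := isEigenfunction_iff.1 hf
      refine ⟨g, ?_, rfl⟩
      exact Submodule.mem_iSup_of_mem (⟨lam⁻¹, inv_anti₀ hpos hlam⟩ : Ici x⁻¹)
        (Module.End.mem_eigenspace_iff.2 hA)
    · unfold spectralSubspace
      rw [Submodule.map_iSup]
      refine iSup_le ?_
      rintro ⟨μ, hμ⟩ f ⟨g, hg, rfl⟩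
      by_cases hg0 : g = 0
      · rw [hg0, map_zero]; exact Submodule.zero_mem _
      have hμ0 : 0 < μ := (inv_pos.2 hx).trans_le hμ
      refine Submodule.subset_span ⟨μ⁻¹, inv_le_of_inv_le₀ hx hμ, ?_⟩
      refine isEigenfunction_iff.2 ⟨inv_pos.2 hμ0, g, hg0, rfl, ?_⟩
      rw [inv_inv]
      exact Module.End.mem_eigenspace_iff.1 hg
  unfold eigenvalueCount
  rw [hspan]
  exact (Submodule.equivMapOfInjective primitiveₗ primitive_injective _).finrank_eq.symm

lemma spectralSubspace_le_derivDomain {c : ℝ} (hc : 0 < c) :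
    spectralSubspace (formOperator ν) (Ici c) ≤ derivDomain ν := by
  refine iSup_le ?_
  rintro ⟨μ, hμ⟩ g hg
  have hμ0 : 0 < μ := hc.trans_le hμ
  have hA : formOperator ν g = μ • g := Module.End.mem_eigenspace_iff.1 hg
  have h1 := (derivDomain ν).smul_mem μ⁻¹ (formOperator_range (ν := ν) g)
  rwa [hA, smul_smul, inv_mul_cancel₀ hμ0.ne', one_smul] at h1

lemma inner_formOperator_self {g : UnitL2} (hg : g ∈ derivDomain ν) :
    inner ℝ (formOperator ν g) g = ‖embed ν g‖ ^ 2 := by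
  rw [inner_formOperator, starProjection_of_mem hg, real_inner_self_eq_norm_sq]

/-- Evaluation at the midpoints of the heavy cells. -/
def evalHeavy (ν : Measure ℝ) [IsFiniteMeasure ν] (t : ℝ) (S : Submodule ℝ UnitL2) :
    S →ₗ[ℝ] (heavyCells ν t → ℝ) :=
  LinearMap.pi fun p => (LinearMap.proj (dyadicMid p.1.1 p.1.2)).comp (primitiveₗ.comp S.subtype)

/-- On this spectral subspace `‖embed ν g‖² ≥ c‖g‖²`, while zeros at all heavy midpoints give
`‖embed ν g‖² ≤ t‖g‖²`. Since `t < c`, only `g = 0` remains. -/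
lemma evalHeavy_injective (hν : ν (Ioo (0 : ℝ) 1)ᶜ = 0) {t c : ℝ} (ht : 0 < t) (htc : t < c) :
    Function.Injective (evalHeavy ν t (spectralSubspace (formOperator ν) (Ici c))) := by
  rw [injective_iff_map_eq_zero]
  rintro ⟨g, hg⟩ h0
  have hgV := spectralSubspace_le_derivDomain (ht.trans htc) hg
  have h1 := norm_embed_sq_le hν ht g hgV.1 (fun p hp => congrFun h0 ⟨p, hp⟩)
  have h2 := le_inner_of_mem_spectralSubspace formOperator_isSymmetric hg
  rw [inner_formOperator_self hgV] at h2
  have h3 : ‖g‖ ^ 2 ≤ 0 := by nlinarith [sq_nonneg ‖g‖]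
  have h4 : ‖g‖ = 0 := by nlinarith [norm_nonneg g]
  exact Subtype.ext (norm_eq_zero.1 h4)

/-- This excludes the default value `0` that `finrank` takes on infinite-dimensional spaces, and it
supplies the projection used in the lower bound. -/
lemma finiteDimensional_spectralSubspace (hν : ν (Ioo (0 : ℝ) 1)ᶜ = 0) {c : ℝ} (hc : 0 < c) :
    FiniteDimensional ℝ (spectralSubspace (formOperator ν) (Ici c)) := by
  have : Finite (heavyCells ν (c / 2)) := (heavyCells_finite (half_pos hc)).to_subtype
  exact FiniteDimensional.of_injective _ (evalHeavy_injective hν (half_pos hc) (half_lt_self hc))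

/-- The number of eigenvalues up to `x` is bounded by the number of heavy cells. -/
lemma eigenvalueCount_le_ncard (hν : ν (Ioo (0 : ℝ) 1)ᶜ = 0) {t x : ℝ} (ht : 0 < t) (hx : 0 < x)
    (htx : t * x < 1) : eigenvalueCount ν x ≤ (heavyCells ν t).ncard := by
  have : Fintype (heavyCells ν t) := (heavyCells_finite ht).fintype
  rw [eigenvalueCount_eq_finrank hx]
  have htc : t < x⁻¹ := by rwa [lt_inv_comm₀ ht hx, lt_inv_comm₀ hx ht, ← one_div, lt_div_iff₀ hx]
  refine (LinearMap.finrank_le_finrank_of_injective (evalHeavy_injective hν ht htc)).trans ?_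
  rw [Module.finrank_fintype_fun_eq_card, ← Nat.card_eq_fintype_card, Nat.card_coe_set_eq]

end Operator

/-! ## Tent functions and the lower bound for the eigenvalue count -/

lemma primitive_initialIndicator {x y : ℝ} (hx : 0 ≤ x) (hy : y ∈ Icc (0 : ℝ) 1) :
    primitive (initialIndicator y) x = min x y := by
  unfold primitive initialIndicator
  rw [L2.inner_indicatorConstLp_indicatorConstLp measurableSet_Ioc measurableSet_Ioc,
    Ioc_inter_Ioc, max_self]
  have h0 : 0 ≤ min x y := le_min hx hy.1
  have h1 : Ioc 0 (min x y) ∩ Icc 0 1 = Ioc (0 : ℝ) (min x y) :=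
    inter_eq_left.2 fun t ht => ⟨ht.1.le, ht.2.trans ((min_le_right _ _).trans hy.2)⟩
  rw [Measure.real, Measure.restrict_apply measurableSet_Ioc, h1, Real.volume_Ioc,
    sub_zero, ENNReal.toReal_ofReal h0]
  simp

/-- The piecewise affine function that is `1` on `[k,k+1]` and `0` off `[k-1,k+2]`. -/
def trapezoid (k z : ℝ) : ℝ := (min z k - min z (k - 1)) - (min z (k + 2) - min z (k + 1))

lemma trapezoid_eq_one {k z : ℝ} (h1 : k ≤ z) (h2 : z ≤ k + 1) : trapezoid k z = 1 := by
  unfold trapezoid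
  rw [min_eq_right h1, min_eq_right (by linarith), min_eq_left (by linarith), min_eq_left h2]
  ring

lemma trapezoid_eq_zero_of_le {k z : ℝ} (h : z ≤ k - 1) : trapezoid k z = 0 := by
  unfold trapezoid
  rw [min_eq_left (by linarith), min_eq_left h, min_eq_left (by linarith),
    min_eq_left (by linarith)]
  ring

lemma trapezoid_eq_zero_of_ge {k z : ℝ} (h : k + 2 ≤ z) : trapezoid k z = 0 := by
  unfold trapezoid
  rw [min_eq_right (by linarith), min_eq_right (by linarith), min_eq_right h,
    min_eq_right (by linarith)]
  ring

/-- The derivative of the tent function over the dyadic interval `(k 2⁻ⁿ, (k+1) 2⁻ⁿ]`. -/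
def tent (n k : ℕ) : UnitL2 :=
  (2 : ℝ) ^ n • ((initialIndicator ((k : ℝ) / 2 ^ n) - initialIndicator (((k : ℝ) - 1) / 2 ^ n)) -
    (initialIndicator (((k : ℝ) + 2) / 2 ^ n) - initialIndicator (((k : ℝ) + 1) / 2 ^ n)))

/-- The cells whose neighbours lie in `(0,1]`. -/
def InnerCell (n k : ℕ) : Prop := 1 ≤ k ∧ k + 2 ≤ 2 ^ n

lemma primitive_tent {n k : ℕ} (hk : InnerCell n k) {x : ℝ} (hx : 0 ≤ x) :
    primitive (tent n k) x = trapezoid k (2 ^ n * x) := by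
  have h2 : (0 : ℝ) < 2 ^ n := by positivity
  have hk1 : (1 : ℝ) ≤ k := by exact_mod_cast hk.1
  have hk2 : (k : ℝ) + 2 ≤ 2 ^ n := by exact_mod_cast hk.2
  have hp : ∀ a : ℝ, 0 ≤ a → a ≤ 2 ^ n →
      2 ^ n * primitive (initialIndicator (a / 2 ^ n)) x = min (2 ^ n * x) a := by
    intro a ha ha'
    rw [primitive_initialIndicator hx ⟨by positivity, (div_le_one h2).2 ha'⟩,
      mul_min_of_nonneg _ _ h2.le, mul_div_cancel₀ _ h2.ne']
  unfold tent trapezoid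
  rw [primitive_smul, primitive_sub, primitive_sub, primitive_sub,
    ← hp k (by linarith) (by linarith), ← hp (k - 1) (by linarith) (by linarith),
    ← hp (k + 2) (by linarith) (by linarith), ← hp (k + 1) (by linarith) (by linarith)]
  ring

/-- Pairing `initialIndicator y` with `g` evaluates the primitive of `g` at `y`, so pairing with a
tent combines four values of the other trapezoid. -/
lemma inner_tent_tent {n j k : ℕ} (hj : InnerCell n j) (hk : InnerCell n k) :
    inner ℝ (tent n j) (tent n k) =
      2 ^ n * ((trapezoid k j - trapezoid k (j - 1)) -
        (trapezoid k (j + 2) - trapezoid k (j + 1))) := by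
  have h2 : (0 : ℝ) < 2 ^ n := by positivity
  have hj1 : (1 : ℝ) ≤ j := by exact_mod_cast hj.1
  have hp : ∀ a : ℝ, 0 ≤ a →
      inner ℝ (initialIndicator (a / 2 ^ n)) (tent n k) = trapezoid k a := by
    intro a ha
    change primitive (tent n k) (a / 2 ^ n) = _
    rw [primitive_tent hk (by positivity), mul_div_cancel₀ _ h2.ne']
  rw [← hp j (by linarith), ← hp (j - 1) (by linarith), ← hp (j + 2) (by linarith),
    ← hp (j + 1) (by linarith)]
  conv_lhs => rw [tent]
  rw [inner_smul_left, inner_sub_left, inner_sub_left, inner_sub_left]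
  simp

lemma inner_tent_self {n k : ℕ} (hk : InnerCell n k) :
    inner ℝ (tent n k) (tent n k) = 2 * 2 ^ n := by
  rw [inner_tent_tent hk hk, trapezoid_eq_one le_rfl (by linarith),
    trapezoid_eq_zero_of_le le_rfl, trapezoid_eq_zero_of_ge le_rfl,
    trapezoid_eq_one (by linarith) le_rfl]
  ring

lemma inner_tent_of_separated {n j k : ℕ} (hj : InnerCell n j) (hk : InnerCell n k)
    (h : j + 3 ≤ k ∨ k + 3 ≤ j) : inner ℝ (tent n j) (tent n k) = 0 := by
  rw [inner_tent_tent hj hk]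
  rcases h with h | h
  · have h' : (j : ℝ) + 3 ≤ k := by exact_mod_cast h
    rw [trapezoid_eq_zero_of_le (by linarith), trapezoid_eq_zero_of_le (by linarith),
      trapezoid_eq_zero_of_le (by linarith), trapezoid_eq_zero_of_le (by linarith)]
    ring
  · have h' : (k : ℝ) + 3 ≤ j := by exact_mod_cast h
    rw [trapezoid_eq_zero_of_ge (by linarith), trapezoid_eq_zero_of_ge (by linarith),
      trapezoid_eq_zero_of_ge (by linarith), trapezoid_eq_zero_of_ge (by linarith)]
    ring

/-- A set of inner cells of order `n` with pairwise disjoint neighbourhoods. -/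
def SeparatedCells (n : ℕ) (K : Finset ℕ) : Prop :=
  (∀ k ∈ K, InnerCell n k) ∧ ∀ j ∈ K, ∀ k ∈ K, j ≠ k → j + 3 ≤ k ∨ k + 3 ≤ j

/-- Linear combinations of tent functions. -/
def tentCombination (n : ℕ) (K : Finset ℕ) : (K → ℝ) →ₗ[ℝ] UnitL2 :=
  Fintype.linearCombination ℝ (fun k : K => tent n k)

lemma tentCombination_apply (n : ℕ) (K : Finset ℕ) (c : K → ℝ) :
    tentCombination n K c = ∑ k, c k • tent n k := Fintype.linearCombination_apply ..

section

variable {n : ℕ} {K : Finset ℕ}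

lemma norm_tentCombination_sq (hK : SeparatedCells n K) (c : K → ℝ) :
    ‖tentCombination n K c‖ ^ 2 = 2 * 2 ^ n * ∑ k, c k ^ 2 := by
  rw [← real_inner_self_eq_norm_sq, tentCombination_apply, sum_inner, Finset.mul_sum]
  refine Finset.sum_congr rfl fun k _ => ?_
  rw [inner_sum, Finset.sum_eq_single k]
  · rw [inner_smul_left, inner_smul_right, inner_tent_self (hK.1 k k.2)]
    simp only [conj_trivial]; ring
  · intro j _ hj
    have hne : (k : ℕ) ≠ j := fun h => hj (Subtype.ext h.symm)
    rw [inner_smul_left, inner_smul_right,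
      inner_tent_of_separated (hK.1 k k.2) (hK.1 j j.2) (hK.2 k k.2 j j.2 hne)]
    simp
  · intro h; exact absurd (Finset.mem_univ k) h

lemma primitive_tentCombination (hK : SeparatedCells n K) (c : K → ℝ) {x : ℝ} (hx : 0 ≤ x) :
    primitive (tentCombination n K c) x = ∑ k, c k * trapezoid (k : ℕ) (2 ^ n * x) := by
  rw [← primitiveₗ_apply, tentCombination_apply, map_sum, Finset.sum_apply]
  refine Finset.sum_congr rfl fun k _ => ?_
  rw [primitiveₗ_apply, primitive_smul, primitive_tent (hK.1 k k.2) hx]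

lemma primitive_tentCombination_of_mem (hK : SeparatedCells n K) (c : K → ℝ) {x : ℝ} (j : K)
    (hx : x ∈ dyadic n j) : primitive (tentCombination n K c) x = c j := by
  have hx' := mem_dyadic_iff.1 hx
  have hx0 : 0 ≤ x := le_trans (by positivity) hx.1.le
  rw [primitive_tentCombination hK c hx0, Finset.sum_eq_single j]
  · rw [trapezoid_eq_one hx'.1.le hx'.2, mul_one]
  · intro k _ hk
    have hne : (k : ℕ) ≠ j := fun h => hk (Subtype.ext h)
    rcases hK.2 k k.2 j j.2 hne with h | h
    · have : ((k : ℕ) : ℝ) + 3 ≤ (j : ℕ) := by exact_mod_cast h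
      rw [trapezoid_eq_zero_of_ge (by linarith), mul_zero]
    · have : ((j : ℕ) : ℝ) + 3 ≤ (k : ℕ) := by exact_mod_cast h
      rw [trapezoid_eq_zero_of_le (by linarith), mul_zero]
  · intro h; exact absurd (Finset.mem_univ j) h

lemma primitive_tentCombination_one (hK : SeparatedCells n K) (c : K → ℝ) :
    primitive (tentCombination n K c) 1 = 0 := by
  rw [primitive_tentCombination hK c zero_le_one]
  refine Finset.sum_eq_zero fun k _ => ?_
  have : ((k : ℕ) : ℝ) + 2 ≤ 2 ^ n := by exact_mod_cast (hK.1 k k.2).2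
  rw [mul_one, trapezoid_eq_zero_of_ge this, mul_zero]

variable {ν : Measure ℝ}

lemma support_subset_Icc (hν : ν (Ioo (0 : ℝ) 1)ᶜ = 0) : ν.support ⊆ Icc 0 1 := by
  refine Measure.support_subset_of_isClosed isClosed_Icc ?_
  have : ∀ᵐ x ∂ν, x ∈ Ioo (0 : ℝ) 1 := hν
  filter_upwards [this] with x hx using Ioo_subset_Icc_self hx

/-- The Green function with pole in the support belongs to the form domain. -/
lemma green_mem_derivDomain {x : ℝ} (hx : x ∈ ν.support) (hx' : x ∈ Icc (0 : ℝ) 1) :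
    initialIndicator x - x • initialIndicator 1 ∈ derivDomain ν := by
  have hval : ∀ z ∈ Icc (0 : ℝ) 1,
      primitive (initialIndicator x - x • initialIndicator 1) z = min z x - x * z := by
    intro z hz
    rw [primitive_sub, primitive_smul, primitive_initialIndicator hz.1 hx',
      primitive_initialIndicator hz.1 ⟨zero_le_one, le_rfl⟩, min_eq_left hz.2]
  refine ⟨?_, fun a b c hab hbc hs => ?_⟩
  · rw [hval 1 ⟨zero_le_one, le_rfl⟩, min_eq_right hx'.2]; ring
  · have hxn : x ∉ Icc a c := fun h => (hs h).2 hx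
    rw [hval a (hs ⟨le_rfl, hab.trans hbc⟩).1, hval b (hs ⟨hab, hbc⟩).1,
      hval c (hs ⟨hab.trans hbc, le_rfl⟩).1]
    rcases not_and_or.1 hxn with h | h
    · have h := not_le.1 h
      rw [min_eq_right (by linarith), min_eq_right (by linarith), min_eq_right (by linarith)]
      ring
    · have h := not_le.1 h
      rw [min_eq_left (by linarith), min_eq_left (by linarith), min_eq_left (by linarith)]
      ring

variable [IsFiniteMeasure ν]

/-- On the cell `j` the combination is constantly `c j`, since the other tents vanish there. -/
lemma le_norm_embed_tentCombination_sq (hK : SeparatedCells n K) (c : K → ℝ) {m : ℝ}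
    (hm : ∀ k ∈ K, m ≤ ν.real (dyadic n k)) :
    m * ∑ k, c k ^ 2 ≤ ‖embed ν (tentCombination n K c)‖ ^ 2 := by
  set g := tentCombination n K c
  rw [norm_embed_sq]
  have hdisj : Pairwise fun i j : K => Disjoint (dyadic n i) (dyadic n j) := fun i j hij =>
    dyadic_disjoint fun h => hij (Subtype.ext h)
  calc m * ∑ k, c k ^ 2 ≤ ∑ k : K, ∫ x in dyadic n k, (primitive g x) ^ 2 ∂ν := by
        rw [Finset.mul_sum]
        refine Finset.sum_le_sum fun k _ => ?_
        rw [setIntegral_congr_fun (measurableSet_dyadic n k)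
          (g := fun _ => c k ^ 2) (fun x hx => by
            simp only [g, primitive_tentCombination_of_mem hK c k hx]),
          setIntegral_const, smul_eq_mul]
        exact mul_le_mul_of_nonneg_right (hm k k.2) (sq_nonneg _)
    _ = ∫ x in ⋃ k : K, dyadic n k, (primitive g x) ^ 2 ∂ν := by
        rw [integral_iUnion_fintype (fun k : K => measurableSet_dyadic n k) hdisj
          (fun k => (integrable_primitive_sq ν g).integrableOn)]
    _ ≤ ∫ x, (primitive g x) ^ 2 ∂ν :=
        setIntegral_le_integral (integrable_primitive_sq ν g) (ae_of_all _ fun x => sq_nonneg _)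

/-- Projecting onto the form domain does not change a function on the support. -/
lemma embed_starProjection (hν : ν (Ioo (0 : ℝ) 1)ᶜ = 0) {g : UnitL2} (hg : primitive g 1 = 0) :
    embed ν ((derivDomain ν).starProjection g) = embed ν g := by
  set v := (derivDomain ν).starProjection g with hv
  have hv1 : primitive v 1 = 0 := ((derivDomain ν).starProjection_apply_mem g).1
  have hsupp : ∀ x ∈ ν.support, primitive v x = primitive g x := by
    intro x hx
    -- `g - v` is orthogonal to the domain, hence to the Green function with pole `x`. As both
    -- primitives vanish at `1`, this pairing is the difference of their values at `x`.
    have hgreen := Submodule.starProjection_inner_eq_zero g _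
      (green_mem_derivDomain hx (support_subset_Icc hν hx))
    rw [real_inner_comm, inner_sub_left, inner_smul_left] at hgreen
    change primitive (g - v) x - x * primitive (g - v) 1 = 0 at hgreen
    rw [primitive_sub, primitive_sub, hg, hv1] at hgreen
    linarith
  refine Lp.ext ?_
  filter_upwards [embed_ae ν v, embed_ae ν g, Measure.support_mem_ae (μ := ν)] with x h1 h2 hx
  rw [h1, h2, hsupp x hx]

/-- Each separated family of cells of large mass contributes to the eigenvalue count. -/
lemma card_le_eigenvalueCount (hν : ν (Ioo (0 : ℝ) 1)ᶜ = 0) (hK : SeparatedCells n K) {m x : ℝ}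
    (hm : ∀ k ∈ K, m ≤ ν.real (dyadic n k)) (hx : 0 < x) (hmx : 2 * 2 ^ n < m * x) :
    K.card ≤ eigenvalueCount ν x := by
  rw [eigenvalueCount_eq_finrank hx]
  -- With fewer eigenvalues than cells, some nonzero tent combination is orthogonal to the spectral
  -- subspace. Projecting it to the form domain keeps this orthogonality and its `L²(ν)` class, and
  -- does not increase the energy. Its Rayleigh quotient is then at least `m / (2 * 2 ^ n)` and at
  -- most `x⁻¹`, a contradiction.
  by_contra hlt
  have hc : 0 < x⁻¹ := inv_pos.2 hx
  set S := spectralSubspace (formOperator ν) (Ici x⁻¹) with hS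
  have : FiniteDimensional ℝ S := finiteDimensional_spectralSubspace hν hc
  set T : (K → ℝ) →ₗ[ℝ] S := S.orthogonalProjectionOnto.toLinearMap.comp (tentCombination n K)
  have hker : T.ker ≠ ⊥ := LinearMap.ker_ne_bot_of_finrank_lt (by
    rw [Module.finrank_fintype_fun_eq_card, Fintype.card_coe]; exact not_le.1 hlt)
  obtain ⟨c, hcker, hc0⟩ := Submodule.exists_mem_ne_zero_of_ne_bot hker
  set g := tentCombination n K c with hg
  have hgS : g ∈ Sᗮ := by
    rw [← Submodule.orthogonalProjectionOnto_eq_zero_iff]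
    exact hcker
  set v := (derivDomain ν).starProjection g with hv
  have hvS : v ∈ Sᗮ := by
    intro s hs
    rw [← Submodule.inner_starProjection_left_eq_right,
      starProjection_of_mem (spectralSubspace_le_derivDomain hc hs)]
    exact hgS s hs
  have hvg : ‖v‖ ≤ ‖g‖ := Submodule.norm_starProjection_apply_le _ _
  have h1 := inner_le_of_mem_spectralSubspace_orthogonal formOperator_isSymmetric
    (isCompactOperator_formOperator hν) hvS
  rw [inner_formOperator_self ((derivDomain ν).starProjection_apply_mem g),
    embed_starProjection hν (primitive_tentCombination_one hK c)] at h1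
  have h2 := le_norm_embed_tentCombination_sq hK c hm
  have h3 := norm_tentCombination_sq hK c
  have hsum : 0 < ∑ k, c k ^ 2 := by
    obtain ⟨k, hk⟩ := Function.ne_iff.1 hc0
    exact Finset.sum_pos' (fun k _ => sq_nonneg _) ⟨k, Finset.mem_univ _, by
      have : c k ≠ 0 := hk
      positivity⟩
  have h4 : x⁻¹ * ‖v‖ ^ 2 ≤ x⁻¹ * ‖g‖ ^ 2 := by gcongr
  have h5 : m * ∑ k, c k ^ 2 ≤ x⁻¹ * (2 * 2 ^ n * ∑ k, c k ^ 2) := by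
    rw [← h3]; exact h2.trans (h1.trans h4)
  have h6 : m ≤ x⁻¹ * (2 * 2 ^ n) := by
    rw [← mul_assoc] at h5
    exact le_of_mul_le_mul_right h5 hsum
  have h7 : m * x ≤ 2 * 2 ^ n := by
    calc m * x ≤ x⁻¹ * (2 * 2 ^ n) * x := by gcongr
      _ = 2 * 2 ^ n := by field_simp
  linarith

end

/-- Every set of cells contains a separated subset of at least a third of its size, up to the two
cells at the boundary. -/
lemma exists_separatedCells {n : ℕ} {K : Finset ℕ} (hK : ∀ k ∈ K, k < 2 ^ n) :
    ∃ K' ⊆ K, SeparatedCells n K' ∧ K.card ≤ 3 * K'.card + 2 := by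
  classical
  set L := K.filter (fun k => InnerCell n k) with hL
  have hLK : K.card ≤ L.card + 2 := by
    have hsub : K ⊆ L ∪ {0, 2 ^ n - 1} := by
      intro k hk
      by_cases h : InnerCell n k
      · exact Finset.mem_union_left _ (Finset.mem_filter.2 ⟨hk, h⟩)
      · refine Finset.mem_union_right _ ?_
        have := hK k hk
        simp only [InnerCell, not_and_or, not_le] at h
        simp only [Finset.mem_insert, Finset.mem_singleton]
        omega
    calc K.card ≤ (L ∪ {0, 2 ^ n - 1}).card := Finset.card_le_card hsub
      _ ≤ L.card + ({0, 2 ^ n - 1} : Finset ℕ).card := Finset.card_union_le _ _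
      _ ≤ L.card + 2 := by gcongr; exact Finset.card_le_two
  -- Distinct positions in one residue class modulo `3` differ by at least `3`; the largest class
  -- has at least a third of the cells.
  obtain ⟨r, -, hr⟩ : ∃ r ∈ Finset.range 3,
      L.card ≤ 3 * (L.filter (fun k => k % 3 = r)).card := by
    by_contra! h
    have hs : L.card = ∑ r ∈ Finset.range 3, (L.filter (fun k => k % 3 = r)).card :=
      Finset.card_eq_sum_card_fiberwise fun k _ => by
        simp only [Finset.coe_range, mem_Iio]; exact Nat.mod_lt _ (by norm_num)
    have h0 := h 0 (by simp)
    have h1 := h 1 (by simp)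
    have h2 := h 2 (by simp)
    simp only [Finset.sum_range_succ, Finset.sum_range_zero] at hs
    omega
  refine ⟨L.filter (fun k => k % 3 = r), (Finset.filter_subset _ _).trans (Finset.filter_subset _ _),
    ⟨fun k hk => ?_, fun j hj k hk hjk => ?_⟩, by omega⟩
  · exact (Finset.mem_filter.1 (Finset.mem_filter.1 hk).1).2
  · have h1 := (Finset.mem_filter.1 hj).2
    have h2 := (Finset.mem_filter.1 hk).2
    omega

/-! ## The partition function and its exponents -/

/-- A nonzero measure carried by the open unit interval. -/
structure UnitSupported (ν : Measure ℝ) : Prop where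
  ne_zero : ν ≠ 0
  compl_eq_zero : ν (Ioo (0 : ℝ) 1)ᶜ = 0

section Partition

variable {ν : Measure ℝ}

open Classical in
/-- The positions of the dyadic cells of order `n` with positive measure. -/
def cells (ν : Measure ℝ) (n : ℕ) : Finset ℕ :=
  (Finset.range (2 ^ n)).filter (fun k => 0 < ν (dyadic n k))

/-- The mass of a dyadic cell. -/
abbrev mass (ν : Measure ℝ) (n k : ℕ) : ℝ := ν.real (dyadic n k)

/-- The partition function `∑ ν(C)^q`. -/
def partitionSum (ν : Measure ℝ) (n : ℕ) (q : ℝ) : ℝ := ∑ k ∈ cells ν n, mass ν n k ^ q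

/-- The exponent of the total mass at scale `2⁻ⁿ`. -/
def massExponent (ν : Measure ℝ) (n : ℕ) : ℝ := Real.log (ν.real univ) / Real.log (2 ^ n)

lemma betaN_eq (n : ℕ) (q : ℝ) :
    betaN ν n q = Real.log (partitionSum ν n q) / Real.log (2 ^ n) := rfl

lemma lt_of_mem_cells {n k : ℕ} (hk : k ∈ cells ν n) : k < 2 ^ n := by
  classical
  exact Finset.mem_range.1 (Finset.mem_filter.1 hk).1

lemma partitionSum_zero (n : ℕ) : partitionSum ν n 0 = (cells ν n).card := by
  simp [partitionSum]

lemma log_two_pow_pos {n : ℕ} (hn : n ≠ 0) : 0 < Real.log ((2 : ℝ) ^ n) :=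
  Real.log_pos (one_lt_pow₀ (by norm_num) hn)

lemma tendsto_log_two_pow : Tendsto (fun n : ℕ => Real.log ((2 : ℝ) ^ n)) atTop atTop := by
  simp_rw [Real.log_pow]
  exact tendsto_natCast_atTop_atTop.atTop_mul_const (Real.log_pos (by norm_num))

lemma tendsto_massExponent : Tendsto (massExponent ν) atTop (𝓝 0) :=
  tendsto_log_two_pow.const_div_atTop _

lemma UnitSupported.ae_mem (h : UnitSupported ν) : ∀ᵐ x ∂ν, x ∈ Ioc (0 : ℝ) 1 := by
  have : ∀ᵐ x ∂ν, x ∈ Ioo (0 : ℝ) 1 := h.compl_eq_zero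
  filter_upwards [this] with x hx using Ioo_subset_Ioc_self hx

variable [IsFiniteMeasure ν]

lemma mass_pos {n k : ℕ} (hk : k ∈ cells ν n) : 0 < mass ν n k := by
  classical
  exact ENNReal.toReal_pos (Finset.mem_filter.1 hk).2.ne' (measure_ne_top _ _)

lemma mass_le (n k : ℕ) : mass ν n k ≤ ν.real univ :=
  measureReal_mono (subset_univ _) (measure_ne_top ν _)

lemma mem_cells {n k : ℕ} : k ∈ cells ν n ↔ k < 2 ^ n ∧ 0 < mass ν n k := by
  classical
  refine ⟨fun h => ⟨lt_of_mem_cells h, mass_pos h⟩, fun h => ?_⟩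
  refine Finset.mem_filter.2 ⟨Finset.mem_range.2 h.1, ?_⟩
  by_contra h0
  have h1 : ν (dyadic n k) = 0 := le_antisymm (not_lt.1 h0) bot_le
  exact absurd h.2 (by simp [mass, Measure.real, h1])

lemma UnitSupported.total_pos (h : UnitSupported ν) : 0 < ν.real univ := by
  have := h.ne_zero
  have : NeZero ν := ⟨this⟩
  simp [Measure.real, ENNReal.toReal_pos_iff, measure_lt_top, pos_iff_ne_zero, this.ne]

lemma UnitSupported.sum_mass (h : UnitSupported ν) (n : ℕ) :
    ∑ k ∈ cells ν n, mass ν n k = ν.real univ := by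
  classical
  have h1 : ν.real univ = ν.real (Ioc (0 : ℝ) 1) := by
    refine (measureReal_congr ?_)
    filter_upwards [h.ae_mem] with x hx
    exact propext ⟨fun _ => hx, fun _ => trivial⟩
  rw [h1, Ioc_eq_biUnion_dyadic n, measureReal_biUnion_finset
    (fun i _ j _ hij => dyadic_disjoint hij) (fun k _ => measurableSet_dyadic n k)]
  refine Finset.sum_subset (Finset.filter_subset _ _) fun k hk hk' => ?_
  by_contra hne
  exact hk' (mem_cells.2 ⟨Finset.mem_range.1 hk, lt_of_le_of_ne measureReal_nonneg (Ne.symm hne)⟩)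

lemma UnitSupported.cells_nonempty (h : UnitSupported ν) (n : ℕ) : (cells ν n).Nonempty := by
  rw [Finset.nonempty_iff_ne_empty]
  intro h0
  have := h.sum_mass n
  rw [h0, Finset.sum_empty] at this
  exact h.total_pos.ne this

lemma UnitSupported.partitionSum_pos (h : UnitSupported ν) (n : ℕ) (q : ℝ) :
    0 < partitionSum ν n q :=
  Finset.sum_pos (fun _ hk => Real.rpow_pos_of_pos (mass_pos hk) q) (h.cells_nonempty n)

lemma UnitSupported.partitionSum_one (h : UnitSupported ν) (n : ℕ) :
    partitionSum ν n 1 = ν.real univ := by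
  simp only [partitionSum, Real.rpow_one]; exact h.sum_mass n

lemma UnitSupported.partitionSum_eq_rpow (h : UnitSupported ν) {n : ℕ} (hn : n ≠ 0) (q : ℝ) :
    partitionSum ν n q = ((2 : ℝ) ^ n) ^ betaN ν n q := by
  rw [betaN_eq, Real.rpow_def_of_pos (by positivity), mul_div_cancel₀ _ (log_two_pow_pos hn).ne',
    Real.exp_log (h.partitionSum_pos n q)]

lemma UnitSupported.betaN_one (h : UnitSupported ν) (n : ℕ) :
    betaN ν n 1 = massExponent ν n := by
  rw [betaN_eq, h.partitionSum_one, massExponent]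

lemma UnitSupported.betaN_zero_nonneg (h : UnitSupported ν) (n : ℕ) : 0 ≤ betaN ν n 0 := by
  rw [betaN_eq, partitionSum_zero]
  refine div_nonneg (Real.log_nonneg ?_) (Real.log_nonneg (one_le_pow₀ (by norm_num)))
  exact_mod_cast (h.cells_nonempty n).card_pos

lemma UnitSupported.betaN_zero_le_one (h : UnitSupported ν) {n : ℕ} (hn : n ≠ 0) :
    betaN ν n 0 ≤ 1 := by
  classical
  rw [betaN_eq, partitionSum_zero, div_le_one (log_two_pow_pos hn)]
  refine Real.log_le_log (by exact_mod_cast (h.cells_nonempty n).card_pos) ?_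
  have : (cells ν n).card ≤ 2 ^ n := by
    simpa [cells] using Finset.card_filter_le (Finset.range (2 ^ n))
      (fun k => 0 < ν (dyadic n k))
  exact_mod_cast this

/-- `β_n` is decreasing up to the exponent of the total mass. -/
lemma UnitSupported.betaN_le (h : UnitSupported ν) {n : ℕ} (hn : n ≠ 0) {q r : ℝ} (hqr : q ≤ r) :
    betaN ν n r ≤ betaN ν n q + (r - q) * massExponent ν n := by
  have hL := log_two_pow_pos hn
  have hsum : partitionSum ν n r ≤ ν.real univ ^ (r - q) * partitionSum ν n q := by
    unfold partitionSum
    rw [Finset.mul_sum]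
    refine Finset.sum_le_sum fun k hk => ?_
    have hm := mass_pos hk
    calc mass ν n k ^ r = mass ν n k ^ (r - q) * mass ν n k ^ q := by
          rw [← Real.rpow_add hm]; congr 1; ring
      _ ≤ ν.real univ ^ (r - q) * mass ν n k ^ q := by
          refine mul_le_mul_of_nonneg_right ?_ (Real.rpow_pos_of_pos hm q).le
          exact Real.rpow_le_rpow hm.le (mass_le n k) (sub_nonneg.2 hqr)
  have hlog := Real.log_le_log (h.partitionSum_pos n r) hsum
  rw [Real.log_mul (Real.rpow_pos_of_pos h.total_pos _).ne' (h.partitionSum_pos n q).ne',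
    Real.log_rpow h.total_pos] at hlog
  rw [betaN_eq, betaN_eq, massExponent, mul_div_assoc', ← add_div]
  gcongr
  linarith

/-- A crude lower bound: some cell has at least the average mass. -/
lemma UnitSupported.le_betaN (h : UnitSupported ν) {n : ℕ} (hn : n ≠ 0) {q : ℝ} (hq : 0 ≤ q) :
    q * massExponent ν n - q ≤ betaN ν n q := by
  have hL := log_two_pow_pos hn
  have h2 : (0 : ℝ) < 2 ^ n := by positivity
  have hcard : ((cells ν n).card : ℝ) ≤ 2 ^ n := by
    have h1 := h.betaN_zero_le_one hn
    rw [betaN_eq, partitionSum_zero, div_le_one hL] at h1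
    exact (Real.log_le_log_iff (by exact_mod_cast (h.cells_nonempty n).card_pos) h2).1 h1
  obtain ⟨k, hk, hkm⟩ : ∃ k ∈ cells ν n, ν.real univ / 2 ^ n ≤ mass ν n k := by
    refine Finset.exists_le_of_sum_le (h.cells_nonempty n) ?_
    rw [h.sum_mass, Finset.sum_const, nsmul_eq_mul]
    calc ((cells ν n).card : ℝ) * (ν.real univ / 2 ^ n) ≤ 2 ^ n * (ν.real univ / 2 ^ n) := by
          have := h.total_pos
          gcongr
      _ = ν.real univ := by field_simp
  have hpos : 0 < ν.real univ / 2 ^ n := div_pos h.total_pos h2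
  have hsum : (ν.real univ / 2 ^ n) ^ q ≤ partitionSum ν n q :=
    (Real.rpow_le_rpow hpos.le hkm hq).trans
      (Finset.single_le_sum (f := fun k => mass ν n k ^ q)
        (fun j hj => (Real.rpow_pos_of_pos (mass_pos hj) q).le) hk)
  have hlog := Real.log_le_log (Real.rpow_pos_of_pos hpos q) hsum
  rw [Real.log_rpow hpos, Real.log_div h.total_pos.ne' h2.ne'] at hlog
  rw [betaN_eq, massExponent, le_div_iff₀ hL]
  calc (q * (Real.log (ν.real univ) / Real.log (2 ^ n)) - q) * Real.log (2 ^ n)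
      = q * (Real.log (ν.real univ) - Real.log (2 ^ n)) := by field_simp
    _ ≤ _ := hlog

/-- Log-convexity of power sums in the exponent: Hölder's inequality with exponents `1/a` and `1/b`.
-/
lemma UnitSupported.convexOn_betaN (h : UnitSupported ν) (n : ℕ) :
    ConvexOn ℝ univ (betaN ν n) := by
  refine ⟨convex_univ, fun q _ r _ a b ha hb hab => ?_⟩
  rcases ha.eq_or_lt with rfl | ha
  · have : b = 1 := by linarith
    subst this; simp
  rcases hb.eq_or_lt with rfl | hb
  · have : a = 1 := by linarith
    subst this; simp
  simp only [smul_eq_mul]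
  have hH := Real.inner_le_Lp_mul_Lq_of_nonneg (cells ν n)
    (f := fun k => mass ν n k ^ (a * q)) (g := fun k => mass ν n k ^ (b * r))
    (Real.HolderConjugate.inv_inv ha hb hab)
    (fun k hk => (Real.rpow_pos_of_pos (mass_pos hk) _).le)
    (fun k hk => (Real.rpow_pos_of_pos (mass_pos hk) _).le)
  have e1 : ∑ k ∈ cells ν n, mass ν n k ^ (a * q) * mass ν n k ^ (b * r) =
      partitionSum ν n (a * q + b * r) :=
    Finset.sum_congr rfl fun k hk => (Real.rpow_add (mass_pos hk) _ _).symm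
  have e2 : ∀ {c s : ℝ}, 0 < c →
      ∑ k ∈ cells ν n, (mass ν n k ^ (c * s)) ^ c⁻¹ = partitionSum ν n s := by
    intro c s hc
    refine Finset.sum_congr rfl fun k hk => ?_
    rw [← Real.rpow_mul (mass_pos hk).le]
    congr 1
    field_simp
  rw [e1, e2 ha, e2 hb, one_div, one_div, inv_inv, inv_inv] at hH
  have hlog := Real.log_le_log (h.partitionSum_pos n _) hH
  rw [Real.log_mul (Real.rpow_pos_of_pos (h.partitionSum_pos n q) a).ne'
    (Real.rpow_pos_of_pos (h.partitionSum_pos n r) b).ne',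
    Real.log_rpow (h.partitionSum_pos n q), Real.log_rpow (h.partitionSum_pos n r)] at hlog
  rw [betaN_eq, betaN_eq, betaN_eq, mul_div_assoc', mul_div_assoc', ← add_div]
  exact div_le_div_of_nonneg_right hlog (Real.log_nonneg (one_le_pow₀ (by norm_num)))

lemma UnitSupported.continuous_betaN (h : UnitSupported ν) (n : ℕ) : Continuous (betaN ν n) := by
  have : ContinuousOn (betaN ν n) univ := (h.convexOn_betaN n).continuousOn isOpen_univ
  rwa [continuousOn_univ] at this

/-! ## The fixed points -/

/-- Difference quotients of `β_n` are at most the exponent of the total mass. Once this is below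
`1`, `β_n(q) - q` is strictly decreasing, nonnegative at `0` and negative at `1`. -/
lemma UnitSupported.eventually_fixedPoint (h : UnitSupported ν) :
    ∀ᶠ n in atTop, betaN ν n (fixedPoint ν n) = fixedPoint ν n ∧ fixedPoint ν n ∈ Icc (0 : ℝ) 1 := by
  have hc : ∀ᶠ n in atTop, massExponent ν n < 1 :=
    (tendsto_massExponent (ν := ν)).eventually (gt_mem_nhds zero_lt_one)
  filter_upwards [hc, eventually_ne_atTop 0] with n hn hn0
  have hmono : ∀ {q r : ℝ}, q < r → betaN ν n r - r < betaN ν n q - q := by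
    intro q r hqr
    have := h.betaN_le hn0 hqr.le
    nlinarith
  have hcont : ContinuousOn (fun q => betaN ν n q - q) (Icc 0 1) :=
    ((h.continuous_betaN n).sub continuous_id).continuousOn
  have hivt := intermediate_value_Icc' zero_le_one hcont
  obtain ⟨q, hq, hq0⟩ := hivt (show (0 : ℝ) ∈ Icc (betaN ν n 1 - 1) (betaN ν n 0 - 0) from
    ⟨by rw [h.betaN_one]; linarith, by rw [sub_zero]; exact h.betaN_zero_nonneg n⟩)
  have hset : {q : ℝ | betaN ν n q = q} = {q} := by
    ext r
    simp only [mem_ofPred_eq, mem_singleton_iff]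
    simp only at hq0
    constructor
    · intro hr
      rcases lt_trichotomy r q with hlt | heq | hgt
      · have := hmono hlt; linarith
      · exact heq
      · have := hmono hgt; linarith
    · rintro rfl; linarith
  have hfix : fixedPoint ν n = q := by
    unfold fixedPoint; rw [hset, csInf_singleton]
  rw [hfix]
  exact ⟨by simp only at hq0; linarith, hq⟩

lemma UnitSupported.fixedPoint_isBoundedUnder (h : UnitSupported ν) :
    IsBoundedUnder (· ≤ ·) atTop (fixedPoint ν) :=
  isBoundedUnder_of_eventually_le (a := 1) (h.eventually_fixedPoint.mono fun _ hn => hn.2.2)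

lemma UnitSupported.fixedPoint_isCoboundedUnder (h : UnitSupported ν) :
    IsCoboundedUnder (· ≤ ·) atTop (fixedPoint ν) :=
  (isBoundedUnder_of_eventually_ge (a := 0)
    (h.eventually_fixedPoint.mono fun _ hn => hn.2.1)).isCoboundedUnder_le

lemma UnitSupported.qBar_nonneg (h : UnitSupported ν) : 0 ≤ qBar ν :=
  le_limsup_of_frequently_le (h.eventually_fixedPoint.mono fun _ hn => hn.2.1).frequently
    h.fixedPoint_isBoundedUnder

lemma UnitSupported.qBar_le_one (h : UnitSupported ν) : qBar ν ≤ 1 :=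
  limsup_le_of_le h.fixedPoint_isCoboundedUnder
    (h.eventually_fixedPoint.mono fun _ hn => hn.2.2)

/-! ## The limit exponent as a real function -/

/-- The `L^q`-spectrum as a real function, meaningful for `q ≥ 0`. -/
def betaReal (ν : Measure ℝ) (q : ℝ) : ℝ := (beta ν q).toReal

lemma UnitSupported.eventually_betaN_mem (h : UnitSupported ν) {q : ℝ} (hq : 0 ≤ q) :
    ∀ᶠ n in atTop, betaN ν n q ∈ Icc (-q - 1) 2 := by
  have hlim : Tendsto (fun n => q * massExponent ν n) atTop (𝓝 0) := by
    simpa using (tendsto_massExponent (ν := ν)).const_mul q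
  filter_upwards [hlim.eventually (gt_mem_nhds zero_lt_one),
    hlim.eventually (lt_mem_nhds (show (-1 : ℝ) < 0 by norm_num)), eventually_ne_atTop 0]
    with n h1 h2 hn
  have h3 := h.betaN_le hn hq
  have h4 := h.betaN_zero_le_one hn
  have h5 := h.le_betaN hn hq
  rw [sub_zero] at h3
  exact ⟨by linarith, by linarith⟩

lemma UnitSupported.coe_betaReal (h : UnitSupported ν) {q : ℝ} (hq : 0 ≤ q) :
    (betaReal ν q : EReal) = beta ν q := by
  have hev := h.eventually_betaN_mem hq
  have h1 : beta ν q ≤ ((2 : ℝ) : EReal) :=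
    limsup_le_of_le (by isBoundedDefault) (hev.mono fun n hn => EReal.coe_le_coe_iff.2 hn.2)
  have h2 : ((-q - 1 : ℝ) : EReal) ≤ beta ν q :=
    le_limsup_of_frequently_le
      (hev.mono fun n hn => EReal.coe_le_coe_iff.2 hn.1).frequently (by isBoundedDefault)
  exact EReal.coe_toReal (ne_top_of_le_ne_top (EReal.coe_ne_top _) h1)
    (ne_bot_of_le_ne_bot (EReal.coe_ne_bot _) h2)

lemma UnitSupported.eventually_betaN_lt (h : UnitSupported ν) {q r : ℝ} (hq : 0 ≤ q)
    (hr : betaReal ν q < r) : ∀ᶠ n in atTop, betaN ν n q < r := by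
  have h1 : beta ν q < (r : EReal) := by
    rw [← h.coe_betaReal hq]; exact EReal.coe_lt_coe_iff.2 hr
  exact (eventually_lt_of_limsup_lt h1).mono fun n hn => EReal.coe_lt_coe_iff.1 hn

lemma UnitSupported.frequently_lt_betaN (h : UnitSupported ν) {q r : ℝ} (hq : 0 ≤ q)
    (hr : r < betaReal ν q) : ∃ᶠ n in atTop, r < betaN ν n q := by
  have h1 : (r : EReal) < beta ν q := by
    rw [← h.coe_betaReal hq]; exact EReal.coe_lt_coe_iff.2 hr
  exact (frequently_lt_of_lt_limsup (by isBoundedDefault) h1).mono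
    fun n hn => EReal.coe_lt_coe_iff.1 hn

lemma UnitSupported.eventually_lt_betaN (h : UnitSupported ν) {q r : ℝ} (hq : 0 ≤ q)
    (heq : beta ν q = betaLower ν q) (hr : r < betaReal ν q) :
    ∀ᶠ n in atTop, r < betaN ν n q := by
  have h1 : (r : EReal) < betaLower ν q := by
    rw [← heq, ← h.coe_betaReal hq]; exact EReal.coe_lt_coe_iff.2 hr
  exact (eventually_lt_of_lt_liminf h1).mono fun n hn => EReal.coe_lt_coe_iff.1 hn

lemma UnitSupported.betaReal_le (h : UnitSupported ν) {q r : ℝ} (hq : 0 ≤ q)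
    (hr : ∀ᶠ n in atTop, betaN ν n q ≤ r) : betaReal ν q ≤ r := by
  by_contra! hlt
  obtain ⟨n, hn1, hn2⟩ := ((h.frequently_lt_betaN hq hlt).and_eventually hr).exists
  linarith

lemma UnitSupported.le_betaReal (h : UnitSupported ν) {q r : ℝ} (hq : 0 ≤ q)
    (hr : ∃ᶠ n in atTop, r ≤ betaN ν n q) : r ≤ betaReal ν q := by
  by_contra! hlt
  obtain ⟨n, hn1, hn2⟩ := (hr.and_eventually (h.eventually_betaN_lt hq hlt)).exists
  linarith

lemma UnitSupported.betaReal_one (h : UnitSupported ν) : betaReal ν 1 = 0 := by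
  have hlim : Tendsto (fun n => betaN ν n 1) atTop (𝓝 0) := by
    simp_rw [h.betaN_one]; exact tendsto_massExponent
  refine le_antisymm (le_of_forall_pos_le_add fun ε hε => ?_)
    (le_of_forall_pos_le_add fun ε hε => ?_)
  · rw [zero_add]
    exact h.betaReal_le zero_le_one ((hlim.eventually (gt_mem_nhds hε)).mono fun _ hn => hn.le)
  · rw [← sub_le_iff_le_add, zero_sub]
    exact h.le_betaReal zero_le_one
      ((hlim.eventually (lt_mem_nhds (neg_lt_zero.2 hε))).mono fun _ hn => hn.le).frequently

lemma UnitSupported.antitoneOn_betaReal (h : UnitSupported ν) :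
    AntitoneOn (betaReal ν) (Ici 0) := by
  intro q hq r hr hqr
  refine le_of_forall_pos_le_add fun ε hε => ?_
  have hlim : Tendsto (fun n => (r - q) * massExponent ν n) atTop (𝓝 0) := by
    simpa using (tendsto_massExponent (ν := ν)).const_mul (r - q)
  refine h.betaReal_le hr ?_
  filter_upwards [hlim.eventually (gt_mem_nhds (half_pos hε)), eventually_ne_atTop 0,
    h.eventually_betaN_lt hq (show betaReal ν q < betaReal ν q + ε / 2 by linarith)] with n h1 hn h2
  linarith [h.betaN_le hn hqr]

lemma UnitSupported.convexOn_betaReal (h : UnitSupported ν) :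
    ConvexOn ℝ (Ici 0) (betaReal ν) := by
  refine ⟨convex_Ici 0, fun q hq r hr a b ha hb hab => ?_⟩
  have hq' : (0 : ℝ) ≤ q := hq
  have hr' : (0 : ℝ) ≤ r := hr
  simp only [smul_eq_mul]
  refine le_of_forall_pos_le_add fun ε hε => h.betaReal_le (by positivity) ?_
  filter_upwards [h.eventually_betaN_lt hq' (show betaReal ν q < betaReal ν q + ε by linarith),
    h.eventually_betaN_lt hr' (show betaReal ν r < betaReal ν r + ε by linarith)] with n h1 h2
  have h3 := (h.convexOn_betaN n).2 (mem_univ q) (mem_univ r) ha hb hab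
  simp only [smul_eq_mul] at h3
  have h4 : a * betaN ν n q ≤ a * (betaReal ν q + ε) := by gcongr
  have h5 : b * betaN ν n r ≤ b * (betaReal ν r + ε) := by gcongr
  have h6 : a * ε + b * ε = ε := by rw [← add_mul, hab, one_mul]
  linarith

lemma UnitSupported.betaReal_nonneg (h : UnitSupported ν) {q : ℝ} (hq : q ∈ Icc (0 : ℝ) 1) :
    0 ≤ betaReal ν q := by
  rw [← h.betaReal_one]
  exact h.antitoneOn_betaReal hq.1 (mem_Ici.2 zero_le_one) hq.2

lemma UnitSupported.continuousAt_betaReal (h : UnitSupported ν) {q : ℝ} (hq : 0 < q) :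
    ContinuousAt (betaReal ν) q := by
  have h1 : ContinuousOn (betaReal ν) (Ioi 0) :=
    (h.convexOn_betaReal.subset Ioi_subset_Ici_self (convex_Ioi 0)).continuousOn isOpen_Ioi
  exact h1.continuousAt (Ioi_mem_nhds hq)

/-- Eventually `q_n < q`, and monotonicity up to `o(1)` gives `β_n(q) ≤ β_n(q_n) + o(1) = q_n +
o(1)`. -/
lemma UnitSupported.betaReal_le_qBar (h : UnitSupported ν) {q : ℝ} (hq : qBar ν < q) :
    betaReal ν q ≤ qBar ν := by
  have hq0 : 0 ≤ q := h.qBar_nonneg.trans hq.le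
  refine le_of_forall_pos_le_add fun ε hε => h.betaReal_le hq0 ?_
  set η := min (ε / 2) ((q - qBar ν) / 2) with hη
  have hη0 : 0 < η := lt_min (by linarith) (by linarith)
  have hη1 : η ≤ ε / 2 := min_le_left _ _
  have hη2 : η ≤ (q - qBar ν) / 2 := min_le_right _ _
  have hlim : Tendsto (fun n => q * |massExponent ν n|) atTop (𝓝 0) := by
    simpa using (tendsto_massExponent (ν := ν)).abs.const_mul q
  have hlt : ∀ᶠ n in atTop, fixedPoint ν n < qBar ν + η :=
    eventually_lt_of_limsup_lt (show qBar ν < qBar ν + η by linarith) h.fixedPoint_isBoundedUnder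
  filter_upwards [hlt, h.eventually_fixedPoint, eventually_ne_atTop 0,
    hlim.eventually (gt_mem_nhds (half_pos hε))] with n h1 h2 hn h3
  have h4 := h.betaN_le hn (show fixedPoint ν n ≤ q by linarith)
  have h5 : (q - fixedPoint ν n) * massExponent ν n ≤ q * |massExponent ν n| := by
    have h6 : 0 ≤ q - fixedPoint ν n := by linarith
    calc (q - fixedPoint ν n) * massExponent ν n
        ≤ (q - fixedPoint ν n) * |massExponent ν n| := by gcongr; exact le_abs_self _
      _ ≤ q * |massExponent ν n| := by gcongr; linarith [h2.2.1]
  rw [h2.1] at h4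
  linarith

/-- Infinitely often `q_n` exceeds `q` and is close to `q̄`, and then `β_n(q) ≥ q_n - o(1)`.
Infinitely many orders suffice because `β` is an upper limit. -/
lemma UnitSupported.qBar_le_betaReal_of_lt (h : UnitSupported ν) {q : ℝ} (hq0 : 0 ≤ q)
    (hq : q < qBar ν) : qBar ν ≤ betaReal ν q := by
  refine le_of_forall_pos_le_add fun ε hε => ?_
  rw [← sub_le_iff_le_add]
  refine h.le_betaReal hq0 ?_
  set η := min (ε / 2) (qBar ν - q) with hη
  have hη0 : 0 < η := lt_min (by linarith) (by linarith)
  have hη1 : η ≤ ε / 2 := min_le_left _ _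
  have hη2 : η ≤ qBar ν - q := min_le_right _ _
  have hlim : Tendsto (fun n => |massExponent ν n|) atTop (𝓝 0) := by
    simpa using (tendsto_massExponent (ν := ν)).abs
  have hfreq : ∃ᶠ n in atTop, qBar ν - η < fixedPoint ν n :=
    frequently_lt_of_lt_limsup h.fixedPoint_isCoboundedUnder
      (show qBar ν - η < qBar ν by linarith)
  refine (hfreq.and_eventually ((h.eventually_fixedPoint.and (eventually_ne_atTop 0)).and
    (hlim.eventually (gt_mem_nhds (half_pos hε))))).mono ?_
  rintro n ⟨h1, ⟨h2, hn⟩, h3⟩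
  have h4 := h.betaN_le hn (show q ≤ fixedPoint ν n by linarith)
  have h5 : (fixedPoint ν n - q) * massExponent ν n ≤ |massExponent ν n| := by
    have h6 : 0 ≤ fixedPoint ν n - q := by linarith
    calc (fixedPoint ν n - q) * massExponent ν n
        ≤ (fixedPoint ν n - q) * |massExponent ν n| := by gcongr; exact le_abs_self _
      _ ≤ 1 * |massExponent ν n| := by gcongr; linarith [h2.2.2]
      _ = |massExponent ν n| := one_mul _
  rw [h2.1] at h4
  linarith

/-- A positive `q̄` is a fixed point of the spectrum. -/
lemma UnitSupported.betaReal_qBar (h : UnitSupported ν) (hpos : 0 < qBar ν) :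
    betaReal ν (qBar ν) = qBar ν := by
  -- Convexity gives continuity only inside the half-line, hence the assumption `q̄ > 0`. The bounds
  -- from the two sides of `q̄` then meet.
  have hc := h.continuousAt_betaReal hpos
  apply le_antisymm
  · refine le_of_tendsto (hc.tendsto.mono_left (nhdsWithin_le_nhds (s := Ioi (qBar ν)))) ?_
    filter_upwards [self_mem_nhdsWithin] with q hq using h.betaReal_le_qBar hq
  · refine ge_of_tendsto (hc.tendsto.mono_left (nhdsWithin_le_nhds (s := Iio (qBar ν)))) ?_
    filter_upwards [self_mem_nhdsWithin, mem_nhdsWithin_of_mem_nhds (Ioi_mem_nhds hpos)] with q hq hq'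
    exact h.qBar_le_betaReal_of_lt (le_of_lt hq') hq

end Partition

/-! ## Logarithmic growth rates -/

lemma tendsto_const_div_log (C : ℝ) : Tendsto (fun x : ℝ => C / Real.log x) atTop (𝓝 0) :=
  Real.tendsto_log_atTop.const_div_atTop C

lemma eventually_log_div_log_lt {N : ℝ → ℕ} {C q r : ℝ} (hC : 0 < C) (hq : 0 ≤ q) (hqr : q < r)
    (h : ∀ᶠ x : ℝ in atTop, (N x : ℝ) ≤ C * x ^ q) :
    ∀ᶠ x : ℝ in atTop, Real.log (N x) / Real.log x < r := by
  have h1 := (tendsto_const_div_log (Real.log C)).eventually (gt_mem_nhds (sub_pos.2 hqr))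
  filter_upwards [h, h1, eventually_gt_atTop 1] with x hx hx1 hx2
  have hlx : 0 < Real.log x := Real.log_pos hx2
  rcases (N x).eq_zero_or_pos with h0 | h0
  · rw [h0]; simp; linarith
  · have hx0 : 0 < x := by linarith
    have hlog := Real.log_le_log (by exact_mod_cast h0) hx
    rw [Real.log_mul hC.ne' (Real.rpow_pos_of_pos hx0 q).ne', Real.log_rpow hx0] at hlog
    rw [div_lt_iff₀ hlx] at hx1 ⊢
    linarith

lemma eventually_lt_log_div_log {N : ℝ → ℕ} {c q r : ℝ} (hc : 0 < c) (hqr : r < q)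
    (h : ∀ᶠ x : ℝ in atTop, c * x ^ q ≤ (N x : ℝ)) :
    ∀ᶠ x : ℝ in atTop, r < Real.log (N x) / Real.log x := by
  have h1 := (tendsto_const_div_log (Real.log c)).eventually (lt_mem_nhds (sub_neg.2 hqr))
  filter_upwards [h, h1, eventually_gt_atTop 1] with x hx hx1 hx2
  have hlx : 0 < Real.log x := Real.log_pos hx2
  have hx0 : 0 < x := by linarith
  have hxq := Real.rpow_pos_of_pos hx0 q
  have hlog := Real.log_le_log (mul_pos hc hxq) hx
  rw [Real.log_mul hc.ne' hxq.ne', Real.log_rpow hx0] at hlog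
  rw [lt_div_iff₀ hlx] at hx1 ⊢
  linarith

section SpectralDimension

variable {ν : Measure ℝ} [IsFiniteMeasure ν]

/-! ## The upper bound for the spectral dimension -/

/-- For `q̄ < r < q` eventually `β_n(q) < r`, so the terms are dominated by the geometric sequence
`2^{n(r-q)}`. -/
lemma UnitSupported.summable_partitionSum (h : UnitSupported ν) {q : ℝ} (hq : qBar ν < q) :
    Summable fun n : ℕ => partitionSum ν n q * ((2 : ℝ) ^ n) ^ (-q) := by
  obtain ⟨r, hr1, hr2⟩ := exists_between hq
  have hq0 : 0 ≤ q := h.qBar_nonneg.trans hq.le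
  have hgeo : Summable fun n : ℕ => ((2 : ℝ) ^ (r - q)) ^ n :=
    summable_geometric_of_lt_one (by positivity)
      (Real.rpow_lt_one_of_one_lt_of_neg (by norm_num) (by linarith))
  refine hgeo.of_norm_bounded_eventually_nat ?_
  filter_upwards [h.eventually_betaN_lt hq0 ((h.betaReal_le_qBar hq).trans_lt hr1),
    eventually_ne_atTop 0] with n hn hn0
  have h2 : (1 : ℝ) ≤ 2 ^ n := one_le_pow₀ (by norm_num)
  have hpos := h.partitionSum_pos n q
  rw [Real.norm_of_nonneg (by positivity), h.partitionSum_eq_rpow hn0, ← Real.rpow_add (by positivity),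
    ← Real.rpow_natCast (2 ^ (r - q)) n, ← Real.rpow_mul (by norm_num), mul_comm (r - q),
    Real.rpow_mul (by norm_num), Real.rpow_natCast]
  exact Real.rpow_le_rpow_of_exponent_le h2 (by linarith)

/-- Markov's inequality: each heavy cell contributes at least `t^q` to the sum of `(ν(C)Λ(C))^q`
over all cells of all orders. -/
lemma UnitSupported.ncard_heavyCells_le (h : UnitSupported ν) {q : ℝ} (hq : qBar ν < q) {t : ℝ}
    (ht : 0 < t) : ((heavyCells ν t).ncard : ℝ) * t ^ q ≤
      ∑' n : ℕ, partitionSum ν n q * ((2 : ℝ) ^ n) ^ (-q) := by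
  classical
  have hq0 : 0 ≤ q := h.qBar_nonneg.trans hq.le
  obtain ⟨N, hN⟩ := exists_order_light (ν := ν) ht
  have hfin := heavyCells_finite (ν := ν) ht
  set R : Finset (ℕ × ℕ) :=
    (Finset.range N ×ˢ Finset.range (2 ^ N)).filter (fun p => p.2 ∈ cells ν p.1) with hR
  have hRmem : ∀ p : ℕ × ℕ, p ∈ R ↔ p.1 ∈ Finset.range N ∧ p.2 ∈ cells ν p.1 := by
    intro p
    simp only [hR, Finset.mem_filter, Finset.mem_product, Finset.mem_range]
    refine ⟨fun hp => ⟨hp.1.1, hp.2⟩, fun hp => ⟨⟨hp.1, ?_⟩, hp.2⟩⟩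
    exact (lt_of_mem_cells hp.2).trans_le (Nat.pow_le_pow_right (by norm_num) hp.1.le)
  have hsub : hfin.toFinset ⊆ R := by
    intro p hp
    obtain ⟨h1, h2⟩ := hfin.mem_toFinset.1 hp
    have hpN : p.1 < N := by
      by_contra hge
      exact absurd h2 (not_le.2 (hN _ (not_lt.1 hge) _))
    refine (hRmem p).2 ⟨Finset.mem_range.2 hpN, mem_cells.2 ⟨h1, ?_⟩⟩
    have h3 := ht.trans_le h2
    exact (div_pos_iff_of_pos_right (by positivity)).1 h3
  have hterm : ∀ n k, k ∈ cells ν n →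
      (mass ν n k / 2 ^ n) ^ q = mass ν n k ^ q * ((2 : ℝ) ^ n) ^ (-q) := by
    intro n k hk
    rw [Real.div_rpow (mass_pos hk).le (by positivity), Real.rpow_neg (by positivity),
      div_eq_mul_inv]
  calc ((heavyCells ν t).ncard : ℝ) * t ^ q = ∑ _p ∈ hfin.toFinset, t ^ q := by
        rw [Finset.sum_const, nsmul_eq_mul, Set.ncard_eq_toFinset_card _ hfin]
    _ ≤ ∑ p ∈ hfin.toFinset, (mass ν p.1 p.2 / 2 ^ p.1) ^ q :=
        Finset.sum_le_sum fun p hp =>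
          Real.rpow_le_rpow ht.le (hfin.mem_toFinset.1 hp).2 hq0
    _ ≤ ∑ p ∈ R, (mass ν p.1 p.2 / 2 ^ p.1) ^ q :=
        Finset.sum_le_sum_of_subset_of_nonneg hsub fun p _ _ => by positivity
    _ = ∑ n ∈ Finset.range N, ∑ k ∈ cells ν n, (mass ν n k / 2 ^ n) ^ q :=
        Finset.sum_finset_product' R (Finset.range N) (cells ν) hRmem
          (f := fun n k => (mass ν n k / 2 ^ n) ^ q)
    _ = ∑ n ∈ Finset.range N, partitionSum ν n q * ((2 : ℝ) ^ n) ^ (-q) := by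
        refine Finset.sum_congr rfl fun n _ => ?_
        rw [partitionSum, Finset.sum_mul]
        exact Finset.sum_congr rfl fun k hk => hterm n k hk
    _ ≤ _ := (h.summable_partitionSum hq).sum_le_tsum _ fun n _ => by
        have := h.partitionSum_pos n q
        positivity

lemma UnitSupported.eventually_eigenvalueCount_lt (h : UnitSupported ν) {r : ℝ}
    (hr : qBar ν < r) :
    ∀ᶠ x : ℝ in atTop, Real.log (eigenvalueCount ν x) / Real.log x < r := by
  obtain ⟨q, hq1, hq2⟩ := exists_between hr
  have hq0 : 0 ≤ q := h.qBar_nonneg.trans hq1.le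
  set S := ∑' n : ℕ, partitionSum ν n q * ((2 : ℝ) ^ n) ^ (-q) with hS
  have hS0 : 0 ≤ S := tsum_nonneg fun n => by
    have := h.partitionSum_pos n q
    positivity
  refine eventually_log_div_log_lt (C := (S + 1) * 2 ^ q) (by positivity) hq0 hq2 ?_
  filter_upwards [eventually_gt_atTop 0] with x hx
  -- The threshold must be strictly below `1/x`; the factor `2` only costs the constant `2^q`.
  have ht : 0 < (2 * x)⁻¹ := by positivity
  have h1 : (eigenvalueCount ν x : ℝ) ≤ (heavyCells ν (2 * x)⁻¹).ncard := by
    exact_mod_cast eigenvalueCount_le_ncard h.compl_eq_zero ht hx (by field_simp; norm_num)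
  have h2 := h.ncard_heavyCells_le hq1 ht
  rw [Real.inv_rpow (by positivity), ← div_eq_mul_inv, div_le_iff₀ (by positivity),
    Real.mul_rpow (by norm_num) hx.le] at h2
  calc (eigenvalueCount ν x : ℝ) ≤ S * (2 ^ q * x ^ q) := h1.trans h2
    _ ≤ (S + 1) * 2 ^ q * x ^ q := by
        rw [mul_assoc]
        gcongr
        linarith

/-! ## Many cells of typical mass -/

/-- If the lower and upper exponents agree at a point `q` of differentiability, then the partition
sum at `q` is dominated by the cells of mass about `2^{-na}`, with `-a` the slope at `q`. -/
lemma UnitSupported.exists_many_cells (h : UnitSupported ν) {q a : ℝ} (hq : 0 < q)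
    (hd : HasDerivAt (betaReal ν) (-a) q)
    (hlow : ∀ r < betaReal ν q, ∀ᶠ n in atTop, r < betaN ν n q) {δ : ℝ} (hδ : 0 < δ) :
    ∀ᶠ n in atTop, ∃ K ⊆ cells ν n, (∀ k ∈ K, ((2 : ℝ) ^ n) ^ (-(a + δ)) ≤ mass ν n k) ∧
      ((2 : ℝ) ^ n) ^ (betaReal ν q - δ + (a - δ) * q) / 2 ≤ K.card := by
  classical
  set b := betaReal ν q with hb
  have hlin := (hasDerivAt_iff_isLittleO.1 hd).def (show 0 < δ / 4 by linarith)
  obtain ⟨ρ, hρ, hball⟩ := Metric.eventually_nhds_iff.1 hlin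
  -- The bounds on `e` keep `q ± e` within the range of the linear approximation, keep `q - e`
  -- positive, and give `δ * e / 8 ≤ δ`.
  set e := min (min (ρ / 2) (q / 2)) 1 with he
  have he0 : 0 < e := lt_min (lt_min (by linarith) (by linarith)) one_pos
  have he1 : e ≤ 1 := min_le_right _ _
  have heq : e ≤ q / 2 := (min_le_left _ _).trans (min_le_right _ _)
  have heρ : e < ρ := lt_of_le_of_lt ((min_le_left _ _).trans (min_le_left _ _)) (by linarith)
  have hB1 : betaReal ν (q - e) ≤ b + a * e + δ / 4 * e := by
    have h1 := hball (y := q - e) (by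
      rw [Real.dist_eq, sub_sub_cancel_left, abs_neg, abs_of_pos he0]; exact heρ)
    rw [sub_sub_cancel_left, norm_neg, Real.norm_eq_abs, Real.norm_eq_abs, abs_of_pos he0,
      smul_eq_mul] at h1
    have h2 := (abs_le.1 h1).2
    linarith
  have hB2 : betaReal ν (q + e) ≤ b - a * e + δ / 4 * e := by
    have h1 := hball (y := q + e) (by
      rw [Real.dist_eq, add_sub_cancel_left, abs_of_pos he0]; exact heρ)
    rw [add_sub_cancel_left, Real.norm_eq_abs, Real.norm_eq_abs, abs_of_pos he0,
      smul_eq_mul] at h1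
    have h2 := (abs_le.1 h1).2
    linarith
  have hη : 0 < δ * e / 8 := by positivity
  have hlarge : ∀ᶠ n : ℕ in atTop, (4 : ℝ) ≤ ((2 : ℝ) ^ n) ^ (δ * e / 2) := by
    have : Tendsto (fun n : ℕ => ((2 : ℝ) ^ n) ^ (δ * e / 2)) atTop atTop :=
      (tendsto_rpow_atTop (by positivity)).comp
        (tendsto_pow_atTop_atTop_of_one_lt (by norm_num : (1 : ℝ) < 2))
    exact this.eventually_ge_atTop 4
  filter_upwards [hlow (b - δ * e / 8) (by linarith),
    h.eventually_betaN_lt (q := q - e) (by linarith)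
      (show betaReal ν (q - e) < b + a * e + δ / 4 * e + δ * e / 8 by linarith),
    h.eventually_betaN_lt (q := q + e) (by linarith)
      (show betaReal ν (q + e) < b - a * e + δ / 4 * e + δ * e / 8 by linarith),
    hlarge, eventually_ne_atTop 0] with n hn0 hn1 hn2 hn4 hn
  set X : ℝ := (2 : ℝ) ^ n with hX
  have hX0 : 0 < X := by positivity
  have hX1 : 1 ≤ X := one_le_pow₀ (by norm_num)
  set small := (cells ν n).filter (fun k => mass ν n k < X ^ (-(a + δ))) with hsmall
  set rest := (cells ν n).filter (fun k => ¬ mass ν n k < X ^ (-(a + δ))) with hrest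
  set big := rest.filter (fun k => X ^ (-(a - δ)) < mass ν n k) with hbig
  set mid := rest.filter (fun k => ¬ X ^ (-(a - δ)) < mass ν n k) with hmid
  have hrestc : rest ⊆ cells ν n := Finset.filter_subset _ _
  have hbigc : big ⊆ cells ν n := (Finset.filter_subset _ _).trans hrestc
  have hmidc : mid ⊆ cells ν n := (Finset.filter_subset _ _).trans hrestc
  have hsmallc : small ⊆ cells ν n := Finset.filter_subset _ _
  have hpart : ∀ {s : Finset ℕ} (p : ℝ), s ⊆ cells ν n →
      ∑ k ∈ s, mass ν n k ^ p ≤ partitionSum ν n p := fun p hs =>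
    Finset.sum_le_sum_of_subset_of_nonneg hs fun k hk _ => (Real.rpow_pos_of_pos (mass_pos hk) p).le
  -- Chernoff bound: shifting the exponent by `e` gains `δ * e` on too small masses, while the
  -- linear approximation and the limit lose `δ * e / 4 + δ * e / 8`. The same works for too large
  -- masses with `q + e`. As the whole sum is at least `X ^ (b - δ * e / 8)`, each of the two parts
  -- is at most a quarter of it once `X ^ (δ * e / 2) ≥ 4`.
  have hS1 : ∑ k ∈ small, mass ν n k ^ q ≤ X ^ (b - 5 * (δ * e) / 8) := by
    calc ∑ k ∈ small, mass ν n k ^ q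
        ≤ ∑ k ∈ small, X ^ (-(a + δ) * e) * mass ν n k ^ (q - e) := by
          refine Finset.sum_le_sum fun k hk => ?_
          have hm := mass_pos (hsmallc hk)
          have h1 : mass ν n k ^ e ≤ X ^ (-(a + δ) * e) := by
            rw [Real.rpow_mul hX0.le]
            exact Real.rpow_le_rpow hm.le (Finset.mem_filter.1 hk).2.le he0.le
          calc mass ν n k ^ q = mass ν n k ^ e * mass ν n k ^ (q - e) := by
                rw [← Real.rpow_add hm]; congr 1; ring
            _ ≤ _ := mul_le_mul_of_nonneg_right h1 (Real.rpow_pos_of_pos hm _).le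
      _ ≤ X ^ (-(a + δ) * e) * X ^ (b + a * e + δ / 4 * e + δ * e / 8) := by
          rw [← Finset.mul_sum]
          refine mul_le_mul_of_nonneg_left ((hpart _ hsmallc).trans ?_)
            (Real.rpow_pos_of_pos hX0 _).le
          rw [h.partitionSum_eq_rpow hn]
          exact Real.rpow_le_rpow_of_exponent_le hX1 hn1.le
      _ = X ^ (b - 5 * (δ * e) / 8) := by
          rw [← Real.rpow_add hX0]; congr 1; ring
  have hS2 : ∑ k ∈ big, mass ν n k ^ q ≤ X ^ (b - 5 * (δ * e) / 8) := by
    calc ∑ k ∈ big, mass ν n k ^ q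
        ≤ ∑ k ∈ big, X ^ ((a - δ) * e) * mass ν n k ^ (q + e) := by
          refine Finset.sum_le_sum fun k hk => ?_
          have hm := mass_pos (hbigc hk)
          have h1 : mass ν n k ^ (-e) ≤ X ^ ((a - δ) * e) := by
            rw [show (a - δ) * e = (-(a - δ)) * (-e) by ring, Real.rpow_mul hX0.le]
            exact Real.rpow_le_rpow_of_nonpos (Real.rpow_pos_of_pos hX0 _)
              (Finset.mem_filter.1 hk).2.le (by linarith)
          calc mass ν n k ^ q = mass ν n k ^ (-e) * mass ν n k ^ (q + e) := by
                rw [← Real.rpow_add hm]; congr 1; ring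
            _ ≤ _ := mul_le_mul_of_nonneg_right h1 (Real.rpow_pos_of_pos hm _).le
      _ ≤ X ^ ((a - δ) * e) * X ^ (b - a * e + δ / 4 * e + δ * e / 8) := by
          rw [← Finset.mul_sum]
          refine mul_le_mul_of_nonneg_left ((hpart _ hbigc).trans ?_)
            (Real.rpow_pos_of_pos hX0 _).le
          rw [h.partitionSum_eq_rpow hn]
          exact Real.rpow_le_rpow_of_exponent_le hX1 hn2.le
      _ = X ^ (b - 5 * (δ * e) / 8) := by
          rw [← Real.rpow_add hX0]; congr 1; ring
  have hZ : X ^ (b - δ * e / 8) ≤ partitionSum ν n q := by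
    rw [h.partitionSum_eq_rpow hn]
    exact Real.rpow_le_rpow_of_exponent_le hX1 hn0.le
  have hsplit : partitionSum ν n q = ∑ k ∈ small, mass ν n k ^ q +
      (∑ k ∈ big, mass ν n k ^ q + ∑ k ∈ mid, mass ν n k ^ q) := by
    rw [hbig, hmid, Finset.sum_filter_add_sum_filter_not, hsmall, hrest,
      Finset.sum_filter_add_sum_filter_not, partitionSum]
  have hcmp : 4 * X ^ (b - 5 * (δ * e) / 8) ≤ X ^ (b - δ * e / 8) := by
    calc 4 * X ^ (b - 5 * (δ * e) / 8) ≤ X ^ (δ * e / 2) * X ^ (b - 5 * (δ * e) / 8) := by gcongr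
      _ = X ^ (b - δ * e / 8) := by rw [← Real.rpow_add hX0]; congr 1; ring
  have hmidsum : X ^ (b - δ) / 2 ≤ ∑ k ∈ mid, mass ν n k ^ q := by
    have h1 : X ^ (b - δ) ≤ X ^ (b - δ * e / 8) :=
      Real.rpow_le_rpow_of_exponent_le hX1 (by nlinarith)
    linarith
  have hmidle : ∑ k ∈ mid, mass ν n k ^ q ≤ mid.card * X ^ (-(a - δ) * q) := by
    rw [← nsmul_eq_mul]
    refine Finset.sum_le_card_nsmul _ _ _ fun k hk => ?_
    rw [Real.rpow_mul hX0.le]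
    exact Real.rpow_le_rpow (mass_pos (hmidc hk)).le (not_lt.1 (Finset.mem_filter.1 hk).2) hq.le
  refine ⟨mid, hmidc, fun k hk => ?_, ?_⟩
  · exact not_lt.1 (Finset.mem_filter.1 (Finset.mem_filter.1 hk).1).2
  · have h1 := hmidsum.trans hmidle
    have h2 := mul_le_mul_of_nonneg_right h1 (Real.rpow_pos_of_pos hX0 ((a - δ) * q)).le
    have e1 : X ^ (b - δ) / 2 * X ^ ((a - δ) * q) = X ^ (b - δ + (a - δ) * q) / 2 := by
      rw [Real.rpow_add hX0]; ring
    have e2 : (mid.card : ℝ) * X ^ (-(a - δ) * q) * X ^ ((a - δ) * q) = mid.card := by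
      rw [mul_assoc, ← Real.rpow_add hX0]
      have : -(a - δ) * q + (a - δ) * q = 0 := by ring
      rw [this, Real.rpow_zero, mul_one]
    rwa [e1, e2] at h2

/-! ## The lower bound for the spectral dimension -/

/-- Up to small errors, `2^{n(β(q)+aq)}` cells of mass `2^{-na}` produce that many eigenvalues below
a multiple of `2^{n(1+a)}`. The ratio of the exponents is at least `q` because `β(q) ≥ q` and `a ≥
0`. -/
lemma UnitSupported.eventually_lt_eigenvalueCount (h : UnitSupported ν) {q a r : ℝ} (hq : 0 < q)
    (ha : 0 ≤ a) (hqb : q ≤ betaReal ν q) (hd : HasDerivAt (betaReal ν) (-a) q)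
    (hlow : ∀ r < betaReal ν q, ∀ᶠ n in atTop, r < betaN ν n q) (hr : r < q) :
    ∀ᶠ x : ℝ in atTop, r < Real.log (eigenvalueCount ν x) / Real.log x := by
  obtain ⟨s, hs1, hsq⟩ := exists_between (max_lt hr hq)
  have hrs : r < s := (le_max_left _ _).trans_lt hs1
  have hs0 : 0 < s := (le_max_right _ _).trans_lt hs1
  -- The gap `κ - s * b` is at least `(q - s)(1 + a) - δ(1 + q + s)`; this `δ` makes the loss at
  -- most half of `q - s`.
  set δ := (q - s) / (2 * (1 + 2 * q)) with hδ
  have hδ0 : 0 < δ := div_pos (by linarith) (by positivity)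
  have hδe : δ * (1 + 2 * q) = (q - s) / 2 := by rw [hδ]; field_simp
  set b := 1 + a + δ with hb
  have hb0 : 0 < b := by positivity
  set κ := betaReal ν q - δ + (a - δ) * q with hκ
  have hκs : s * b ≤ κ := by
    have h1 : 0 ≤ (q - s) * a := mul_nonneg (by linarith) ha
    have h2 : δ * s ≤ δ * q := by gcongr
    rw [hκ, hb]
    nlinarith
  have hκ0 : 0 < κ := (mul_pos hs0 hb0).trans_le hκs
  -- The number `8` absorbs the boundary cells: `X^κ / 2 ≤ 3 * card K' + 2` then yields `X^κ / 12 ≤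
  -- card K'`.
  have hlarge : ∀ᶠ n : ℕ in atTop, (8 : ℝ) ≤ ((2 : ℝ) ^ n) ^ κ := by
    have : Tendsto (fun n : ℕ => ((2 : ℝ) ^ n) ^ κ) atTop atTop :=
      (tendsto_rpow_atTop hκ0).comp
        (tendsto_pow_atTop_atTop_of_one_lt (by norm_num : (1 : ℝ) < 2))
    exact this.eventually_ge_atTop 8
  have hl2 : 0 < Real.log 2 := Real.log_pos (by norm_num)
  -- `y` solves `3 * 2 ^ (b * y) = x`. With `n = ⌊y⌋`, the factor `3` leaves room for the strict
  -- inequality with `2 * 2 ^ n`, and rounding costs at most `2 ^ b`.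
  set y : ℝ → ℝ := fun x => Real.log (x / 3) / (b * Real.log 2) with hy
  have hyt : Tendsto y atTop atTop :=
    (Real.tendsto_log_atTop.comp (tendsto_id.atTop_div_const (by norm_num))).atTop_div_const
      (by positivity)
  have hnt : Tendsto (fun x => ⌊y x⌋₊) atTop atTop := tendsto_nat_floor_atTop.comp hyt
  refine eventually_lt_log_div_log (c := ((3 * 2 ^ b) ^ s)⁻¹ / 12) (by positivity) hrs ?_
  filter_upwards [hnt.eventually (h.exists_many_cells hq hd hlow hδ0), hnt.eventually hlarge,
    hyt.eventually_ge_atTop 0, eventually_gt_atTop 0] with x hx1 hx2 hx3 hx4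
  obtain ⟨K, hKc, hKm, hKcard⟩ := hx1
  set n := ⌊y x⌋₊ with hn
  set X : ℝ := (2 : ℝ) ^ n with hX
  have hX0 : 0 < X := by positivity
  have hx3' : 0 < x / 3 := by positivity
  have hXlog : ∀ c : ℝ, X ^ c = Real.exp (n * (c * Real.log 2)) := by
    intro c
    rw [Real.rpow_def_of_pos hX0, hX, Real.log_pow]; congr 1; ring
  have hlo : X ^ b ≤ x / 3 := by
    have h1 : (n : ℝ) ≤ y x := Nat.floor_le hx3
    rw [hy, le_div_iff₀ (by positivity)] at h1
    rw [hXlog, ← Real.le_log_iff_exp_le hx3']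
    exact h1
  have hhi : x / 3 ≤ X ^ b * 2 ^ b := by
    have h1 : y x < n + 1 := Nat.lt_floor_add_one _
    rw [hy, div_lt_iff₀ (by positivity)] at h1
    rw [hXlog, Real.rpow_def_of_pos (by norm_num : (0 : ℝ) < 2), ← Real.exp_add,
      ← Real.log_le_iff_le_exp hx3']
    nlinarith
  obtain ⟨K', hK'K, hsep, hcard⟩ := exists_separatedCells fun k hk => lt_of_mem_cells (hKc hk)
  have hcount := card_le_eigenvalueCount h.compl_eq_zero hsep (m := X ^ (-(a + δ))) (x := x)
    (fun k hk => hKm k (hK'K hk)) hx4 (by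
      have h1 : X ^ (-(a + δ)) * X ^ b = X := by
        rw [← Real.rpow_add hX0, hb]
        have : -(a + δ) + (1 + a + δ) = 1 := by ring
        rw [this, Real.rpow_one]
      have h2 : X ^ (-(a + δ)) * (3 * X ^ b) ≤ X ^ (-(a + δ)) * x := by
        gcongr; linarith
      have h3 : X ^ (-(a + δ)) * (3 * X ^ b) = 3 * X := by
        rw [mul_left_comm, h1]
      change 2 * X < _
      linarith)
  have h1 : (K.card : ℝ) ≤ 3 * K'.card + 2 := by exact_mod_cast hcard
  have h2 : (K'.card : ℝ) ≤ eigenvalueCount ν x := by exact_mod_cast hcount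
  have h3 : X ^ κ / 12 ≤ eigenvalueCount ν x := by linarith
  refine le_trans ?_ h3
  have h4 : x ^ s ≤ (3 * 2 ^ b) ^ s * X ^ κ := by
    have h5 : x ≤ 3 * 2 ^ b * X ^ b := by linarith
    calc x ^ s ≤ (3 * 2 ^ b * X ^ b) ^ s := Real.rpow_le_rpow hx4.le h5 hs0.le
      _ = (3 * 2 ^ b) ^ s * X ^ (b * s) := by
          rw [Real.mul_rpow (by positivity) (by positivity), ← Real.rpow_mul hX0.le]
      _ ≤ (3 * 2 ^ b) ^ s * X ^ κ := by
          gcongr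
          · exact one_le_pow₀ (by norm_num)
          · linarith
  have h6 : 0 < ((3 : ℝ) * 2 ^ b) ^ s := by positivity
  calc ((3 * 2 ^ b) ^ s)⁻¹ / 12 * x ^ s
      ≤ ((3 * 2 ^ b) ^ s)⁻¹ / 12 * ((3 * 2 ^ b) ^ s * X ^ κ) := by gcongr
    _ = X ^ κ / 12 := by field_simp

/-! ### Differentiability of the spectrum and identification of the spectral dimension -/

lemma UnitSupported.deriv_betaReal_nonpos (h : UnitSupported ν) {q : ℝ} (hq : 0 < q) :
    deriv (betaReal ν) q ≤ 0 := by
  by_cases hd : DifferentiableAt ℝ (betaReal ν) q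
  · have h1 := hd.hasDerivAt.tendsto_slope.mono_left
      (nhdsWithin_mono q (show Ioi q ⊆ {q}ᶜ from fun y hy => ne_of_gt hy))
    refine le_of_tendsto h1 ?_
    filter_upwards [self_mem_nhdsWithin] with y hy
    have hy' : q < y := hy
    rw [slope_def_field]
    exact div_nonpos_of_nonpos_of_nonneg
      (sub_nonpos.2 (h.antitoneOn_betaReal hq.le (hq.trans hy').le hy'.le)) (by linarith)
  · rw [deriv_zero_of_not_differentiableAt hd]

/-- A monotone function is differentiable almost everywhere, and the interval has positive length.
-/
lemma UnitSupported.exists_differentiableAt (h : UnitSupported ν) {u v : ℝ} (hu : 0 ≤ u)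
    (huv : u < v) : ∃ q ∈ Ioo u v, DifferentiableAt ℝ (betaReal ν) q := by
  have hmono : MonotoneOn (fun q => -betaReal ν q) (Ioo u v) := fun x hx y hy hxy =>
    neg_le_neg (h.antitoneOn_betaReal (hu.trans hx.1.le) (hu.trans hy.1.le) hxy)
  by_contra! hno
  have hnull : volume (Ioo u v) = 0 := by
    refine measure_mono_null (fun q hq => ?_)
      (ae_iff.1 (hmono.ae_differentiableWithinAt_of_mem))
    intro hcon
    have h1 := (hcon hq).differentiableAt (Ioo_mem_nhds hq.1 hq.2)
    exact hno q hq (by simpa using h1.neg)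
  rw [Real.volume_Ioo, ENNReal.ofReal_eq_zero] at hnull
  linarith

/-- For an `L^q`-regular measure the spectral dimension is `q̄`. -/
theorem UnitSupported.hasSpectralDim_qBar (h : UnitSupported ν) (hreg : IsLqRegular ν) :
    HasSpectralDim ν (qBar ν) := by
  refine tendsto_order.2 ⟨fun r hr => ?_, fun r hr => h.eventually_eigenvalueCount_lt hr⟩
  rcases h.qBar_nonneg.eq_or_lt with h0 | hpos
  -- For `q̄ = 0` the lower bound is free: the logarithm of a natural number is nonnegative, also
  -- for a zero count since `Real.log 0 = 0`.
  · filter_upwards [eventually_gt_atTop 1] with x hx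
    exact (hr.trans_eq h0.symm).trans_le
      (div_nonneg (Real.log_natCast_nonneg _) (Real.log_pos hx).le)
  · have main : ∀ q, r < q → 0 < q → q ≤ betaReal ν q → beta ν q = betaLower ν q →
        DifferentiableAt ℝ (betaReal ν) q →
        ∀ᶠ x : ℝ in atTop, r < Real.log (eigenvalueCount ν x) / Real.log x := by
      intro q hrq hq hqb heq hd
      refine h.eventually_lt_eigenvalueCount (a := -deriv (betaReal ν) q) hq
        (neg_nonneg.2 (h.deriv_betaReal_nonpos hq)) hqb (by rw [neg_neg]; exact hd.hasDerivAt)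
        (fun r hr => h.eventually_lt_betaN hq.le heq hr) hrq
    rcases hreg with ⟨ε, hε, hreg⟩ | ⟨heq, hdiff⟩
    · obtain ⟨q, hq, hd⟩ := h.exists_differentiableAt
        (u := max (max r (qBar ν - ε)) 0) (le_max_right _ _)
        (max_lt (max_lt hr (by linarith)) hpos)
      have hq1 : max r (qBar ν - ε) < q := (le_max_left _ _).trans_lt hq.1
      have hq0 : 0 < q := (le_max_right _ _).trans_lt hq.1
      exact main q ((le_max_left _ _).trans_lt hq1) hq0
        (hq.2.le.trans (h.qBar_le_betaReal_of_lt hq0.le hq.2))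
        (hreg q ⟨(le_max_right _ _).trans_lt hq1, hq.2⟩) hd
    · exact main _ hr hpos (h.betaReal_qBar hpos).ge heq hdiff.2

end SpectralDimension

/-! ## Hausdorff and Minkowski dimensions -/

/-- A set with efficient covers at arbitrarily small scales has small Hausdorff dimension. -/
lemma dimH_le_of_covers {A : Set ℝ} {d : ℝ≥0} {M : ℝ}
    (hcov : ∀ ρ > 0, ∃ r : ℝ, 0 < r ∧ r ≤ ρ ∧ ∃ C : Finset ℝ,
      A ⊆ (⋃ c ∈ C, Metric.closedBall c r) ∧ (C.card : ℝ) * r ^ (d : ℝ) ≤ M) :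
    dimH A ≤ d := by
  have hpos : ∀ n : ℕ, (0 : ℝ) < 1 / (n + 1) := fun n => by positivity
  choose r hr0 hrle C hC hM using fun n : ℕ => hcov _ (hpos n)
  have hdiam : ∀ n (i : C n), Metric.ediam (Metric.closedBall (i : ℝ) (r n)) =
      ENNReal.ofReal (2 * r n) := fun n i => by
    rw [Real.closedBall_eq_Icc, Real.ediam_Icc]; congr 1; ring
  have hlim : Tendsto (fun n => ENNReal.ofReal (2 * r n)) atTop (𝓝 0) := by
    have h1 : Tendsto (fun n : ℕ => (2 : ℝ) * (1 / (n + 1))) atTop (𝓝 0) := by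
      simpa using tendsto_one_div_add_atTop_nhds_zero_nat.const_mul (2 : ℝ)
    have h2 : Tendsto (fun n => 2 * r n) atTop (𝓝 0) :=
      squeeze_zero (fun n => by linarith [hr0 n]) (fun n => by linarith [hrle n]) h1
    simpa using ENNReal.tendsto_ofReal h2
  have hsum : ∀ n, ∑ i : C n, Metric.ediam (Metric.closedBall (i : ℝ) (r n)) ^ (d : ℝ) ≤
      ENNReal.ofReal (2 ^ (d : ℝ) * M) := by
    intro n
    simp_rw [hdiam]
    rw [Finset.sum_const, Finset.card_univ, Fintype.card_coe, nsmul_eq_mul,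
      ENNReal.ofReal_rpow_of_nonneg (by linarith [hr0 n]) d.coe_nonneg, ← ENNReal.ofReal_natCast,
      ← ENNReal.ofReal_mul (by positivity)]
    apply ENNReal.ofReal_le_ofReal
    rw [Real.mul_rpow (by norm_num) (hr0 n).le]
    calc ((C n).card : ℝ) * (2 ^ (d : ℝ) * r n ^ (d : ℝ))
        = 2 ^ (d : ℝ) * ((C n).card * r n ^ (d : ℝ)) := by ring
      _ ≤ 2 ^ (d : ℝ) * M := by gcongr; exact hM n
  refine dimH_le_of_hausdorffMeasure_ne_top (ne_top_of_le_ne_top ENNReal.ofReal_ne_top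
    ((Measure.hausdorffMeasure_le_liminf_sum (d : ℝ) A (l := atTop) _ hlim
      (fun n (i : C n) => Metric.closedBall (i : ℝ) (r n))
      (Eventually.of_forall fun n i => (hdiam n i).le)
      (Eventually.of_forall fun n => (hC n).trans ?_)).trans
      (liminf_le_of_frequently_le (Frequently.of_forall hsum))))
  intro x hx
  simp only [mem_iUnion] at hx ⊢
  obtain ⟨c, hc, hxc⟩ := hx
  exact ⟨⟨c, hc⟩, hxc⟩

/-- For `d` slightly above the box dimension, the covering number at every small scale `ε` is at
most `ε^{-d}`, which bounds the `d`-dimensional Hausdorff measure. -/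
lemma dimH_le_upperMinkowskiDim (A : Set ℝ) : dimH A ≤ upperMinkowskiDim A := by
  refine ENNReal.le_of_forall_pos_le_add fun η hη hfin => ?_
  obtain ⟨b, hb⟩ : ∃ b : ℝ≥0, upperMinkowskiDim A = b := ⟨_, (ENNReal.coe_toNNReal hfin.ne).symm⟩
  set d : ℝ≥0 := b + η with hd
  rw [hb, ← ENNReal.coe_add]
  have hlt : limsup (fun ε : ℝ≥0 => ENNReal.log ((Metric.externalCoveringNumber ε A : ℕ∞) : ℝ≥0∞) /
      ((-Real.log (ε : ℝ) : ℝ) : EReal)) (𝓝[>] 0) < ((d : ℝ) : EReal) := by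
    -- `toENNReal` truncates at `0`, so the upper limit is at most the dimension even when negative,
    -- as for the empty set.
    refine lt_of_le_of_lt ((le_max_right 0 _).trans_eq EReal.coe_toENNReal_eq_max.symm) ?_
    change ((upperMinkowskiDim A : ℝ≥0∞) : EReal) < _
    rw [hb]
    have : (b : ℝ) < d := by rw [hd]; push_cast; linarith [show (0 : ℝ) < η from hη]
    exact EReal.coe_lt_coe_iff.2 this
  have hev := eventually_lt_of_limsup_lt hlt
  refine dimH_le_of_covers (M := 1) fun ρ hρ => ?_
  have hsmall : ∀ᶠ ε : ℝ≥0 in 𝓝[>] 0, (ε : ℝ) < min ρ 1 := by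
    have h1 : (0 : ℝ) < min ρ 1 := lt_min hρ one_pos
    exact mem_nhdsWithin_of_mem_nhds ((NNReal.continuous_coe.tendsto 0).eventually
      (gt_mem_nhds (by simpa using h1)))
  obtain ⟨ε, ⟨h1, h2⟩, h3⟩ := ((hev.and hsmall).and self_mem_nhdsWithin).exists
  have hε0 : (0 : ℝ) < ε := h3
  have hε1 : (ε : ℝ) < 1 := h2.trans_le (min_le_right _ _)
  have hlog : 0 < -Real.log ε := neg_pos.2 (Real.log_neg hε0 hε1)
  rw [EReal.div_lt_iff (by exact_mod_cast hlog) (EReal.coe_ne_top _), ← EReal.coe_mul] at h1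
  have hne : Metric.externalCoveringNumber ε A ≠ ⊤ := by
    intro htop
    rw [htop] at h1
    simp at h1
  obtain ⟨C, hC, hCcard⟩ : ∃ C : Set ℝ, Metric.IsCover ε A C ∧
      C.encard = Metric.externalCoveringNumber ε A := by
    have : Nonempty {C : Set ℝ // Metric.IsCover ε A C} := ⟨A, by simp⟩
    obtain ⟨C, hC⟩ := ENat.exists_eq_iInf
      (fun C : {C : Set ℝ // Metric.IsCover ε A C} => (C : Set ℝ).encard)
    refine ⟨C, C.2, hC.trans ?_⟩
    rw [Metric.externalCoveringNumber, iInf_subtype]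
  have hCfin : C.Finite := by
    rw [← Set.encard_ne_top_iff, hCcard]; exact hne
  refine ⟨ε, hε0, h2.le.trans (min_le_left _ _), hCfin.toFinset, ?_, ?_⟩
  · have := Metric.isCover_iff_subset_iUnion_closedBall.1 hC
    simpa using this
  · rcases Nat.eq_zero_or_pos hCfin.toFinset.card with h0 | h0
    · rw [h0]; simp
    · rw [← hCcard, hCfin.encard_eq_coe_toFinset_card] at h1
      have hc0 : (0 : ℝ) < hCfin.toFinset.card := by exact_mod_cast h0
      have h4 : ENNReal.log (((hCfin.toFinset.card : ℕ∞) : ℝ≥0∞)) =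
          ((Real.log hCfin.toFinset.card : ℝ) : EReal) := by
        rw [← ENNReal.log_ofReal_of_pos hc0]; simp
      rw [h4, EReal.coe_lt_coe_iff] at h1
      have h5 : Real.log ((hCfin.toFinset.card : ℝ) * (ε : ℝ) ^ (d : ℝ)) ≤ 0 := by
        rw [Real.log_mul hc0.ne' (by positivity), Real.log_rpow hε0]
        linarith
      exact (Real.log_nonpos_iff (by positivity)).1 h5

/-- Countable stability of `dimH` reduces this to comparing Hausdorff and box dimension on each
piece of a cover. -/
lemma measureHausdorffDim_le_measurePackingDim (ν : Measure ℝ) :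
    measureHausdorffDim ν ≤ measurePackingDim ν := by
  refine iInf_mono fun A => iInf_mono fun _ => iInf_mono fun _ => ?_
  refine le_iInf fun F => le_iInf fun hF => ?_
  calc dimH A ≤ dimH (⋃ i, F i) := dimH_mono hF
    _ = ⨆ i, dimH (F i) := dimH_iUnion F
    _ ≤ _ := iSup_mono fun i => dimH_le_upperMinkowskiDim _

lemma measurePackingDim_le_measureMinkowskiDim (ν : Measure ℝ) :
    measurePackingDim ν ≤ measureMinkowskiDim ν := by
  refine (iInf_le _ ν.support).trans ((iInf_le _ Measure.isClosed_support.measurableSet).trans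
    ((iInf_le _ Measure.measure_compl_support).trans ?_))
  exact (iInf_le _ fun _ => ν.support).trans
    ((iInf_le _ (subset_iUnion (fun _ : ℕ => ν.support) 0)).trans (iSup_le fun _ => le_rfl))

lemma measureLowerHausdorffDim_le_measureHausdorffDim {ν : Measure ℝ} (hν : ν ≠ 0) :
    measureLowerHausdorffDim ν ≤ measureHausdorffDim ν := by
  refine le_iInf fun A => le_iInf fun hA => le_iInf fun hA0 => ?_
  refine (iInf_le _ A).trans ((iInf_le _ hA).trans (iInf_le _ ?_))
  rw [pos_iff_ne_zero]
  intro h0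
  apply hν
  rw [← Measure.measure_univ_eq_zero, ← Set.union_compl_self A]
  exact measure_union_null h0 hA0

/-! ## The Minkowski dimension of the support -/

section Minkowski

variable {ν : Measure ℝ}

/-- Each charged cell meets the support, so some centre `c` lies within `2⁻ⁿ` of a point in it. Its
position is in `[2ⁿc - 2, 2ⁿc + 1)`, so one centre serves at most three cells; `(card + 2) / 3` is
the rounded-up quotient. -/
lemma card_cells_le_of_isCover {n : ℕ} {ε : ℝ≥0} (hε : (ε : ℝ) = 1 / 2 ^ n) {C : Set ℝ}
    (hC : Metric.IsCover ε ν.support C) : (((cells ν n).card + 2) / 3 : ℕ) ≤ C.encard := by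
  classical
  have hex : ∀ k : ℕ, k ∈ cells ν n → ∃ c ∈ C, |2 ^ n * c - k| ≤ 2 ∧ (k : ℝ) < 2 ^ n * c + 1 := by
    intro k hk
    have hpos : 0 < ν (dyadic n k) := (Finset.mem_filter.1 hk).2
    obtain ⟨x, hx, hxs⟩ := Measure.nonempty_inter_support_of_pos hpos
    obtain ⟨c, hc, hxc⟩ := mem_iUnion₂.1 (Metric.isCover_iff_subset_iUnion_closedBall.1 hC hxs)
    rw [Metric.mem_closedBall, Real.dist_eq, hε, le_div_iff₀ (by positivity)] at hxc
    have h1 : |2 ^ n * x - 2 ^ n * c| ≤ 1 := by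
      rw [← mul_sub, abs_mul, abs_of_pos (by positivity : (0 : ℝ) < 2 ^ n), mul_comm]
      exact hxc
    obtain ⟨h2, h3⟩ := mem_dyadic_iff.1 hx
    obtain ⟨h4, h5⟩ := abs_le.1 h1
    exact ⟨c, hc, abs_le.2 ⟨by linarith, by linarith⟩, by linarith⟩
  choose! f hfC hf1 hf2 using hex
  have hfib : ∀ b ∈ (cells ν n).image f, ((cells ν n).filter (fun a => f a = b)).card ≤ 3 := by
    intro b hb
    set F := (cells ν n).filter (fun a => f a = b) with hF
    obtain ⟨a, ha, hab⟩ := Finset.mem_image.1 hb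
    have hne : F.Nonempty := ⟨a, Finset.mem_filter.2 ⟨ha, hab⟩⟩
    have hmin := Finset.min'_mem F hne
    set m := F.min' hne with hm
    have hsub : F ⊆ Finset.Icc m (m + 2) := by
      intro k hk
      refine Finset.mem_Icc.2 ⟨Finset.min'_le F k hk, ?_⟩
      obtain ⟨hkc, hkb⟩ := Finset.mem_filter.1 hk
      obtain ⟨hmc, hmb⟩ := Finset.mem_filter.1 hmin
      have h1 := hf2 k hkc
      have h2 := (abs_le.1 (hf1 m hmc)).2
      rw [hkb] at h1
      rw [hmb] at h2
      have h3 : (k : ℝ) < m + 3 := by linarith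
      have h4 : k < m + 3 := by exact_mod_cast h3
      omega
    calc F.card ≤ (Finset.Icc m (m + 2)).card := Finset.card_le_card hsub
      _ = 3 := by rw [Nat.card_Icc]; omega
  have hcard := Finset.card_le_mul_card_image _ _ hfib
  have himg : (((cells ν n).image f : Finset ℝ) : Set ℝ) ⊆ C := by
    intro y hy
    obtain ⟨k, hk, rfl⟩ := Finset.mem_image.1 (Finset.mem_coe.1 hy)
    exact hfC k hk
  have h1 := Set.encard_le_encard himg
  rw [Set.encard_coe_eq_coe_finsetCard] at h1
  refine le_trans ?_ h1
  have : ((cells ν n).card + 2) / 3 ≤ ((cells ν n).image f).card := by omega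
  exact_mod_cast this

lemma le_externalCoveringNumber {n : ℕ} {ε : ℝ≥0} (hε : (ε : ℝ) = 1 / 2 ^ n) :
    (((cells ν n).card + 2) / 3 : ℕ) ≤ Metric.externalCoveringNumber ε ν.support :=
  le_iInf₂ fun _ hC => card_cells_le_of_isCover hε hC

variable [IsFiniteMeasure ν]

/-- The right endpoint of a dyadic interval. -/
def rightEndpoint (n k : ℕ) : ℝ := ((k : ℝ) + 1) / 2 ^ n

lemma Icc_subset_closedBall_rightEndpoint (n k : ℕ) :
    Icc ((k : ℝ) / 2 ^ n) (((k : ℝ) + 1) / 2 ^ n) ⊆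
      Metric.closedBall (rightEndpoint n k) (1 / 2 ^ n) := by
  have h2 : (0 : ℝ) < 1 / 2 ^ n := by positivity
  rw [Real.closedBall_eq_Icc, rightEndpoint]
  refine Icc_subset_Icc (le_of_eq (by ring)) (by linarith)

lemma dyadic_subset_closedBall (n k : ℕ) :
    dyadic n k ⊆ Metric.closedBall (rightEndpoint n k) (1 / 2 ^ n) :=
  Ioc_subset_Icc_self.trans (Icc_subset_closedBall_rightEndpoint n k)

/-- The support lies in every closed set of full measure. Closed cells are needed because it may
contain left endpoints. -/
lemma UnitSupported.support_subset_biUnion (h : UnitSupported ν) (n : ℕ) :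
    ν.support ⊆ ⋃ k ∈ cells ν n, Icc ((k : ℝ) / 2 ^ n) (((k : ℝ) + 1) / 2 ^ n) := by
  refine Measure.support_subset_of_isClosed
    ((cells ν n).finite_toSet.isClosed_biUnion fun k _ => isClosed_Icc) ?_
  have hnull : ∀ᵐ x ∂ν, ∀ k ∈ Finset.range (2 ^ n) \ cells ν n, x ∉ dyadic n k := by
    rw [Finset.eventually_all]
    intro k hk
    rw [Finset.mem_sdiff, Finset.mem_range] at hk
    have h0 : ν (dyadic n k) = 0 := by
      by_contra hne
      exact hk.2 (mem_cells.2 ⟨hk.1, ENNReal.toReal_pos hne (measure_ne_top _ _)⟩)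
    exact measure_eq_zero_iff_ae_notMem.1 h0
  filter_upwards [h.ae_mem, hnull] with x hx hx'
  obtain ⟨k, hk, hxk⟩ := exists_mem_dyadic n hx
  simp only [mem_iUnion]
  refine ⟨k, ?_, Ioc_subset_Icc_self hxk⟩
  by_contra hkc
  exact hx' k (Finset.mem_sdiff.2 ⟨Finset.mem_range.2 hk, hkc⟩) hxk

lemma UnitSupported.externalCoveringNumber_le (h : UnitSupported ν) {n : ℕ} {ε : ℝ≥0}
    (hε : 1 / 2 ^ n ≤ (ε : ℝ)) :
    Metric.externalCoveringNumber ε ν.support ≤ (cells ν n).card := by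
  classical
  have hcov : Metric.IsCover ε ν.support
      (((cells ν n).image (rightEndpoint n) : Finset ℝ) : Set ℝ) := by
    rw [Metric.isCover_iff_subset_iUnion_closedBall]
    intro x hx
    obtain ⟨k, hk, hxk⟩ := mem_iUnion₂.1 (h.support_subset_biUnion n hx)
    refine mem_iUnion₂.2 ⟨rightEndpoint n k, Finset.mem_coe.2 (Finset.mem_image_of_mem _ hk), ?_⟩
    exact Metric.closedBall_subset_closedBall hε (Icc_subset_closedBall_rightEndpoint n k hxk)
  refine hcov.externalCoveringNumber_le_encard.trans ?_
  rw [Set.encard_coe_eq_coe_finsetCard]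
  exact_mod_cast Finset.card_image_le

/-- The ratio in the definition of the upper Minkowski dimension is a real number. -/
lemma UnitSupported.exists_coveringNumber_eq (h : UnitSupported ν) {ε : ℝ≥0} (hε : 0 < ε) :
    ∃ m : ℕ, 0 < m ∧ Metric.externalCoveringNumber ε ν.support = m ∧
      ENNReal.log ((Metric.externalCoveringNumber ε ν.support : ℕ∞) : ℝ≥0∞) /
        ((-Real.log (ε : ℝ) : ℝ) : EReal) = ((Real.log m / -Real.log ε : ℝ) : EReal) := by
  obtain ⟨n, hn⟩ := exists_pow_lt_of_lt_one (show (0 : ℝ) < ε from hε)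
    (show (1 / 2 : ℝ) < 1 by norm_num)
  have hle := h.externalCoveringNumber_le (n := n) (ε := ε) (by
    rw [one_div_pow] at hn; exact hn.le)
  obtain ⟨m, hm⟩ := ENat.ne_top_iff_exists.1 (ne_top_of_le_ne_top (ENat.natCast_ne_top _) hle)
  have hm0 : 0 < m := by
    have h1 : 0 < Metric.externalCoveringNumber ε ν.support :=
      Metric.externalCoveringNumber_pos_iff.2 (Measure.nonempty_support h.ne_zero)
    rw [← hm] at h1
    exact_mod_cast h1
  refine ⟨m, hm0, hm.symm, ?_⟩
  rw [← hm, EReal.coe_div]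
  congr 1
  rw [← ENNReal.log_ofReal_of_pos (by exact_mod_cast hm0)]
  simp

/-- Covering numbers at scale `2⁻ⁿ` and the number of charged cells agree up to a factor `3`. For
the upper bound a general `ε` is rounded to a dyadic scale, at a bounded logarithmic cost; for the
lower bound dyadic scales suffice. -/
lemma UnitSupported.measureMinkowskiDim_eq (h : UnitSupported ν) :
    measureMinkowskiDim ν = ENNReal.ofReal (deltaStar ν) := by
  have hl2 : 0 < Real.log 2 := Real.log_pos (by norm_num)
  have hδ : deltaStar ν = betaReal ν 0 := rfl
  have hδ0 : 0 ≤ deltaStar ν := h.betaReal_nonneg ⟨le_rfl, zero_le_one⟩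
  unfold measureMinkowskiDim upperMinkowskiDim
  rw [← EReal.real_coe_toENNReal]
  congr 1
  apply le_antisymm
  · refine EReal.le_of_forall_lt_iff_le.1 fun r hr => ?_
    have hr' : deltaStar ν < r := EReal.coe_lt_coe_iff.1 hr
    obtain ⟨s, hs1, hs2⟩ := exists_between hr'
    have hs0 : 0 ≤ s := hδ0.trans hs1.le
    refine limsup_le_of_le (by isBoundedDefault) ?_
    have hN : Tendsto (fun ε : ℝ≥0 => -Real.log (ε : ℝ)) (𝓝[>] 0) atTop := by
      have h1 : Tendsto (fun ε : ℝ≥0 => (ε : ℝ)) (𝓝[>] 0) (𝓝[>] 0) := by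
        refine tendsto_nhdsWithin_iff.2 ⟨?_, ?_⟩
        · exact (NNReal.continuous_coe.tendsto 0).mono_left nhdsWithin_le_nhds
        · filter_upwards [self_mem_nhdsWithin] with ε hε
          exact NNReal.coe_pos.2 hε
      exact tendsto_neg_atBot_atTop.comp (Real.tendsto_log_nhdsGT_zero.comp h1)
    have hceil : Tendsto (fun ε : ℝ≥0 => ⌈-Real.log (ε : ℝ) / Real.log 2⌉₊) (𝓝[>] 0) atTop :=
      tendsto_nat_ceil_atTop.comp (hN.atTop_div_const hl2)
    filter_upwards [hceil.eventually (h.eventually_betaN_lt le_rfl (hδ ▸ hs1)),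
      hceil.eventually (eventually_ne_atTop 0), self_mem_nhdsWithin,
      hN.eventually_ge_atTop (s * Real.log 2 / (r - s)), hN.eventually_gt_atTop 0]
      with ε h1 h2 h3 h4 h5
    set n := ⌈-Real.log (ε : ℝ) / Real.log 2⌉₊ with hn
    have hε0 : (0 : ℝ) < ε := NNReal.coe_pos.2 h3
    have hn1 : -Real.log (ε : ℝ) ≤ n * Real.log 2 := by
      rw [← div_le_iff₀ hl2]; exact Nat.le_ceil _
    have hn2 : n * Real.log 2 ≤ -Real.log (ε : ℝ) + Real.log 2 := by
      have := Nat.ceil_lt_add_one (a := -Real.log (ε : ℝ) / Real.log 2) (by positivity)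
      rw [← hn, ← sub_lt_iff_lt_add, lt_div_iff₀ hl2] at this
      linarith
    have hscale : 1 / 2 ^ n ≤ (ε : ℝ) := by
      rw [← Real.log_le_log_iff (by positivity) hε0, Real.log_div one_ne_zero (by positivity),
        Real.log_one, Real.log_pow]
      linarith
    obtain ⟨m, hm0, hm, hratio⟩ := h.exists_coveringNumber_eq (ε := ε) h3
    rw [hratio, EReal.coe_le_coe_iff, div_le_iff₀ h5]
    have hcard := h.externalCoveringNumber_le hscale
    rw [hm] at hcard
    have hcard' : (m : ℝ) ≤ (cells ν n).card := by exact_mod_cast hcard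
    have hlog : Real.log m ≤ Real.log (cells ν n).card :=
      Real.log_le_log (by exact_mod_cast hm0) hcard'
    rw [betaN_eq, partitionSum_zero, div_lt_iff₀ (log_two_pow_pos h2), Real.log_pow] at h1
    rw [div_le_iff₀ (by linarith)] at h4
    have h6 : s * (n * Real.log 2) ≤ s * (-Real.log (ε : ℝ) + Real.log 2) := by gcongr
    linarith
  · refine EReal.ge_of_forall_gt_iff_ge.1 fun r hr => ?_
    have hr' : r < deltaStar ν := EReal.coe_lt_coe_iff.1 hr
    obtain ⟨s, hs1, hs2⟩ := exists_between hr'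
    refine le_limsup_of_frequently_le ?_ (by isBoundedDefault)
    have hscale : Tendsto (fun n : ℕ => ((1 / 2) ^ n : ℝ≥0)) atTop (𝓝[>] 0) := by
      refine tendsto_nhdsWithin_iff.2 ⟨?_, Eventually.of_forall fun n => ?_⟩
      · exact NNReal.tendsto_pow_atTop_nhds_zero_of_lt_one (NNReal.half_lt_self one_ne_zero)
      · exact mem_Ioi.2 (by positivity)
    refine hscale.frequently ?_
    refine ((h.frequently_lt_betaN le_rfl (hδ ▸ hs2)).and_eventually
      ((tendsto_log_two_pow.eventually_ge_atTop (Real.log 3 / (s - r))).and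
        (eventually_ne_atTop 0))).mono ?_
    rintro n ⟨h1, h2, hn⟩
    have hL := log_two_pow_pos hn
    have hε : (((1 / 2) ^ n : ℝ≥0) : ℝ) = 1 / 2 ^ n := by
      push_cast; rw [one_div_pow]
    obtain ⟨m, hm0, hm, hratio⟩ := h.exists_coveringNumber_eq (ε := (1 / 2) ^ n) (by positivity)
    have hcard := le_externalCoveringNumber (ν := ν) hε
    rw [hm] at hcard
    have hcard1 : ((cells ν n).card + 2) / 3 ≤ m := by exact_mod_cast hcard
    have hcard2 : (cells ν n).card ≤ 3 * m := by omega
    have hcard3 : ((cells ν n).card : ℝ) ≤ 3 * m := by exact_mod_cast hcard2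
    have hlog := Real.log_le_log (by exact_mod_cast (h.cells_nonempty n).card_pos) hcard3
    rw [Real.log_mul (by norm_num) (by exact_mod_cast hm0.ne')] at hlog
    rw [hratio, EReal.coe_le_coe_iff, hε, Real.log_div one_ne_zero (by positivity), Real.log_one,
      zero_sub, neg_neg, le_div_iff₀ hL]
    rw [betaN_eq, partitionSum_zero, lt_div_iff₀ hL] at h1
    rw [div_le_iff₀ (by linarith)] at h2
    linarith

end Minkowski

/-! ## Hausdorff dimensions of the measure -/

section BorelCantelli

variable {ν : Measure ℝ}

open Classical in
/-- The union of the cells of order `n` whose position satisfies `p`. -/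
def cellUnion (n : ℕ) (p : ℕ → Prop) : Set ℝ :=
  ⋃ k ∈ (Finset.range (2 ^ n)).filter p, dyadic n k

lemma measurableSet_cellUnion (n : ℕ) (p : ℕ → Prop) : MeasurableSet (cellUnion n p) :=
  Finset.measurableSet_biUnion _ fun k _ => measurableSet_dyadic n k

lemma mem_cellUnion {n k : ℕ} {p : ℕ → Prop} (hk : k < 2 ^ n) (hp : p k) {x : ℝ}
    (hx : x ∈ dyadic n k) : x ∈ cellUnion n p := by
  classical
  exact mem_iUnion₂.2 ⟨k, Finset.mem_filter.2 ⟨Finset.mem_range.2 hk, hp⟩, hx⟩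

/-- The points of `(0,1]` outside of the given cells of all orders at least `m`. -/
def avoidingSet (p : ℕ → ℕ → Prop) (m : ℕ) : Set ℝ :=
  Ioc (0 : ℝ) 1 ∩ ⋂ n ≥ m, (cellUnion n (p n))ᶜ

lemma measurableSet_avoidingSet (p : ℕ → ℕ → Prop) (m : ℕ) :
    MeasurableSet (avoidingSet p m) :=
  measurableSet_Ioc.inter (MeasurableSet.biInter (to_countable _) fun n _ =>
    (measurableSet_cellUnion n (p n)).compl)

lemma not_of_mem_avoidingSet {p : ℕ → ℕ → Prop} {m n k : ℕ} {x : ℝ} (hx : x ∈ avoidingSet p m)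
    (hn : m ≤ n) (hk : k < 2 ^ n) (hxk : x ∈ dyadic n k) : ¬ p n k := fun hp =>
  mem_iInter₂.1 hx.2 n hn (mem_cellUnion hk hp hxk)

lemma UnitSupported.compl_iUnion_avoidingSet (h : UnitSupported ν) {p : ℕ → ℕ → Prop}
    (hp : ∀ᵐ x ∂ν, ∀ᶠ n in atTop, x ∉ cellUnion n (p n)) :
    ν (⋃ m, avoidingSet p m)ᶜ = 0 := by
  have : ∀ᵐ x ∂ν, x ∈ ⋃ m, avoidingSet p m := by
    filter_upwards [hp, h.ae_mem] with x hx hx'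
    obtain ⟨m, hm⟩ := eventually_atTop.1 hx
    exact mem_iUnion.2 ⟨m, hx', mem_iInter₂.2 fun n hn => hm n hn⟩
  exact this

variable [IsFiniteMeasure ν]

open Classical in
lemma measureReal_cellUnion (n : ℕ) (p : ℕ → Prop) :
    ν.real (cellUnion n p) = ∑ k ∈ (cells ν n).filter p, mass ν n k := by
  rw [cellUnion, measureReal_biUnion_finset (fun i _ j _ hij => dyadic_disjoint hij)
    (fun k _ => measurableSet_dyadic n k)]
  symm
  refine Finset.sum_subset (fun k hk => ?_) fun k hk hk' => ?_
  · obtain ⟨h1, h2⟩ := Finset.mem_filter.1 hk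
    exact Finset.mem_filter.2 ⟨Finset.mem_range.2 (lt_of_mem_cells h1), h2⟩
  · obtain ⟨h1, h2⟩ := Finset.mem_filter.1 hk
    by_contra hne
    exact hk' (Finset.mem_filter.2 ⟨mem_cells.2 ⟨Finset.mem_range.1 h1,
      lt_of_le_of_ne measureReal_nonneg (Ne.symm hne)⟩, h2⟩)

/-- Borel-Cantelli: if the cells satisfying `p` have mass bounded through the partition sum at `t`
with a negative total exponent, then almost every point is eventually outside of these cells. -/
lemma UnitSupported.ae_eventually_notMem_cellUnion (h : UnitSupported ν) {t e : ℝ} (ht : 0 ≤ t)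
    (he : betaReal ν t + e < 0) {p : ℕ → ℕ → Prop}
    (hp : ∀ n, ∀ k ∈ cells ν n, p n k → mass ν n k ≤ mass ν n k ^ t * ((2 : ℝ) ^ n) ^ e) :
    ∀ᵐ x ∂ν, ∀ᶠ n in atTop, x ∉ cellUnion n (p n) := by
  classical
  obtain ⟨s, hs1, hs2⟩ := exists_between he
  have hgeo : Summable fun n : ℕ => ((2 : ℝ) ^ s) ^ n :=
    summable_geometric_of_lt_one (by positivity)
      (Real.rpow_lt_one_of_one_lt_of_neg (by norm_num) hs2)
  have hsum : Summable fun n => ν.real (cellUnion n (p n)) := by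
    refine hgeo.of_norm_bounded_eventually_nat ?_
    filter_upwards [h.eventually_betaN_lt ht (show betaReal ν t < s - e by linarith),
      eventually_ne_atTop 0] with n hn hn0
    have hX1 : (1 : ℝ) ≤ 2 ^ n := one_le_pow₀ (by norm_num)
    have hX0 : (0 : ℝ) < 2 ^ n := by positivity
    rw [Real.norm_of_nonneg measureReal_nonneg, measureReal_cellUnion]
    calc ∑ k ∈ (cells ν n).filter (p n), mass ν n k
        ≤ ∑ k ∈ (cells ν n).filter (p n), mass ν n k ^ t * ((2 : ℝ) ^ n) ^ e :=
          Finset.sum_le_sum fun k hk =>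
            hp n k (Finset.mem_filter.1 hk).1 (Finset.mem_filter.1 hk).2
      _ ≤ ∑ k ∈ cells ν n, mass ν n k ^ t * ((2 : ℝ) ^ n) ^ e :=
          Finset.sum_le_sum_of_subset_of_nonneg (Finset.filter_subset _ _) fun k hk _ => by
            have := mass_pos hk
            positivity
      _ = ((2 : ℝ) ^ n) ^ (betaN ν n t + e) := by
          rw [← Finset.sum_mul, Real.rpow_add hX0, ← h.partitionSum_eq_rpow hn0]
          rfl
      _ ≤ ((2 : ℝ) ^ n) ^ s := Real.rpow_le_rpow_of_exponent_le hX1 (by linarith)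
      _ = ((2 : ℝ) ^ s) ^ n := by
          rw [← Real.rpow_natCast 2 n, ← Real.rpow_mul (by norm_num), mul_comm,
            Real.rpow_mul (by norm_num), Real.rpow_natCast]
  refine ae_eventually_notMem ?_
  have := hsum.tsum_ofReal_ne_top
  simpa [Measure.real, ENNReal.ofReal_toReal] using this

/-- If the spectrum lies below the line of slope `-d` through `(1,0)` somewhere to the left of `1`,
then the Hausdorff dimension of the measure is at most `d`. -/
lemma UnitSupported.measureHausdorffDim_le (h : UnitSupported ν) {t : ℝ} {d : ℝ≥0} (ht0 : 0 ≤ t)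
    (ht1 : t ≤ 1) (hlt : betaReal ν t < d * (1 - t)) : measureHausdorffDim ν ≤ d := by
  classical
  -- Cells of mass below `2^{-nd}` satisfy `ν(C) ≤ ν(C)^t 2^{-nd(1-t)}`, so their total masses are
  -- summable over `n`.
  set p : ℕ → ℕ → Prop := fun n k => mass ν n k < ((2 : ℝ) ^ n) ^ (-(d : ℝ)) with hp
  have hae := h.ae_eventually_notMem_cellUnion (p := p) ht0
    (show betaReal ν t + -(d * (1 - t)) < 0 by linarith) (fun n k hk hpk => by
      have hm := mass_pos hk
      have hX0 : (0 : ℝ) < 2 ^ n := by positivity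
      calc mass ν n k = mass ν n k ^ t * mass ν n k ^ (1 - t) := by
            rw [← Real.rpow_add hm, add_sub_cancel, Real.rpow_one]
        _ ≤ mass ν n k ^ t * (((2 : ℝ) ^ n) ^ (-(d : ℝ))) ^ (1 - t) := by
            have h1 := Real.rpow_le_rpow hm.le (le_of_lt hpk) (sub_nonneg.2 ht1)
            exact mul_le_mul_of_nonneg_left h1 (Real.rpow_pos_of_pos hm t).le
        _ = mass ν n k ^ t * ((2 : ℝ) ^ n) ^ (-(d * (1 - t))) := by
            rw [← Real.rpow_mul hX0.le, neg_mul])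
  have hmeas : MeasurableSet (⋃ m, avoidingSet p m) :=
    MeasurableSet.iUnion fun m => measurableSet_avoidingSet p m
  refine (iInf_le _ (⋃ m, avoidingSet p m)).trans ((iInf_le _ hmeas).trans
    ((iInf_le _ (h.compl_iUnion_avoidingSet hae)).trans ?_))
  rw [dimH_iUnion]
  refine iSup_le fun m => dimH_le_of_covers (M := ν.real univ) fun ρ hρ => ?_
  obtain ⟨n, hnm, hnρ⟩ : ∃ n, m ≤ n ∧ (1 : ℝ) / 2 ^ n ≤ ρ := by
    have h1 : Tendsto (fun n : ℕ => ((1 : ℝ) / 2) ^ n) atTop (𝓝 0) :=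
      tendsto_pow_atTop_nhds_zero_of_lt_one (by norm_num) (by norm_num)
    obtain ⟨n, h2, h3⟩ := ((h1.eventually (gt_mem_nhds hρ)).and (eventually_ge_atTop m)).exists
    rw [one_div_pow] at h2
    exact ⟨n, h3, h2.le⟩
  have hX0 : (0 : ℝ) < 2 ^ n := by positivity
  -- The remaining points are covered by cells of mass at least `2^{-nd}`, and there are at most
  -- `ν(ℝ) 2^{nd}` of them.
  set F := (cells ν n).filter (fun k => ¬ p n k) with hF
  refine ⟨1 / 2 ^ n, by positivity, hnρ, F.image (rightEndpoint n), fun x hx => ?_, ?_⟩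
  · obtain ⟨k, hk, hxk⟩ := exists_mem_dyadic n hx.1
    have hnp := not_of_mem_avoidingSet hx hnm hk hxk
    have hkc : k ∈ cells ν n :=
      mem_cells.2 ⟨hk, (Real.rpow_pos_of_pos hX0 _).trans_le (not_lt.1 hnp)⟩
    exact mem_iUnion₂.2 ⟨rightEndpoint n k,
      Finset.mem_image_of_mem _ (Finset.mem_filter.2 ⟨hkc, hnp⟩), dyadic_subset_closedBall n k hxk⟩
  · have hinv : ((1 : ℝ) / 2 ^ n) ^ (d : ℝ) = ((2 : ℝ) ^ n) ^ (-(d : ℝ)) := by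
      rw [one_div, Real.inv_rpow hX0.le, Real.rpow_neg hX0.le]
    calc ((F.image (rightEndpoint n)).card : ℝ) * (1 / 2 ^ n) ^ (d : ℝ)
        ≤ F.card * ((2 : ℝ) ^ n) ^ (-(d : ℝ)) := by
          rw [hinv]
          gcongr
          exact Finset.card_image_le
      _ ≤ ∑ k ∈ F, mass ν n k := by
          rw [← nsmul_eq_mul]
          exact Finset.card_nsmul_le_sum _ _ _ fun k hk => not_lt.1 (Finset.mem_filter.1 hk).2
      _ ≤ ∑ k ∈ cells ν n, mass ν n k :=
          Finset.sum_le_sum_of_subset_of_nonneg (Finset.filter_subset _ _) fun k _ _ =>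
            measureReal_nonneg
      _ = ν.real univ := h.sum_mass n

/-- A set of diameter at most `2⁻ⁿ` meets at most three neighbouring cells of order `n`. -/
lemma exists_subset_three_cells {n : ℕ} {s : Set ℝ} (hs : Metric.ediam s ≤ ENNReal.ofReal (1 / 2 ^ n))
    (hs1 : s ⊆ Ioc (0 : ℝ) 1) :
    ∃ k : ℕ, s ⊆ ⋃ j ∈ Finset.Icc (k - 1) (k + 1), dyadic n j ∩ s := by
  rcases s.eq_empty_or_nonempty with rfl | ⟨y, hy⟩
  · exact ⟨0, empty_subset _⟩
  have h2 : (0 : ℝ) < 2 ^ n := by positivity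
  obtain ⟨k, -, hyk⟩ := exists_mem_dyadic n (hs1 hy)
  refine ⟨k, fun x hx => ?_⟩
  obtain ⟨j, -, hxj⟩ := exists_mem_dyadic n (hs1 hx)
  have hd : |x - y| ≤ 1 / 2 ^ n := by
    have h1 := (Metric.edist_le_ediam_of_mem hx hy).trans hs
    rw [edist_dist] at h1
    exact (ENNReal.ofReal_le_ofReal_iff (by positivity)).1 h1
  have hd' : |2 ^ n * x - 2 ^ n * y| ≤ 1 := by
    rw [← mul_sub, abs_mul, abs_of_pos h2, mul_comm, ← le_div_iff₀ h2]
    exact hd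
  obtain ⟨a1, a2⟩ := abs_le.1 hd'
  obtain ⟨b1, b2⟩ := mem_dyadic_iff.1 hyk
  obtain ⟨c1, c2⟩ := mem_dyadic_iff.1 hxj
  have e1 : (j : ℝ) < k + 2 := by linarith
  have e2 : (k : ℝ) < j + 2 := by linarith
  have e1' : j < k + 2 := by exact_mod_cast e1
  have e2' : k < j + 2 := by exact_mod_cast e2
  exact mem_iUnion₂.2 ⟨j, Finset.mem_Icc.2 ⟨by omega, by omega⟩, hxj, hx⟩

/-- The mass of small subsets of a set avoiding all cells with mass above `2^{-nd}`. -/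
lemma measureReal_avoidingSet_le {d : ℝ} {m n : ℕ} (hmn : m ≤ n) {s : Set ℝ}
    (hs : Metric.ediam s ≤ ENNReal.ofReal (1 / 2 ^ n)) :
    ν.real (s ∩ avoidingSet (fun n k => ((2 : ℝ) ^ n) ^ (-d) < mass ν n k) m) ≤
      3 * ((2 : ℝ) ^ n) ^ (-d) := by
  set G := avoidingSet (fun n k => ((2 : ℝ) ^ n) ^ (-d) < mass ν n k) m with hG
  have hX : (0 : ℝ) < ((2 : ℝ) ^ n) ^ (-d) := by positivity
  obtain ⟨k, hk⟩ := exists_subset_three_cells (s := s ∩ G)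
    ((Metric.ediam_mono inter_subset_left).trans hs) (fun x hx => hx.2.1)
  have hcell : ∀ j, ν.real (dyadic n j ∩ (s ∩ G)) ≤ ((2 : ℝ) ^ n) ^ (-d) := by
    intro j
    rcases (dyadic n j ∩ (s ∩ G)).eq_empty_or_nonempty with h0 | ⟨x, hxj, hxs, hxG⟩
    · rw [h0]; simpa using hX.le
    · obtain ⟨i, hi, hxi⟩ := exists_mem_dyadic n hxG.1
      have hij : i = j := by
        by_contra hne
        exact Set.disjoint_left.1 (dyadic_disjoint hne) hxi hxj
      subst hij
      exact (measureReal_mono inter_subset_left (measure_ne_top ν _)).trans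
        (not_lt.1 (not_of_mem_avoidingSet hxG hmn hi hxi))
  calc ν.real (s ∩ G) ≤ ν.real (⋃ j ∈ Finset.Icc (k - 1) (k + 1), dyadic n j ∩ (s ∩ G)) :=
        measureReal_mono hk (measure_ne_top ν _)
    _ ≤ ∑ j ∈ Finset.Icc (k - 1) (k + 1), ν.real (dyadic n j ∩ (s ∩ G)) :=
        measureReal_biUnion_finset_le _ _
    _ ≤ ∑ _j ∈ Finset.Icc (k - 1) (k + 1), ((2 : ℝ) ^ n) ^ (-d) :=
        Finset.sum_le_sum fun j _ => hcell j
    _ ≤ 3 * ((2 : ℝ) ^ n) ^ (-d) := by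
        rw [Finset.sum_const, nsmul_eq_mul]
        gcongr
        rw [Nat.card_Icc]
        -- At `k = 0` truncated subtraction leaves only two cells, hence an inequality.
        have : k + 1 + 1 - (k - 1) ≤ 3 := by omega
        exact_mod_cast this

/-- The mass distribution bound for the restriction of the measure to an avoiding set. -/
lemma restrict_avoidingSet_le {d : ℝ} (hd : 0 < d) (m : ℕ) {s : Set ℝ}
    (hs : Metric.ediam s ≤ ENNReal.ofReal (1 / 2 ^ m)) :
    ν.restrict (avoidingSet (fun n k => ((2 : ℝ) ^ n) ^ (-d) < mass ν n k) m) s ≤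
      ENNReal.ofReal (3 * 2 ^ d) * Metric.ediam s ^ d := by
  rw [Measure.restrict_apply' (measurableSet_avoidingSet _ _)]
  set G := avoidingSet (fun n k => ((2 : ℝ) ^ n) ^ (-d) < mass ν n k) m with hG
  obtain ⟨D, hD0, hD⟩ : ∃ D : ℝ, 0 ≤ D ∧ Metric.ediam s = ENNReal.ofReal D :=
    ⟨_, ENNReal.toReal_nonneg,
      (ENNReal.ofReal_toReal (ne_top_of_le_ne_top ENNReal.ofReal_ne_top hs)).symm⟩
  rw [hD] at hs ⊢
  have hDm : D ≤ 1 / 2 ^ m := (ENNReal.ofReal_le_ofReal_iff (by positivity)).1 hs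
  rw [ENNReal.ofReal_rpow_of_nonneg hD0 hd.le, ← ENNReal.ofReal_mul (by positivity),
    ← ENNReal.ofReal_toReal (measure_ne_top ν (s ∩ G))]
  apply ENNReal.ofReal_le_ofReal
  change ν.real (s ∩ G) ≤ _
  have hbound : ∀ n ≥ m, D ≤ 1 / 2 ^ n → ν.real (s ∩ G) ≤ 3 * ((2 : ℝ) ^ n) ^ (-d) :=
    fun n hn hDn => measureReal_avoidingSet_le hn (hD ▸ ENNReal.ofReal_le_ofReal hDn)
  -- For zero diameter the bound at all orders tends to `0`. Otherwise `n` is chosen with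
  -- `2^{-(n+1)} < D ≤ 2^{-n}`, and the factor `2^d` comes from the step from `n` to `n + 1`.
  rcases hD0.eq_or_lt with h0 | hpos
  · have hlim : Tendsto (fun n : ℕ => 3 * ((2 : ℝ) ^ n) ^ (-d)) atTop (𝓝 (3 * 0)) :=
      ((tendsto_rpow_neg_atTop hd).comp
        (tendsto_pow_atTop_atTop_of_one_lt (by norm_num : (1 : ℝ) < 2))).const_mul 3
    rw [mul_zero] at hlim
    refine (ge_of_tendsto hlim ?_).trans (by positivity)
    filter_upwards [eventually_ge_atTop m] with n hn
    exact hbound n hn (by rw [← h0]; positivity)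
  · obtain ⟨n, hn1, hn2⟩ := exists_nat_pow_near_of_lt_one hpos
      (hDm.trans ((div_le_one (by positivity)).2 (one_le_pow₀ (by norm_num))))
      (show (0 : ℝ) < 1 / 2 by norm_num) (by norm_num)
    have hmn : m ≤ n := by
      rw [← one_div_pow] at hDm
      have h1 := hn1.trans_le hDm
      have h2 := (pow_lt_pow_iff_right_of_lt_one₀ (by norm_num : (0 : ℝ) < 1 / 2)
        (by norm_num)).1 h1
      omega
    rw [one_div_pow] at hn1 hn2
    refine (hbound n hmn hn2).trans ?_
    have h3 : ((2 : ℝ) ^ n) ^ (-d) = 2 ^ d * (1 / 2 ^ (n + 1)) ^ d := by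
      rw [← Real.mul_rpow (by norm_num) (by positivity), Real.rpow_neg (by positivity),
        ← Real.inv_rpow (by positivity)]
      congr 1
      rw [pow_succ]; field_simp
    rw [h3, mul_assoc]
    gcongr

/-- If the spectrum lies below the line of slope `-d` through `(1,0)` somewhere to the right of
`1`, then the lower Hausdorff dimension of the measure is at least `d`. -/
lemma UnitSupported.le_measureLowerHausdorffDim (h : UnitSupported ν) {t : ℝ} {d : ℝ≥0}
    (ht : 1 ≤ t) (hd : 0 < d) (hlt : betaReal ν t < d * (1 - t)) :
    (d : ℝ≥0∞) ≤ measureLowerHausdorffDim ν := by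
  refine le_iInf fun E => le_iInf fun hE => le_iInf fun hEpos => ?_
  set p : ℕ → ℕ → Prop := fun n k => ((2 : ℝ) ^ n) ^ (-(d : ℝ)) < mass ν n k with hp
  have hae := h.ae_eventually_notMem_cellUnion (p := p) (zero_le_one.trans ht)
    (show betaReal ν t + -(d * (1 - t)) < 0 by linarith) (fun n k hk hpk => by
      have hm := mass_pos hk
      have hX0 : (0 : ℝ) < 2 ^ n := by positivity
      calc mass ν n k = mass ν n k ^ t * mass ν n k ^ (1 - t) := by
            rw [← Real.rpow_add hm, add_sub_cancel, Real.rpow_one]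
        _ ≤ mass ν n k ^ t * (((2 : ℝ) ^ n) ^ (-(d : ℝ))) ^ (1 - t) := by
            have h1 := Real.rpow_le_rpow_of_nonpos (Real.rpow_pos_of_pos hX0 _) (le_of_lt hpk)
              (sub_nonpos.2 ht)
            exact mul_le_mul_of_nonneg_left h1 (Real.rpow_pos_of_pos hm t).le
        _ = mass ν n k ^ t * ((2 : ℝ) ^ n) ^ (-(d * (1 - t))) := by
            rw [← Real.rpow_mul hX0.le, neg_mul])
  have hex : ∃ m, ν (E ∩ avoidingSet p m) ≠ 0 := by
    by_contra! hall
    have h1 : ν (E ∩ ⋃ m, avoidingSet p m) = 0 := by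
      rw [inter_iUnion]; exact measure_iUnion_null hall
    have h2 : ν E ≤ 0 := by
      calc ν E ≤ ν (E ∩ ⋃ m, avoidingSet p m) + ν (E \ ⋃ m, avoidingSet p m) :=
            measure_le_inter_add_sdiff ν E _
        _ ≤ 0 + 0 := add_le_add h1.le ((measure_mono fun x hx => hx.2).trans
            (h.compl_iUnion_avoidingSet hae).le)
        _ = 0 := add_zero _
    exact absurd hEpos (not_lt.2 h2)
  obtain ⟨m, hm⟩ := hex
  have hd' : (0 : ℝ) < d := NNReal.coe_pos.2 hd
  set c : ℝ≥0∞ := ENNReal.ofReal (3 * 2 ^ (d : ℝ)) with hc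
  have hc0 : c ≠ 0 := by
    rw [hc, Ne, ENNReal.ofReal_eq_zero, not_le]; positivity
  have hctop : c ≠ ∞ := ENNReal.ofReal_ne_top
  -- Mass distribution principle: a multiple of the restricted measure is dominated by Hausdorff
  -- measure, so `E`, being charged by the restriction, is not a null set for `μH[d]`.
  have hle : c⁻¹ • ν.restrict (avoidingSet p m) ≤ μH[(d : ℝ)] := by
    refine Measure.le_hausdorffMeasure _ _ (ENNReal.ofReal (1 / 2 ^ m))
      (ENNReal.ofReal_pos.2 (by positivity)) fun s hs => ?_
    rw [Measure.smul_apply, smul_eq_mul, mul_comm, ← div_eq_mul_inv]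
    refine ENNReal.div_le_of_le_mul ?_
    rw [mul_comm]
    exact restrict_avoidingSet_le hd' m hs
  refine le_dimH_of_hausdorffMeasure_ne_zero fun h0 => hm ?_
  have h1 := hle E
  rw [h0, Measure.smul_apply, smul_eq_mul, Measure.restrict_apply hE, nonpos_iff_eq_zero,
    mul_eq_zero] at h1
  exact h1.resolve_left (ENNReal.inv_ne_zero.2 hctop)

end BorelCantelli

/-! ## The slopes of the spectrum at `1` -/

section Slopes

variable {ν : Measure ℝ} [IsFiniteMeasure ν]

/-- The spectrum is affine on `[0,1]`. -/
def SpectrumAffine (ν : Measure ℝ) : Prop :=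
  ∀ t ∈ Ico (0 : ℝ) 1, betaReal ν t = deltaStar ν * (1 - t)

lemma UnitSupported.deltaStar_nonneg (h : UnitSupported ν) : 0 ≤ deltaStar ν :=
  h.betaReal_nonneg ⟨le_rfl, zero_le_one⟩

lemma UnitSupported.betaReal_convex_comb (h : UnitSupported ν) {x y a b : ℝ} (hx : 0 ≤ x)
    (hy : 0 ≤ y) (ha : 0 ≤ a) (hb : 0 ≤ b) (hab : a + b = 1) :
    betaReal ν (a * x + b * y) ≤ a * betaReal ν x + b * betaReal ν y :=
  h.convexOn_betaReal.2 hx hy ha hb hab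

/-- The slopes of the chords ending at `1` are monotone. -/
lemma UnitSupported.betaReal_div_antitone (h : UnitSupported ν) {s t : ℝ} (hs : 0 ≤ s)
    (hst : s ≤ t) (ht : t < 1) : betaReal ν t / (1 - t) ≤ betaReal ν s / (1 - s) := by
  have h1 : 0 < 1 - s := by linarith
  have h2 : 0 < 1 - t := by linarith
  have hc := h.betaReal_convex_comb hs (zero_le_one (α := ℝ))
    (a := (1 - t) / (1 - s)) (b := (t - s) / (1 - s)) (by positivity)
    (div_nonneg (by linarith) h1.le) (by field_simp; ring)
  have e : ((1 - t) / (1 - s)) * s + ((t - s) / (1 - s)) * (1 : ℝ) = t := by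
    field_simp; ring
  rw [e, h.betaReal_one, mul_zero, add_zero] at hc
  rw [div_le_iff₀ h2]
  calc betaReal ν t ≤ (1 - t) / (1 - s) * betaReal ν s := hc
    _ = betaReal ν s / (1 - s) * (1 - t) := by ring

lemma UnitSupported.betaReal_le_chord (h : UnitSupported ν) {t : ℝ} (ht : t ∈ Ico (0 : ℝ) 1) :
    betaReal ν t ≤ deltaStar ν * (1 - t) := by
  have h1 := h.betaReal_div_antitone le_rfl ht.1 ht.2
  rw [sub_zero, div_one, div_le_iff₀ (by linarith [ht.2])] at h1
  exact h1

lemma UnitSupported.spectrumAffine_of_le (h : UnitSupported ν)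
    (hle : ∀ t ∈ Ico (0 : ℝ) 1, deltaStar ν ≤ betaReal ν t / (1 - t)) : SpectrumAffine ν :=
  fun t ht => le_antisymm (h.betaReal_le_chord ht) (by
    rw [← le_div_iff₀ (by linarith [ht.2])]; exact hle t ht)

/-- The quotients `β(t)/(1-t)` decrease by convexity from their value `δ*` at `t = 0`; their limit
equals `δ*` only if they are constant. -/
lemma UnitSupported.deltaUpperEq_iff (h : UnitSupported ν) :
    DeltaUpperEq ν (deltaStar ν) ↔ SpectrumAffine ν := by
  constructor
  · intro hlim
    refine h.spectrumAffine_of_le fun t ht => le_of_tendsto hlim ?_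
    filter_upwards [Ioo_mem_nhdsLT ht.2] with u hu
    exact h.betaReal_div_antitone ht.1 hu.1.le hu.2
  · intro haff
    refine tendsto_const_nhds.congr' ?_
    filter_upwards [Ioo_mem_nhdsLT (zero_lt_one (α := ℝ))] with t ht
    have h1 : 1 - t ≠ 0 := by linarith [ht.2]
    change _ = betaReal ν t / (1 - t)
    rw [haff t ⟨ht.1.le, ht.2⟩, mul_div_cancel_right₀ _ h1]

/-- A convex function touching its chord at an interior point coincides with it. -/
lemma UnitSupported.spectrumAffine_of_eq (h : UnitSupported ν) {q : ℝ} (hq : q ∈ Ioo (0 : ℝ) 1)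
    (heq : betaReal ν q = deltaStar ν * (1 - q)) : SpectrumAffine ν := by
  refine h.spectrumAffine_of_le fun t ht => ?_
  have h1q : 0 < 1 - q := by linarith [hq.2]
  rcases le_total t q with htq | htq
  · refine le_trans ?_ (h.betaReal_div_antitone ht.1 htq hq.2)
    rw [heq, mul_div_cancel_right₀ _ h1q.ne']
  -- Now `q` lies between `0` and `t`; a value at `t` below the chord would push `β(q)` below the
  -- chord as well.
  · have ht0 : 0 < t := hq.1.trans_le htq
    have hc := h.betaReal_convex_comb le_rfl ht0.le
      (a := (t - q) / t) (b := q / t) (div_nonneg (by linarith) ht0.le)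
      (div_nonneg hq.1.le ht0.le) (by field_simp; ring)
    have e : ((t - q) / t) * (0 : ℝ) + (q / t) * t = q := by
      field_simp; ring
    rw [e, heq] at hc
    change _ ≤ (t - q) / t * deltaStar ν + _ at hc
    have h2 : deltaStar ν * (1 - q) * t ≤ (t - q) * deltaStar ν + q * betaReal ν t := by
      calc deltaStar ν * (1 - q) * t
          ≤ ((t - q) / t * deltaStar ν + q / t * betaReal ν t) * t := by gcongr
        _ = (t - q) * deltaStar ν + q * betaReal ν t := by field_simp
    rw [le_div_iff₀ (by linarith [ht.2])]
    have h3 : q * (deltaStar ν * (1 - t)) ≤ q * betaReal ν t := by linarith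
    exact le_of_mul_le_mul_left h3 hq.1

/-- The chord `δ*(1-t)` meets the diagonal at `δ*/(1+δ*)`. Since a positive `q̄` is a fixed point of
`β`, having this value means touching the chord at an interior point, unless `δ* = 0`, where `β`
vanishes on `[0,1]`. -/
lemma UnitSupported.spectrumAffine_iff (h : UnitSupported ν) :
    SpectrumAffine ν ↔ qBar ν = deltaStar ν / (1 + deltaStar ν) := by
  have hδ := h.deltaStar_nonneg
  have hδ1 : 0 < 1 + deltaStar ν := by linarith
  constructor
  · intro haff
    rw [eq_div_iff hδ1.ne']
    rcases h.qBar_nonneg.eq_or_lt with h0 | hpos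
    -- The fixed point equation is not available at `q̄ = 0`; instead `β(1/2) ≤ q̄ = 0` forces `δ* =
    -- 0`.
    · have h1 := haff (1 / 2) ⟨by norm_num, by norm_num⟩
      have h2 := h.betaReal_le_qBar (q := 1 / 2) (by rw [← h0]; norm_num)
      rw [← h0, h1] at h2
      rw [← h0]
      linarith
    · have hfix := h.betaReal_qBar hpos
      rcases h.qBar_le_one.lt_or_eq with hlt | heq
      · rw [haff _ ⟨hpos.le, hlt⟩] at hfix
        linarith
      · rw [heq, h.betaReal_one] at hfix
        linarith
  · intro hq
    rcases hδ.eq_or_lt with h0 | hpos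
    · refine h.spectrumAffine_of_le fun t ht => ?_
      rw [← h0]
      exact div_nonneg (h.betaReal_nonneg ⟨ht.1, ht.2.le⟩) (by linarith [ht.2])
    · have hq0 : 0 < qBar ν := by rw [hq]; positivity
      have hq1 : qBar ν < 1 := by rw [hq, div_lt_one hδ1]; linarith
      refine h.spectrumAffine_of_eq ⟨hq0, hq1⟩ ?_
      rw [h.betaReal_qBar hq0, hq]
      field_simp
      ring

lemma UnitSupported.hasSpectralDim_iff (h : UnitSupported ν) (hreg : IsLqRegular ν) {s : ℝ} :
    HasSpectralDim ν s ↔ qBar ν = s :=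
  ⟨fun hs => tendsto_nhds_unique (h.hasSpectralDim_qBar hreg) hs,
    fun hs => hs ▸ h.hasSpectralDim_qBar hreg⟩

/-- By convexity, chords from `1` to the right are at least as steep upwards as chords into `1` from
the left, so `β(u)/(1-u) ≤ β(t)/(1-t)` for `t < 1 < u`. Letting `u` decrease to `1` gives `δ* ≤
β(t)/(1-t)`. -/
lemma UnitSupported.spectrumAffine_of_deltaLowerEq (h : UnitSupported ν)
    (hlim : DeltaLowerEq ν (deltaStar ν)) : SpectrumAffine ν := by
  refine h.spectrumAffine_of_le fun t ht => le_of_tendsto hlim ?_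
  filter_upwards [self_mem_nhdsWithin] with u hu
  have hu1 : 1 < u := hu
  have h1 : 0 < 1 - t := by linarith [ht.2]
  have h2 : 0 < u - 1 := by linarith
  have h3 : 0 < u - t := by linarith
  have hc := h.betaReal_convex_comb ht.1 (zero_le_one.trans hu1.le)
    (a := (u - 1) / (u - t)) (b := (1 - t) / (u - t)) (by positivity) (by positivity)
    (by field_simp; ring)
  have e : ((u - 1) / (u - t)) * t + ((1 - t) / (u - t)) * u = 1 := by
    field_simp; ring
  rw [e, h.betaReal_one] at hc
  have h4 : 0 ≤ (u - 1) * betaReal ν t + (1 - t) * betaReal ν u := by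
    calc (0 : ℝ) ≤ ((u - 1) / (u - t) * betaReal ν t + (1 - t) / (u - t) * betaReal ν u) * (u - t) :=
          mul_nonneg hc h3.le
      _ = _ := by field_simp
  change betaReal ν u / (1 - u) ≤ betaReal ν t / (1 - t)
  rw [← neg_div_neg_eq, neg_sub, div_le_div_iff₀ h2 h1]
  linarith

/-- Every `d` above `β(t)/(1-t)` bounds the Hausdorff dimension, which here equals `δ*`; no chord
quotient can then fall below `δ*`. -/
lemma UnitSupported.spectrumAffine_of_dim_eq (h : UnitSupported ν)
    (hdim : measureMinkowskiDim ν = measureHausdorffDim ν) : SpectrumAffine ν := by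
  refine h.spectrumAffine_of_le fun t ht => le_of_forall_gt_imp_ge_of_dense fun d hd => ?_
  have h1 : 0 < 1 - t := by linarith [ht.2]
  have hd0 : 0 ≤ d := (div_nonneg (h.betaReal_nonneg ⟨ht.1, ht.2.le⟩) h1.le).trans hd.le
  lift d to ℝ≥0 using hd0
  have h2 := h.measureHausdorffDim_le (d := d) ht.1 ht.2.le (by
    rw [div_lt_iff₀ h1] at hd; exact hd)
  rw [← hdim, h.measureMinkowskiDim_eq, ← ENNReal.ofReal_coe_nnreal] at h2
  exact (ENNReal.ofReal_le_ofReal_iff d.coe_nonneg).1 h2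

/-- Affineness makes the left derivative at `1` equal to `-δ*`, and differentiability carries it to
the right side. Each `d < δ*` then has some `u > 1` with `β(u) < d(1-u)`, as the mass distribution
bound requires; that bound needs `d > 0`, so `d = 0` is separate. -/
lemma UnitSupported.ofReal_deltaStar_le (h : UnitSupported ν) (haff : SpectrumAffine ν)
    (hdiff : DifferentiableAt ℝ (betaReal ν) 1) :
    ENNReal.ofReal (deltaStar ν) ≤ measureLowerHausdorffDim ν := by
  have hslope := hasDerivAt_iff_tendsto_slope.1 hdiff.hasDerivAt
  have hleft : Tendsto (slope (betaReal ν) 1) (𝓝[<] 1) (𝓝 (deriv (betaReal ν) 1)) :=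
    hslope.mono_left (nhdsWithin_mono 1 (show Iio (1 : ℝ) ⊆ {1}ᶜ from fun y hy => ne_of_lt hy))
  have hright : Tendsto (slope (betaReal ν) 1) (𝓝[>] 1) (𝓝 (deriv (betaReal ν) 1)) :=
    hslope.mono_left (nhdsWithin_mono 1 (show Ioi (1 : ℝ) ⊆ {1}ᶜ from fun y hy => ne_of_gt hy))
  have hconst : Tendsto (slope (betaReal ν) 1) (𝓝[<] 1) (𝓝 (-deltaStar ν)) := by
    refine tendsto_const_nhds.congr' ?_
    filter_upwards [Ioo_mem_nhdsLT (zero_lt_one (α := ℝ))] with t ht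
    have h1 : t - 1 ≠ 0 := by linarith [ht.2]
    rw [slope_def_field, haff t ⟨ht.1.le, ht.2⟩, h.betaReal_one, eq_div_iff h1]
    ring
  have hderiv : deriv (betaReal ν) 1 = -deltaStar ν := tendsto_nhds_unique hleft hconst
  rw [hderiv] at hright
  refine ENNReal.le_of_forall_nnreal_lt fun d hd => ?_
  rcases eq_or_ne d 0 with rfl | hd0
  · simp
  have hdlt : (d : ℝ) < deltaStar ν := by
    rw [← ENNReal.ofReal_coe_nnreal] at hd
    exact (ENNReal.ofReal_lt_ofReal_iff_of_nonneg d.coe_nonneg).1 hd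
  obtain ⟨u, hu, hu1⟩ :=
    ((hright.eventually (gt_mem_nhds (neg_lt_neg hdlt))).and self_mem_nhdsWithin).exists
  have hu1' : 1 < u := hu1
  rw [slope_def_field, h.betaReal_one, sub_zero, div_lt_iff₀ (by linarith)] at hu
  exact h.le_measureLowerHausdorffDim hu1'.le (pos_iff_ne_zero.2 hd0) (by linarith)

end Slopes

end KreinFeller

end

/-! ### The equivalences and the cycle of dimension inequalities -/

theorem corollary1p7 (ν : Measure ℝ) [IsFiniteMeasure ν] (hν_ne : ν ≠ 0)
    (hν_supp : ν (Ioo (0 : ℝ) 1)ᶜ = 0) (hreg : KreinFeller.IsLqRegular ν) :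
    (∃ s : ℝ, KreinFeller.HasSpectralDim ν s) ∧
    (KreinFeller.DeltaUpperEq ν (KreinFeller.deltaStar ν) ↔
      KreinFeller.HasSpectralDim ν
        (KreinFeller.deltaStar ν / (1 + KreinFeller.deltaStar ν))) ∧
    (KreinFeller.DeltaLowerEq ν (KreinFeller.deltaStar ν) →
      KreinFeller.HasSpectralDim ν
        (KreinFeller.deltaStar ν / (1 + KreinFeller.deltaStar ν))) ∧
    (KreinFeller.measureMinkowskiDim ν = KreinFeller.measureHausdorffDim ν →
      KreinFeller.HasSpectralDim ν
        (KreinFeller.deltaStar ν / (1 + KreinFeller.deltaStar ν))) ∧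
    (KreinFeller.BetaDifferentiableAt ν 1 →
      KreinFeller.HasSpectralDim ν
        (KreinFeller.deltaStar ν / (1 + KreinFeller.deltaStar ν)) →
      KreinFeller.measureMinkowskiDim ν = KreinFeller.measureHausdorffDim ν ∧
      KreinFeller.measureHausdorffDim ν = KreinFeller.measureLowerHausdorffDim ν ∧
      KreinFeller.measureLowerHausdorffDim ν = KreinFeller.measurePackingDim ν) := by
  have h : KreinFeller.UnitSupported ν := ⟨hν_ne, hν_supp⟩
  have hdim := h.hasSpectralDim_iff hreg
    (s := KreinFeller.deltaStar ν / (1 + KreinFeller.deltaStar ν))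
  have haff := h.spectrumAffine_iff.trans hdim.symm
  refine ⟨⟨_, h.hasSpectralDim_qBar hreg⟩, h.deltaUpperEq_iff.trans haff,
    fun hδ => haff.1 (h.spectrumAffine_of_deltaLowerEq hδ),
    fun hd => haff.1 (h.spectrumAffine_of_dim_eq hd), fun hdiff hs => ?_⟩
  -- Minkowski dimension at most lower Hausdorff dimension is the only nontrivial link; the other
  -- three hold for every nonzero `ν` and close the cycle.
  have h1 := h.measureMinkowskiDim_eq.trans_le (h.ofReal_deltaStar_le (haff.2 hs) hdiff.2)
  have h2 := KreinFeller.measureLowerHausdorffDim_le_measureHausdorffDim hν_ne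
  have h3 := KreinFeller.measureHausdorffDim_le_measurePackingDim ν
  have h4 := KreinFeller.measurePackingDim_le_measureMinkowskiDim ν
  exact ⟨le_antisymm (h1.trans h2) (h3.trans h4), le_antisymm (h3.trans (h4.trans h1)) h2,
    le_antisymm (h2.trans h3) (h4.trans h1)⟩
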